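/- **Setting.** For $c=(c_1,c_2,c_3)\in\mathbb R^3$ put $P_c(x)=c_1(1-x)+c_2(1+x)+c_3(1-x^2)$. A pair $U=(U_\theta,U_\phi)$ with $U_\theta\in C^1(-1,1)$, $U_\phi\in C^2(-1,1)$ *solves (NSE) with constants* $\hat c$ if on $(-1,1)$ $$(1-x^2)U_\theta'+2xU_\theta+\tfrac12U_\theta^2+\psi[U_\phi]=P_{\hat c},\qquad (1-x^2)U_\phi''+U_\theta U_\phi'=0,$$ where $\psi[u](x)=\int_0^x\int_0^l\int_0^t\frac{2u(s)u'(s)}{1-s^2}\,ds\,dt\,dl$. Let $\gamma^+(c)$ be the largest value $u(0)$ of a solution $u\in C^1(-1,1)$ of $(1-x^2)u'+2xu+\frac12u^2=P_c$ on $(-1,1)$, let $U^{c,\gamma}_\theta$ be the solution of this equation with value $\gamma$ at $0$, and let $U^{c,\gamma}=(U_\theta^{c,\gamma},0)$; $U_\theta^{c,\gamma}(\pm1)$ denote the limits at $\pm1$. Let $$\bar c_3(c_1,c_2)=-\tfrac12\big(\sqrt{1+c_1}+\sqrt{1+c_2}\big)\big(\sqrt{1+c_1}+\sqrt{1+c_2}+2\big).$$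 For $5\le k\le8$ let $J_k$ be the set of $c$ with $c_3=\bar c_3(c_1,c_2)$ and, respectively, $c_1,c_2>-1$ ($k=5$); $c_1=-1<c_2$ ($k=6$); $c_2=-1<c_1$ ($k=7$); $c_1=c_2=-1$ ($k=8$). For $l=1,2,3$ let $$I_{k,l}=\{(c,\gamma): c\in J_k,\ \gamma=\gamma^+(c),\ c_1<-\tfrac34,\ c_2<-\tfrac34\}.$$ Put $b_{c,\gamma}(x)=\int_0^x\frac{U^{c,\gamma}_\theta(s)}{1-s^2}ds$, $V^3_{c,\gamma}=\big(0,\int_0^xe^{-b_{c,\gamma}(t)}dt\big)$, $V^4_{c,\gamma}=(0,1)$, and $\varphi_{c,\gamma}[u]=(1-x^2)u'+(2x+U_\theta^{c,\gamma})u+\frac12u^2$. For $0<\epsilon<\frac12$ let $\mathbf X=\mathbf M_1\times\mathbf M_2$ with the norm $\|W\|_{\mathbf X}=\|W_\theta\|_{\mathbf M_1}+\|W_\phi\|_{\mathbf M_2}$. Here $\mathbf M_1$ consists of the $f\in C^3(-\frac12,\frac12)\cap C^1(-1,1)\cap C[-1,1]$ with $f(\pm1)=0$ and finite norm $$\|f\|_{\mathbf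 M_1}=\|(1-x^2)^{-1+2\epsilon}f\|_{L^\infty(-1,1)}+\|(1-x^2)^{2\epsilon}f'\|_{L^\infty(-1,1)}+\|f''\|_{L^\infty(-\frac12,\frac12)}+\|f'''\|_{L^\infty(-\frac12,\frac12)},$$ and $\mathbf M_2$ consists of the $f\in C^2(-1,1)$ with finite norm $$\|f\|_{\mathbf M_2}=\|(1-x^2)^{\epsilon}f\|_{L^\infty(-1,1)}+\|(1-x^2)^{1+\epsilon}f'\|_{L^\infty(-1,1)}+\|(1-x^2)^{2+\epsilon}f''\|_{L^\infty(-1,1)}.$$ Let $\mathbf X_3=\{W\in\mathbf X: W_\phi(0)=W_\phi'(0)=0\}$, and let $B_\delta(0)$ be the open ball of radius $\delta$ about $0$ in $\mathbb R^2$. **Theorem.** Let $K$ be a compact set contained in one of the sets $I_{k,l}$ with $5\le k\le 8$, $1\le l\le 3$. Let $0<\epsilon<\frac12$ be such that for every $(c,\gamma)\in K$, with $m=U_\theta^{c,\gamma}(-1)$ and $n=-U^{c,\gamma}_\theta(1)$: $\epsilon>\frac m4$ if $m<2$ and $\epsilon>\frac m2-1$ if $m\ge2$; $\epsilon>\frac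 n4$ if $n<2$ and $\epsilon>\frac n2-1$ if $n\ge 2$. Then there exist $\delta>0$ and $V\in C^\infty(K\times B_\delta(0),\mathbf X_3)$ (the restriction of a map that is $C^\infty$ on $O\times B_\delta(0)$ for some open $O\supseteq K$ in $\mathbb R^4$) such that for all $(c,\gamma)\in K$ $$V(c,\gamma,0)=0,\qquad \frac{\partial V}{\partial\beta_i}\Big|_{\beta=0}=0\quad(i=3,4),$$ where $\beta=(\beta_3,\beta_4)$, and such that for all $(c,\gamma)\in K$ and $\beta\in B_\delta(0)$ $$U=U^{c,\gamma}+\beta_3V^3_{c,\gamma}+\beta_4V^4_{c,\gamma}+V(c,\gamma,\beta)\tag{1}$$ solves (NSE) with the constants $$\hat c_1=c_1+\tfrac12\psi[\tilde U_\phi](-1),\quad \hat c_2=c_2+\tfrac12\psi[\tilde U_\phi](1),\quad \hat c_3=c_3-\tfrac12(\varphi_{c,\gamma}[\tilde U_\theta])''(0),\qquad \tilde U=U-U^{c,\gamma}.$$ Moreover, there is $\delta'>0$ such that if $(c,\gamma)\in K$, $U-U^{c,\gamma}\in\mathbf X$ with $\|U-U^{c,\gamma}\|_{\mathbf X}<\delta'$,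 and $U$ solves (NSE) with some constants $\hat c_1,\hat c_2,\hat c_3$, then (1) holds for some $\beta$ with $|\beta|<\delta$. -/

import Mathlib

open Set Filter Topology MeasureTheory Metric
open scoped ContDiff

noncomputable section

namespace HomNS

/-! ### Weighted sup-norms -/

/-- The weighted function `w f⁽ⁿ⁾` is bounded on `s`. -/
def WBdd (s : Set ℝ) (w : ℝ → ℝ) (n : ℕ) (f : ℝ → ℝ) : Prop :=
  BddAbove (range fun x : s => |w x * iteratedDeriv n f x|)

/-- The norm of `w f⁽ⁿ⁾` in `L^∞(s)`. It is used only for an open interval `s` and for `w` and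
`f⁽ⁿ⁾` continuous on `s`, where the essential supremum is the supremum. -/
def wnorm (s : Set ℝ) (w : ℝ → ℝ) (n : ℕ) (f : ℝ → ℝ) : ℝ :=
  ⨆ x : s, |w x * iteratedDeriv n f x|

lemma wnorm_nonneg (s : Set ℝ) (w : ℝ → ℝ) (n : ℕ) (f : ℝ → ℝ) : 0 ≤ wnorm s w n f :=
  Real.iSup_nonneg fun _ => abs_nonneg _

lemma WBdd.le {s : Set ℝ} {w : ℝ → ℝ} {n : ℕ} {f : ℝ → ℝ} (h : WBdd s w n f) {x : ℝ}
    (hx : x ∈ s) : |w x * iteratedDeriv n f x| ≤ wnorm s w n f :=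
  le_ciSup h ⟨x, hx⟩

lemma wadd_le {s : Set ℝ} {w : ℝ → ℝ} {n : ℕ} {f g : ℝ → ℝ}
    (hf : ∀ x ∈ s, ContDiffAt ℝ n f x) (hg : ∀ x ∈ s, ContDiffAt ℝ n g x)
    (bf : WBdd s w n f) (bg : WBdd s w n g) (x : s) :
    |w x * iteratedDeriv n (f + g) x| ≤ wnorm s w n f + wnorm s w n g := by
  rw [iteratedDeriv_add (hf x x.2) (hg x x.2), mul_add]
  exact (abs_add_le _ _).trans (add_le_add (bf.le x.2) (bg.le x.2))

lemma WBdd.add {s : Set ℝ} {w : ℝ → ℝ} {n : ℕ} {f g : ℝ → ℝ}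
    (hf : ∀ x ∈ s, ContDiffAt ℝ n f x) (hg : ∀ x ∈ s, ContDiffAt ℝ n g x)
    (bf : WBdd s w n f) (bg : WBdd s w n g) : WBdd s w n (f + g) :=
  ⟨_, forall_mem_range.2 (wadd_le hf hg bf bg)⟩

lemma wnorm_add_le {s : Set ℝ} {w : ℝ → ℝ} {n : ℕ} {f g : ℝ → ℝ}
    (hf : ∀ x ∈ s, ContDiffAt ℝ n f x) (hg : ∀ x ∈ s, ContDiffAt ℝ n g x)
    (bf : WBdd s w n f) (bg : WBdd s w n g) :
    wnorm s w n (f + g) ≤ wnorm s w n f + wnorm s w n g :=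
  Real.iSup_le (wadd_le hf hg bf bg) (add_nonneg (wnorm_nonneg _ _ _ _) (wnorm_nonneg _ _ _ _))

lemma wsmul_eq (s : Set ℝ) (w : ℝ → ℝ) (n : ℕ) (f : ℝ → ℝ) (a : ℝ) :
    (fun x : s => |w x * iteratedDeriv n (a • f) x|)
      = fun x : s => |a| * |w x * iteratedDeriv n f x| := by
  funext x
  rw [iteratedDeriv_const_smul_field, smul_eq_mul, ← abs_mul]
  congr 1
  ring

lemma WBdd.smul {s : Set ℝ} {w : ℝ → ℝ} {n : ℕ} {f : ℝ → ℝ} (a : ℝ) (bf : WBdd s w n f) :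
    WBdd s w n (a • f) := by
  unfold WBdd
  rw [wsmul_eq]
  exact ⟨|a| * wnorm s w n f, forall_mem_range.2 fun x =>
    mul_le_mul_of_nonneg_left (bf.le x.2) (abs_nonneg a)⟩

lemma wnorm_smul (s : Set ℝ) (w : ℝ → ℝ) (n : ℕ) (f : ℝ → ℝ) (a : ℝ) :
    wnorm s w n (a • f) = |a| * wnorm s w n f := by
  unfold wnorm
  rw [wsmul_eq, Real.mul_iSup_of_nonneg (abs_nonneg a)]

lemma WBdd.zero (s : Set ℝ) (w : ℝ → ℝ) (n : ℕ) : WBdd s w n 0 := by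
  refine ⟨0, forall_mem_range.2 fun x => ?_⟩
  have h : iteratedDeriv n (0 : ℝ → ℝ) x = 0 := by
    simp
  simp [h]

/-! ### The Banach spaces -/

/-- The interval `(-1, 1)`. -/
abbrev I1 : Set ℝ := Ioo (-1) 1

/-- The interval `(-1/2, 1/2)`. -/
abbrev Ih : Set ℝ := Ioo (-1 / 2) (1 / 2)

/-- The weight `(1 - x²)ʳ`. -/
def wt (r : ℝ) : ℝ → ℝ := fun x => (1 - x ^ 2) ^ r

/-- The constant weight `1`. -/
def wt1 : ℝ → ℝ := fun _ => 1

/-- Membership in `M₁(ε)`. A function on `[-1, 1]` vanishing at `±1` is represented by its extension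
by zero to the real line, so that equal elements are equal functions. -/
structure MemM1 (ε : ℝ) (f : ℝ → ℝ) : Prop where
  smooth_mid : ContDiffOn ℝ 3 f Ih
  smooth : ContDiffOn ℝ 1 f I1
  cont : ContinuousOn f (Icc (-1) 1)
  zero_off : ∀ x, x ∉ I1 → f x = 0
  bdd0 : WBdd I1 (wt (-1 + 2 * ε)) 0 f
  bdd1 : WBdd I1 (wt (2 * ε)) 1 f
  bdd2 : WBdd Ih wt1 2 f
  bdd3 : WBdd Ih wt1 3 f

/-- Membership in `M₂(ε)`. A function on `(-1, 1)` is represented by its extension by zero to the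
real line (no continuity at `±1` is meant). -/
structure MemM2 (ε : ℝ) (f : ℝ → ℝ) : Prop where
  smooth : ContDiffOn ℝ 2 f I1
  zero_off : ∀ x, x ∉ I1 → f x = 0
  bdd0 : WBdd I1 (wt ε) 0 f
  bdd1 : WBdd I1 (wt (1 + ε)) 1 f
  bdd2 : WBdd I1 (wt (2 + ε)) 2 f

namespace MemM1
variable {ε : ℝ} {f : ℝ → ℝ}

lemma cd0 (h : MemM1 ε f) : ∀ x ∈ I1, ContDiffAt ℝ (0 : ℕ) f x := fun _ hx =>
  (h.smooth.contDiffAt (isOpen_Ioo.mem_nhds hx)).of_le (by norm_num)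
lemma cd1 (h : MemM1 ε f) : ∀ x ∈ I1, ContDiffAt ℝ (1 : ℕ) f x := fun _ hx =>
  (h.smooth.contDiffAt (isOpen_Ioo.mem_nhds hx)).of_le (by norm_num)
lemma cd2 (h : MemM1 ε f) : ∀ x ∈ Ih, ContDiffAt ℝ (2 : ℕ) f x := fun _ hx =>
  (h.smooth_mid.contDiffAt (isOpen_Ioo.mem_nhds hx)).of_le (by norm_cast)
lemma cd3 (h : MemM1 ε f) : ∀ x ∈ Ih, ContDiffAt ℝ (3 : ℕ) f x := fun _ hx =>
  (h.smooth_mid.contDiffAt (isOpen_Ioo.mem_nhds hx)).of_le (by norm_cast)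

end MemM1

namespace MemM2
variable {ε : ℝ} {f : ℝ → ℝ}

lemma cd {m : ℕ} (hm : m ≤ 2) (h : MemM2 ε f) : ∀ x ∈ I1, ContDiffAt ℝ m f x := fun _ hx =>
  (h.smooth.contDiffAt (isOpen_Ioo.mem_nhds hx)).of_le (by exact_mod_cast hm)

end MemM2

/-- `M₁(ε)` as a vector space of functions. -/
def M1Sub (ε : ℝ) : Submodule ℝ (ℝ → ℝ) where
  carrier := {f | MemM1 ε f}
  zero_mem' := ⟨contDiffOn_const, contDiffOn_const, continuousOn_const, fun _ _ => rfl,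
    .zero _ _ _, .zero _ _ _, .zero _ _ _, .zero _ _ _⟩
  add_mem' := fun {f g} hf hg => ⟨hf.smooth_mid.add hg.smooth_mid, hf.smooth.add hg.smooth,
    hf.cont.add hg.cont, fun x hx => by simp [hf.zero_off x hx, hg.zero_off x hx],
    .add hf.cd0 hg.cd0 hf.bdd0 hg.bdd0, .add hf.cd1 hg.cd1 hf.bdd1 hg.bdd1,
    .add hf.cd2 hg.cd2 hf.bdd2 hg.bdd2, .add hf.cd3 hg.cd3 hf.bdd3 hg.bdd3⟩
  smul_mem' := fun a f hf => ⟨hf.smooth_mid.const_smul a, hf.smooth.const_smul a,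
    hf.cont.const_smul a, fun x hx => by simp [hf.zero_off x hx],
    hf.bdd0.smul a, hf.bdd1.smul a, hf.bdd2.smul a, hf.bdd3.smul a⟩

/-- `M₂(ε)` as a vector space of functions. -/
def M2Sub (ε : ℝ) : Submodule ℝ (ℝ → ℝ) where
  carrier := {f | MemM2 ε f}
  zero_mem' := ⟨contDiffOn_const, fun _ _ => rfl, .zero _ _ _, .zero _ _ _, .zero _ _ _⟩
  add_mem' := fun {f g} hf hg => ⟨hf.smooth.add hg.smooth,
    fun x hx => by simp [hf.zero_off x hx, hg.zero_off x hx],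
    .add (hf.cd (by norm_num)) (hg.cd (by norm_num)) hf.bdd0 hg.bdd0,
    .add (hf.cd (by norm_num)) (hg.cd (by norm_num)) hf.bdd1 hg.bdd1,
    .add (hf.cd le_rfl) (hg.cd le_rfl) hf.bdd2 hg.bdd2⟩
  smul_mem' := fun a f hf => ⟨hf.smooth.const_smul a, fun x hx => by simp [hf.zero_off x hx],
    hf.bdd0.smul a, hf.bdd1.smul a, hf.bdd2.smul a⟩

/-- The space `M₁(ε)`, a type of its own so that its only topology is that of its norm. -/
def M1 (ε : ℝ) : Type := M1Sub ε

/-- The space `M₂(ε)`, a type of its own so that its only topology is that of its norm. -/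
def M2 (ε : ℝ) : Type := M2Sub ε

instance (ε : ℝ) : AddCommGroup (M1 ε) := inferInstanceAs (AddCommGroup (M1Sub ε))
instance (ε : ℝ) : Module ℝ (M1 ε) := inferInstanceAs (Module ℝ (M1Sub ε))
instance (ε : ℝ) : AddCommGroup (M2 ε) := inferInstanceAs (AddCommGroup (M2Sub ε))
instance (ε : ℝ) : Module ℝ (M2 ε) := inferInstanceAs (Module ℝ (M2Sub ε))

/-- The function underlying an element of `M₁(ε)`. -/
def M1.fn {ε : ℝ} (f : M1 ε) : ℝ → ℝ := f.1

/-- The function underlying an element of `M₂(ε)`. -/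
def M2.fn {ε : ℝ} (f : M2 ε) : ℝ → ℝ := f.1

lemma M1.mem {ε : ℝ} (f : M1 ε) : MemM1 ε f.fn := f.2
lemma M2.mem {ε : ℝ} (f : M2 ε) : MemM2 ε f.fn := f.2
lemma M1.fn_add {ε : ℝ} (f g : M1 ε) : (f + g).fn = f.fn + g.fn := rfl
lemma M2.fn_add {ε : ℝ} (f g : M2 ε) : (f + g).fn = f.fn + g.fn := rfl
lemma M1.fn_smul {ε : ℝ} (a : ℝ) (f : M1 ε) : (a • f).fn = a • f.fn := rfl
lemma M2.fn_smul {ε : ℝ} (a : ℝ) (f : M2 ε) : (a • f).fn = a • f.fn := rfl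

instance (ε : ℝ) : Norm (M1 ε) where
  norm f := wnorm I1 (wt (-1 + 2 * ε)) 0 f.fn + wnorm I1 (wt (2 * ε)) 1 f.fn
    + wnorm Ih wt1 2 f.fn + wnorm Ih wt1 3 f.fn

instance (ε : ℝ) : Norm (M2 ε) where
  norm f := wnorm I1 (wt ε) 0 f.fn + wnorm I1 (wt (1 + ε)) 1 f.fn + wnorm I1 (wt (2 + ε)) 2 f.fn

lemma M1.norm_def {ε : ℝ} (f : M1 ε) : ‖f‖ = wnorm I1 (wt (-1 + 2 * ε)) 0 f.fn
    + wnorm I1 (wt (2 * ε)) 1 f.fn + wnorm Ih wt1 2 f.fn + wnorm Ih wt1 3 f.fn := rfl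

lemma M2.norm_def {ε : ℝ} (f : M2 ε) : ‖f‖ = wnorm I1 (wt ε) 0 f.fn
    + wnorm I1 (wt (1 + ε)) 1 f.fn + wnorm I1 (wt (2 + ε)) 2 f.fn := rfl

lemma eq_zero_of_wnorm {r : ℝ} {f : ℝ → ℝ} (hb : WBdd I1 (wt r) 0 f)
    (h0 : ∀ x, x ∉ I1 → f x = 0) (h : wnorm I1 (wt r) 0 f = 0) : f = 0 := by
  funext x
  by_cases hx : x ∈ I1
  · have h1 := hb.le hx
    rw [h] at h1
    have h2 : wt r x * iteratedDeriv 0 f x = 0 := abs_nonpos_iff.1 h1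
    rw [iteratedDeriv_zero] at h2
    have h3 : 0 < 1 - x ^ 2 := by nlinarith [hx.1, hx.2]
    exact (mul_eq_zero.1 h2).resolve_left (Real.rpow_pos_of_pos h3 r).ne'
  · exact h0 x hx

lemma M1.core (ε : ℝ) : NormedSpace.Core ℝ (M1 ε) where
  norm_nonneg f := by
    rw [M1.norm_def]
    have := wnorm_nonneg I1 (wt (-1 + 2 * ε)) 0 f.fn
    have := wnorm_nonneg I1 (wt (2 * ε)) 1 f.fn
    have := wnorm_nonneg Ih wt1 2 f.fn
    have := wnorm_nonneg Ih wt1 3 f.fn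
    positivity
  norm_smul a f := by
    simp only [M1.norm_def, M1.fn_smul, wnorm_smul, Real.norm_eq_abs]
    ring
  norm_triangle f g := by
    simp only [M1.norm_def, M1.fn_add]
    have hf := f.mem
    have hg := g.mem
    have := wnorm_add_le hf.cd0 hg.cd0 hf.bdd0 hg.bdd0
    have := wnorm_add_le hf.cd1 hg.cd1 hf.bdd1 hg.bdd1
    have := wnorm_add_le hf.cd2 hg.cd2 hf.bdd2 hg.bdd2
    have := wnorm_add_le hf.cd3 hg.cd3 hf.bdd3 hg.bdd3
    linarith
  norm_eq_zero_iff f := by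
    constructor
    · intro h
      rw [M1.norm_def] at h
      have h0 := wnorm_nonneg I1 (wt (-1 + 2 * ε)) 0 f.fn
      have := wnorm_nonneg I1 (wt (2 * ε)) 1 f.fn
      have := wnorm_nonneg Ih wt1 2 f.fn
      have := wnorm_nonneg Ih wt1 3 f.fn
      have h1 : f.fn = 0 := eq_zero_of_wnorm f.mem.bdd0 f.mem.zero_off (by linarith)
      exact Subtype.ext h1
    · rintro rfl
      have h : (0 : M1 ε).fn = (0 : ℝ) • (0 : ℝ → ℝ) := by simp; rfl
      simp only [M1.norm_def, h, wnorm_smul, abs_zero, zero_mul, add_zero]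

lemma M2.core (ε : ℝ) : NormedSpace.Core ℝ (M2 ε) where
  norm_nonneg f := by
    rw [M2.norm_def]
    have := wnorm_nonneg I1 (wt ε) 0 f.fn
    have := wnorm_nonneg I1 (wt (1 + ε)) 1 f.fn
    have := wnorm_nonneg I1 (wt (2 + ε)) 2 f.fn
    positivity
  norm_smul a f := by
    simp only [M2.norm_def, M2.fn_smul, wnorm_smul, Real.norm_eq_abs]
    ring
  norm_triangle f g := by
    simp only [M2.norm_def, M2.fn_add]
    have hf := f.mem
    have hg := g.mem
    have := wnorm_add_le (hf.cd (Nat.zero_le 2)) (hg.cd (Nat.zero_le 2)) hf.bdd0 hg.bdd0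
    have := wnorm_add_le (hf.cd one_le_two) (hg.cd one_le_two) hf.bdd1 hg.bdd1
    have := wnorm_add_le (hf.cd le_rfl) (hg.cd le_rfl) hf.bdd2 hg.bdd2
    linarith
  norm_eq_zero_iff f := by
    constructor
    · intro h
      rw [M2.norm_def] at h
      have h0 := wnorm_nonneg I1 (wt ε) 0 f.fn
      have := wnorm_nonneg I1 (wt (1 + ε)) 1 f.fn
      have := wnorm_nonneg I1 (wt (2 + ε)) 2 f.fn
      have h1 : f.fn = 0 := eq_zero_of_wnorm f.mem.bdd0 f.mem.zero_off (by linarith)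
      exact Subtype.ext h1
    · rintro rfl
      have h : (0 : M2 ε).fn = (0 : ℝ) • (0 : ℝ → ℝ) := by simp; rfl
      simp only [M2.norm_def, h, wnorm_smul, abs_zero, zero_mul, add_zero]

instance (ε : ℝ) : NormedAddCommGroup (M1 ε) := NormedAddCommGroup.ofCore (M1.core ε)
instance (ε : ℝ) : NormedSpace ℝ (M1 ε) := NormedSpace.ofCore (M1.core ε)
instance (ε : ℝ) : NormedAddCommGroup (M2 ε) := NormedAddCommGroup.ofCore (M2.core ε)
instance (ε : ℝ) : NormedSpace ℝ (M2 ε) := NormedSpace.ofCore (M2.core ε)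

/-- The space `X = M₁(ε) × M₂(ε)` with the norm `‖W_θ‖ + ‖W_φ‖`. -/
abbrev X (ε : ℝ) : Type := WithLp 1 (M1 ε × M2 ε)

/-- The functional `l₃(W) = W_φ'(0)`. -/
def l3 (ε : ℝ) : X ε →ₗ[ℝ] ℝ where
  toFun W := deriv W.snd.fn 0
  map_add' W W' := by
    have h0 : (0 : ℝ) ∈ I1 := by norm_num
    have h1 := (W.snd.mem.cd one_le_two 0 h0).differentiableAt (by norm_num)
    have h2 := (W'.snd.mem.cd one_le_two 0 h0).differentiableAt (by norm_num)
    exact deriv_add h1 h2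
  map_smul' a W := by
    have h0 : (0 : ℝ) ∈ I1 := by norm_num
    have h1 := (W.snd.mem.cd one_le_two 0 h0).differentiableAt (by norm_num)
    exact deriv_const_smul a h1

/-- The functional `l₄(W) = W_φ(0)`. -/
def l4 (ε : ℝ) : X ε →ₗ[ℝ] ℝ where
  toFun W := W.snd.fn 0
  map_add' _ _ := rfl
  map_smul' _ _ := rfl

/-- The subspace `X₃ = ker l₃ ∩ ker l₄` of `X`. -/
def X3 (ε : ℝ) : Submodule ℝ (X ε) := LinearMap.ker (l3 ε) ⊓ LinearMap.ker (l4 ε)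

/-! ### The equations -/

/-- A pair `U = (U_θ, U_φ)` of real functions; only the values on `(-1, 1)` matter. -/
abbrev Pair : Type := (ℝ → ℝ) × (ℝ → ℝ)

/-- The pair of functions underlying an element of `X`. -/
def toPair {ε : ℝ} (W : X ε) : Pair := (W.fst.fn, W.snd.fn)

/-- Equality of pairs of functions on `(-1, 1)`. -/
def Agree (U U' : Pair) : Prop := EqOn U.1 U'.1 I1 ∧ EqOn U.2 U'.2 I1

/-- `P_c(x) = c₁(1 - x) + c₂(1 + x) + c₃(1 - x²)`. The components `c₁, c₂, c₃` of `c` are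
`c 0, c 1, c 2`. -/
def P (c : Fin 3 → ℝ) (x : ℝ) : ℝ := c 0 * (1 - x) + c 1 * (1 + x) + c 2 * (1 - x ^ 2)

/-- `ψ[u](x) = ∫₀ˣ ∫₀ˡ ∫₀ᵗ 2 u(s) u'(s) / (1 - s²) ds dt dl`. -/
def psi (u : ℝ → ℝ) (x : ℝ) : ℝ :=
  ∫ l in (0 : ℝ)..x, ∫ t in (0 : ℝ)..l, ∫ s in (0 : ℝ)..t, 2 * u s * deriv u s / (1 - s ^ 2)

/-- `U = (U_θ, U_φ)` is a classical solution on `(-1, 1)`, with constants `ĉ`, of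
`(1 - x²) U_θ' + 2x U_θ + U_θ² / 2 + ψ[U_φ] = P_ĉ`, `(1 - x²) U_φ'' + U_θ U_φ' = 0`. -/
structure SolvesNSE (U : Pair) (chat : Fin 3 → ℝ) : Prop where
  smooth_theta : ContDiffOn ℝ 1 U.1 I1
  smooth_phi : ContDiffOn ℝ 2 U.2 I1
  eq_theta : ∀ x ∈ I1,
    (1 - x ^ 2) * deriv U.1 x + 2 * x * U.1 x + (1 / 2) * U.1 x ^ 2 + psi U.2 x = P chat x
  eq_phi : ∀ x ∈ I1, (1 - x ^ 2) * iteratedDeriv 2 U.2 x + U.1 x * deriv U.2 x = 0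

/-! ### The axisymmetric no-swirl solutions -/

/-- A parameter `(c, γ)`, an element of `ℝ³ × ℝ`. -/
abbrev Param : Type := (Fin 3 → ℝ) × ℝ

/-- `u` is a solution on `(-1, 1)` of `(1 - x²) u' + 2x u + u² / 2 = P_c`. -/
structure IsNoSwirl (c : Fin 3 → ℝ) (u : ℝ → ℝ) : Prop where
  smooth : ContDiffOn ℝ 1 u I1
  eq : ∀ x ∈ I1, (1 - x ^ 2) * deriv u x + 2 * x * u x + (1 / 2) * u x ^ 2 = P c x

/-- `γ⁺(c)`, the largest value at `0` of a no-swirl solution with constants `c`. -/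
def gammaPlus (c : Fin 3 → ℝ) : ℝ := sSup {γ | ∃ u, IsNoSwirl c u ∧ u 0 = γ}

open Classical in
/-- `U_θ^{c,γ}`, the no-swirl solution with constants `c` whose value at `0` is `γ` (it is unique on
`(-1, 1)`, and only its values there are used; the value is `0` if there is no such solution). -/
def Ubar (p : Param) : ℝ → ℝ :=
  if h : ∃ u, IsNoSwirl p.1 u ∧ u 0 = p.2 then h.choose else 0

/-- `U^{c,γ} = (U_θ^{c,γ}, 0)`. -/
def Ucg (p : Param) : Pair := (Ubar p, 0)

/-- The boundary value `U_θ^{c,γ}(-1)`. -/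
def UbarLeft (p : Param) : ℝ := limUnder (𝓝[>] (-1 : ℝ)) (Ubar p)

/-- The boundary value `U_θ^{c,γ}(1)`. -/
def UbarRight (p : Param) : ℝ := limUnder (𝓝[<] (1 : ℝ)) (Ubar p)

/-- `c̄₃(c₁, c₂)`. -/
def c3bar (c₁ c₂ : ℝ) : ℝ :=
  -(1 / 2) * (√(1 + c₁) + √(1 + c₂)) * (√(1 + c₁) + √(1 + c₂) + 2)

/-- The parameter sets `J_k` for `5 ≤ k ≤ 8`, on which `c₃ = c̄₃(c₁, c₂)`. -/
def J : ℕ → Set (Fin 3 → ℝ)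
  | 5 => {c | -1 < c 0 ∧ -1 < c 1 ∧ c 2 = c3bar (c 0) (c 1)}
  | 6 => {c | c 0 = -1 ∧ -1 < c 1 ∧ c 2 = c3bar (c 0) (c 1)}
  | 7 => {c | -1 < c 0 ∧ c 1 = -1 ∧ c 2 = c3bar (c 0) (c 1)}
  | 8 => {c | c 0 = -1 ∧ c 1 = -1 ∧ c 2 = c3bar (c 0) (c 1)}
  | _ => ∅

/-- The parameter set `I_{k,1} = I_{k,2} = I_{k,3}` for `5 ≤ k ≤ 8`. -/
def Ik (k : ℕ) : Set Param :=
  {p | p.1 ∈ J k ∧ p.2 = gammaPlus p.1 ∧ p.1 0 < -(3 / 4) ∧ p.1 1 < -(3 / 4)}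

/-- The condition on the weight exponent `ε` of the spaces, for all parameters in `K`. -/
structure Admissible (K : Set Param) (ε : ℝ) : Prop where
  pos : 0 < ε
  lt_half : ε < 1 / 2
  left_lt : ∀ p ∈ K, UbarLeft p < 2 → UbarLeft p / 4 < ε
  left_ge : ∀ p ∈ K, 2 ≤ UbarLeft p → UbarLeft p / 2 - 1 < ε
  right_gt : ∀ p ∈ K, -2 < UbarRight p → -UbarRight p / 4 < ε
  right_le : ∀ p ∈ K, UbarRight p ≤ -2 → -UbarRight p / 2 - 1 < ε

/-! ### The ansatz -/

/-- `b_{c,γ}(x) = ∫₀ˣ U_θ^{c,γ}(s) / (1 - s²) ds`. -/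
def b (p : Param) (x : ℝ) : ℝ := ∫ s in (0 : ℝ)..x, Ubar p s / (1 - s ^ 2)

/-- `V³_{c,γ} = (0, ∫₀ˣ e^{-b_{c,γ}(t)} dt)`. -/
def V3 (p : Param) : Pair := (0, fun x => ∫ t in (0 : ℝ)..x, Real.exp (-b p t))

/-- `V⁴_{c,γ} = (0, 1)`. -/
def V4 : Pair := (0, 1)

/-- The parameter space of `β = (β₃, β₄)`, whose components are `β 0, β 1`. -/
abbrev Beta : Type := EuclideanSpace ℝ (Fin 2)

/-- `U^{c,γ} + β₃ V³_{c,γ} + β₄ V⁴_{c,γ} + W`. -/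
def ansatz {ε : ℝ} (p : Param) (β : Beta) (W : X ε) : Pair :=
  Ucg p + β 0 • V3 p + β 1 • V4 + toPair W

/-- `φ_{c,γ}[u](x) = (1 - x²) u' + (2x + U_θ^{c,γ}) u + u² / 2`. -/
def phi (p : Param) (u : ℝ → ℝ) (x : ℝ) : ℝ :=
  (1 - x ^ 2) * deriv u x + (2 * x + Ubar p x) * u x + (1 / 2) * u x ^ 2

/-- The constants `ĉ` attached to the deviation `U - U^{c,γ} = (w_θ, w_φ)`:
`ĉ₁ = c₁ + ψ[w_φ](-1) / 2`, `ĉ₂ = c₂ + ψ[w_φ](1) / 2`, `ĉ₃ = c₃ - φ_{c,γ}[w_θ]''(0) / 2`. -/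
def cHat (p : Param) (w : Pair) : Fin 3 → ℝ :=
  ![p.1 0 + (1 / 2) * psi w.2 (-1), p.1 1 + (1 / 2) * psi w.2 1,
    p.1 2 - (1 / 2) * iteratedDeriv 2 (phi p w.1) 0]

end HomNS

end

noncomputable section

namespace HomNS

/-! On the surface `c₃ = c̄₃` the no-swirl equation has exactly one solution on `(-1, 1)`: the
affine function `aff q` with `q = (a, d) = (1 + √(1 + c₁), 1 + √(1 + c₂))` (`isNoSwirl_unique`). The
difference from any other solution, multiplied by an integrating factor and written in the variable
`s` with `x = tanh s`, solves a Riccati equation on the whole line that has no nonzero global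
solution. Hence `γ⁺` is the only possible value at `0`, the boundary values are `2a ≥ 2` and `-2d ≤
-2`, and the condition on `ε` becomes `1 ≤ a, d < 1 + ε` (`GoodExp`).

Since the base flow is affine, all integrating factors are products of powers `(1 + x)ˢ (1 - x)ʳ`,
and the linearized operators are inverted by explicit quadrature. The operator `f ↦ (1 - x²) f' +
(2x + Ū) f`, taken modulo multiples `l (1 - x²)`, is inverted on data of size `(1 - x²)^(1 - 2ε)`;
the number `l` is what makes the solution decay at both ends (`exists_thetaSol`,
`ThetaSol.eq_zero`). The operator `G ↦ (1 - x²) G'' + Ū G'` is inverted with zero Cauchy data at `0`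
by integrating twice from `0` (`exists_phiSol`). Its kernel is spanned by `1` and the primitive of
`e^{-b}`, which belongs to `M₂` because `a, d < 1 + ε`.

A deviation `f` in `M₁` vanishes at `±1` together with every term it contributes to the equation. So
the affine part of the right-hand side must match the values of `ψ` at `±1`: this is the formula for
`ĉ₁, ĉ₂`, and it amounts to replacing `ψ` by `tripT`, which vanishes at `±1`. The remaining constant
`l = ĉ₃ - c₃` is the one left free by the linear theory and is recovered from the second derivative
of `φ` at `0`.

Near a fixed `q` only the operators at `q` are inverted; the change of coefficient is moved to the
right-hand side. The equations for the deviation `z = (f, G)` with Cauchy data `G'(0) = β₃`, `G(0) =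
β₄` then read `z = N (e, z)` with `e = (p, β)`, `p` the varying exponents, and `N` a linear term in
`β` plus bounded bilinear terms in quantities that vanish at the base point
(`exists_fixedPointMap`). The implicit function theorem gives a smooth branch; uniqueness in a small
ball lets the local branches be glued along a compact set (`exists_branch_near_compact`).
Subtracting the linear part in `β` from the branch leaves `V`. Conversely a nearby solution
determines `β` by its Cauchy data and then lies on the branch by uniqueness. -/

/-! ### Solution branches near a compact set -/

section Abstract

variable {E Z : Type*} [NormedAddCommGroup E] [NormedSpace ℝ E] [CompleteSpace E]
  [NormedAddCommGroup Z] [NormedSpace ℝ Z] [CompleteSpace Z]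

/-- A fixed point equation `z = N (e, z)` with `N` analytic, `N (s, 0) = 0` and `∂N/∂z (s, 0) = 0`
has, for `e` near `s`, exactly one small solution, and this solution is smooth in `e`. -/
theorem exists_local_branch (s : E) (N : E × Z → Z) (hN : ContDiff ℝ ω N) (h0 : N (s, 0) = 0)
    (h1 : fderiv ℝ N (s, 0) ∘L .inr ℝ E Z = 0) :
    ∃ U : Set E, IsOpen U ∧ s ∈ U ∧ ∃ ρ > 0, ∃ v : E → Z, ContDiffOn ℝ ∞ v U ∧ v s = 0 ∧
      ∀ e ∈ U, ∀ z, ‖z‖ < ρ → (z = N (e, z) ↔ z = v e) := by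
  set F : E × Z → Z := fun p => p.2 - N p with hF
  have hFc : ContDiff ℝ ω F := contDiff_snd.sub hN
  -- Zeros of `F (e, z) = z - N (e, z)` are the fixed points, and the partial derivative of `F` in
  -- `z` at the base point is the identity.
  have cdf : ContDiffAt ℝ ω F (s, 0) := hFc.contDiffAt
  have hd : fderiv ℝ F (s, 0) ∘L .inr ℝ E Z = .id ℝ Z := by
    have : fderiv ℝ F (s, 0) = .snd ℝ E Z - fderiv ℝ N (s, 0) :=
      (hasFDerivAt_snd.sub (hN.differentiable (by simp) (s, 0)).hasFDerivAt).fderiv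
    rw [this, ContinuousLinearMap.sub_comp, h1, sub_zero]
    ext z
    simp
  have hinv : (fderiv ℝ F (s, 0) ∘L .inr ℝ E Z).IsInvertible := by
    rw [hd]
    exact ⟨ContinuousLinearEquiv.refl ℝ Z, rfl⟩
  have hn : (ω : ℕ∞ω) ≠ 0 := by simp
  set v := cdf.implicitFunction hn hinv with hv
  have hFs : F (s, 0) = 0 := by simp [hF, h0]
  -- Analyticity at `s` persists nearby, whereas a pointwise `C^∞` condition at `s` would not yield
  -- one neighbourhood on which all derivatives exist.
  have e1 := cdf.eventually_apply_eq_iff_implicitFunction hn hinv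
  have e2 : ∀ᶠ e in 𝓝 s, ContDiffAt ℝ ω v e :=
    (cdf.contDiffAt_implicitFunction hn hinv).eventually (by simp)
  rw [nhds_prod_eq] at e1
  obtain ⟨A, hA, B, hB, hAB⟩ := eventually_prod_iff.1 e1
  obtain ⟨U, hU, hUo, hsU⟩ := _root_.eventually_nhds_iff.1 (hA.and e2)
  obtain ⟨ρ, hρ, hρB⟩ := Metric.eventually_nhds_iff.1 hB
  refine ⟨U, hUo, hsU, ρ, hρ, v, fun e he => ?_, cdf.implicitFunction_apply_self hn hinv,
    fun e he z hz => ?_⟩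
  · exact ((hU e he).2.of_le le_top).contDiffWithinAt
  · have := hAB (hU e he).1 (hρB (y := z) (by simpa using hz))
    rw [hFs] at this
    simp only [hF, sub_eq_zero] at this
    rw [this, eq_comm]

/-- Small solutions of a family of equations that, near every point of a compact set, has the form
required by `exists_local_branch`. -/
theorem exists_branch_near_compact {S : Set E} (hS : IsCompact S) (Sol : E → Z → Prop)
    (h : ∀ s ∈ S, ∃ N : E × Z → Z, ContDiff ℝ ω N ∧ N (s, 0) = 0 ∧
      fderiv ℝ N (s, 0) ∘L .inr ℝ E Z = 0 ∧ ∀ e z, Sol e z ↔ z = N (e, z)) :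
    ∃ O : Set E, IsOpen O ∧ S ⊆ O ∧ ∃ ρ > 0, ∃ v : E → Z, ContDiffOn ℝ ∞ v O ∧
      ∀ e ∈ O, Sol e (v e) ∧ ∀ z, ‖z‖ < ρ → Sol e z → z = v e := by
  have h' : ∀ s ∈ S, ∃ U : Set E, IsOpen U ∧ s ∈ U ∧ ∃ ρ > 0, ∃ v : E → Z,
      ContDiffOn ℝ ∞ v U ∧ v s = 0 ∧ ∀ e ∈ U, ∀ z, ‖z‖ < ρ → (Sol e z ↔ z = v e) := by
    intro s hs
    obtain ⟨N, hN, h0, h1, h2⟩ := h s hs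
    simp only [h2]
    exact exists_local_branch s N hN h0 h1
  have h0 : ∀ s ∈ S, Sol s 0 := by
    intro s hs
    obtain ⟨N, -, h0, -, h2⟩ := h s hs
    exact (h2 s 0).2 h0.symm
  choose! U hUo hsU ρ hρ v hv hvs hiff using h'
  obtain ⟨t, htS, ht⟩ := hS.elim_nhds_subcover U fun s hs => (hUo s hs).mem_nhds (hsU s hs)
  rcases t.eq_empty_or_nonempty with rfl | hne
  · have : S ⊆ ∅ := by simpa using ht
    exact ⟨∅, isOpen_empty, this, 1, one_pos, fun _ => 0, contDiffOn_const, by simp⟩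
  -- A radius valid for all charts of the finite subcover: solutions of norm below `r` are unique
  -- over every `U s`, so the local branches agree where they are that small.
  set r := t.inf' hne ρ with hr
  have hrpos : 0 < r := (Finset.lt_inf'_iff hne).2 fun s hs => hρ s (htS s hs)
  have hrle : ∀ s ∈ t, r ≤ ρ s := fun s hs => Finset.inf'_le _ hs
  set W : E → Set E := fun s => U s ∩ (fun e => ‖v s e‖) ⁻¹' Iio r with hW
  have hWo : ∀ s ∈ t, IsOpen (W s) := fun s hs =>
    ((hv s (htS s hs)).continuousOn.norm).isOpen_inter_preimage (hUo s (htS s hs)) isOpen_Iio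
  set O := ⋃ s ∈ t, W s with hO
  have key : ∀ e ∈ O, ∃ z, ‖z‖ < r ∧ Sol e z := by
    intro e he
    obtain ⟨s, hs, hse⟩ := mem_iUnion₂.1 he
    exact ⟨v s e, hse.2,
      (hiff s (htS s hs) e hse.1 _ (lt_of_lt_of_le hse.2 (hrle s hs))).2 rfl⟩
  choose! vv hvr hvSol using key
  have heq : ∀ s ∈ t, ∀ e ∈ U s, ∀ z, ‖z‖ < r → Sol e z → z = v s e := fun s hs e he z hz hz' =>
    (hiff s (htS s hs) e he z (lt_of_lt_of_le hz (hrle s hs))).1 hz'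
  refine ⟨O, isOpen_biUnion hWo, ?_, r, hrpos, vv, ?_, fun e he => ⟨hvSol e he, fun z hz hSz => ?_⟩⟩
  · intro x hx
    obtain ⟨s, hs, hse⟩ := mem_iUnion₂.1 (ht hx)
    refine mem_iUnion₂.2 ⟨s, hs, hse, ?_⟩
    -- At a point of `S` the zero solution is small, so every chart covering that point has its
    -- branch equal to `0` there. Shrinking `U s` to `W s` therefore loses no point of `S`.
    have := heq s hs x hse 0 (by simpa using hrpos) (h0 x hx)
    simp [← this, hrpos]
  · intro e he
    obtain ⟨s, hs, hse⟩ := mem_iUnion₂.1 he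
    have h1 : ContDiffAt ℝ ∞ (v s) e :=
      (hv s (htS s hs)).contDiffAt ((hUo s (htS s hs)).mem_nhds hse.1)
    refine (h1.congr_of_eventuallyEq ?_).contDiffWithinAt
    filter_upwards [(hWo s hs).mem_nhds hse] with y hy
    have hyO : y ∈ O := mem_iUnion₂.2 ⟨s, hs, hy⟩
    exact heq s hs y hy.1 _ (hvr y hyO) (hvSol y hyO)
  · obtain ⟨s, hs, hse⟩ := mem_iUnion₂.1 he
    rw [heq s hs e hse.1 z hz hSz, heq s hs e hse.1 _ (hvr e he) (hvSol e he)]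

/-- A bilinear relation that is total, single-valued and bounded is the graph of a continuous
bilinear map. -/
theorem exists_bilinear_of_relation {A B C : Type*} [NormedAddCommGroup A] [NormedSpace ℝ A]
    [NormedAddCommGroup B] [NormedSpace ℝ B] [NormedAddCommGroup C] [NormedSpace ℝ C]
    (R : A → B → C → Prop) (K : ℝ) (hex : ∀ a b, ∃ c, R a b c ∧ ‖c‖ ≤ K * ‖a‖ * ‖b‖)
    (huniq : ∀ {a b c c'}, R a b c → R a b c' → c = c')
    (hadd₁ : ∀ {a a' b c c'}, R a b c → R a' b c' → R (a + a') b (c + c'))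
    (hsmul₁ : ∀ (t : ℝ) {a b c}, R a b c → R (t • a) b (t • c))
    (hadd₂ : ∀ {a b b' c c'}, R a b c → R a b' c' → R a (b + b') (c + c'))
    (hsmul₂ : ∀ (t : ℝ) {a b c}, R a b c → R a (t • b) (t • c)) :
    ∃ T : A →L[ℝ] B →L[ℝ] C, ∀ a b c, R a b c ↔ c = T a b := by
  choose f hf hb using hex
  refine ⟨LinearMap.mkContinuous₂ (LinearMap.mk₂ ℝ f
    (fun a a' b => huniq (hf _ _) (hadd₁ (hf a b) (hf a' b)))
    (fun t a b => huniq (hf _ _) (hsmul₁ t (hf a b)))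
    (fun a b b' => huniq (hf _ _) (hadd₂ (hf a b) (hf a b')))
    (fun t a b => huniq (hf _ _) (hsmul₂ t (hf a b)))) K hb, fun a b c => ⟨fun h => ?_, ?_⟩⟩
  · exact huniq h (hf a b)
  · rintro rfl
    exact hf a b

end Abstract

/-! ### Derivatives on open sets -/

section OpenSets

variable {s : Set ℝ} {f g : ℝ → ℝ} {n k : ℕ}

lemma hasDerivAt_iteratedDeriv (hs : IsOpen s) (hf : ContDiffOn ℝ n f s) (hk : k < n) {x : ℝ}
    (hx : x ∈ s) : HasDerivAt (iteratedDeriv k f) (iteratedDeriv (k + 1) f x) x := by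
  rw [iteratedDeriv_succ]
  refine DifferentiableAt.hasDerivAt ?_
  have h1 := (hf.differentiableOn_iteratedDerivWithin (m := k) (by exact_mod_cast hk)
    hs.uniqueDiffOn).differentiableAt (hs.mem_nhds hx)
  refine h1.congr_of_eventuallyEq ?_
  filter_upwards [hs.mem_nhds hx] with y hy
  exact (iteratedDerivWithin_of_isOpen hs hy).symm

lemma continuousOn_iteratedDeriv (hs : IsOpen s) (hf : ContDiffOn ℝ n f s) (hk : k ≤ n) :
    ContinuousOn (iteratedDeriv k f) s :=
  (hf.continuousOn_iteratedDerivWithin (m := k) (by exact_mod_cast hk) hs.uniqueDiffOn).congr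
    fun _ hx => (iteratedDerivWithin_of_isOpen hs hx).symm

lemma contDiffOn_succ_of_hasDerivAt (hs : IsOpen s) (h : ∀ x ∈ s, HasDerivAt f (g x) x)
    (hg : ContDiffOn ℝ n g s) : ContDiffOn ℝ (n + 1 : ℕ) f s := by
  push_cast
  rw [contDiffOn_succ_iff_deriv_of_isOpen hs]
  exact ⟨fun x hx => (h x hx).differentiableAt.differentiableWithinAt, by simp,
    hg.congr fun x hx => (h x hx).deriv⟩

lemma iteratedDeriv_eqOn (hs : IsOpen s) (h : EqOn f g s) :
    EqOn (iteratedDeriv n f) (iteratedDeriv n g) s := fun _ hx =>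
  Filter.EventuallyEq.iteratedDeriv_eq n (eventuallyEq_of_mem (hs.mem_nhds hx) h)

lemma iteratedDeriv_succ_eqOn {l : ℝ → ℝ} (hs : IsOpen s) (h : ∀ x ∈ s, HasDerivAt f (g x) x)
    (hg : EqOn (iteratedDeriv n g) l s) : EqOn (iteratedDeriv (n + 1) f) l s := by
  rw [iteratedDeriv_succ']
  exact (iteratedDeriv_eqOn hs fun x hx => (h x hx).deriv).trans hg

end OpenSets

lemma isOpen_I1 : IsOpen I1 := isOpen_Ioo
lemma isOpen_Ih : IsOpen Ih := isOpen_Ioo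
lemma zero_mem_I1 : (0 : ℝ) ∈ I1 := by norm_num
lemma zero_mem_Ih : (0 : ℝ) ∈ Ih := by norm_num
lemma Ih_subset_I1 : Ih ⊆ I1 := Ioo_subset_Ioo (by norm_num) (by norm_num)

/-! ### Power weights -/

/-- The weight `(1 + x)ˢ (1 - x)ʳ`. -/
def ww (s r : ℝ) (x : ℝ) : ℝ := (1 + x) ^ s * (1 - x) ^ r

section Weights

variable {x : ℝ}

lemma one_add_pos (hx : x ∈ I1) : 0 < 1 + x := by linarith [hx.1]
lemma one_sub_pos (hx : x ∈ I1) : 0 < 1 - x := by linarith [hx.2]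
lemma one_sub_sq_pos (hx : x ∈ I1) : 0 < 1 - x ^ 2 := by nlinarith [hx.1, hx.2]

lemma ww_pos (s r : ℝ) (hx : x ∈ I1) : 0 < ww s r x :=
  mul_pos (Real.rpow_pos_of_pos (one_add_pos hx) _) (Real.rpow_pos_of_pos (one_sub_pos hx) _)

lemma ww_add (s r s' r' : ℝ) (hx : x ∈ I1) : ww (s + s') (r + r') x = ww s r x * ww s' r' x := by
  unfold ww
  rw [Real.rpow_add (one_add_pos hx), Real.rpow_add (one_sub_pos hx)]
  ring

lemma ww_zero (x : ℝ) : ww 0 0 x = 1 := by simp [ww]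

lemma ww_one (x : ℝ) : ww 1 1 x = 1 - x ^ 2 := by simp [ww]; ring

lemma ww_neg (s r : ℝ) (hx : x ∈ I1) : ww (-s) (-r) x = (ww s r x)⁻¹ := by
  have := ww_add s r (-s) (-r) hx
  rw [add_neg_cancel, add_neg_cancel, ww_zero] at this
  exact eq_inv_of_mul_eq_one_right this.symm

lemma wt_eq_ww (r : ℝ) (hx : x ∈ I1) : wt r x = ww r r x := by
  have : 1 - x ^ 2 = (1 + x) * (1 - x) := by ring
  simp only [wt, ww]
  rw [this, Real.mul_rpow (one_add_pos hx).le (one_sub_pos hx).le]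

lemma ww_reflect (s r : ℝ) (x : ℝ) : ww s r (-x) = ww r s x := by
  simp only [ww, sub_neg_eq_add, ← sub_eq_add_neg]
  ring

lemma continuousOn_ww (s r : ℝ) : ContinuousOn (ww s r) I1 := by
  unfold ww
  refine ContinuousOn.mul ?_ ?_
  · exact ContinuousOn.rpow_const (by fun_prop) fun x hx => Or.inl (one_add_pos hx).ne'
  · exact ContinuousOn.rpow_const (by fun_prop) fun x hx => Or.inl (one_sub_pos hx).ne'

lemma hasDerivAt_ww (s r : ℝ) (hx : x ∈ I1) :
    HasDerivAt (ww s r) ((s * (1 - x) - r * (1 + x)) * ww (s - 1) (r - 1) x) x := by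
  have h1 : HasDerivAt (fun y : ℝ => (1 + y) ^ s) (1 * s * (1 + x) ^ (s - 1)) x :=
    ((hasDerivAt_id' x).const_add 1).rpow_const (Or.inl (one_add_pos hx).ne')
  have h2 : HasDerivAt (fun y : ℝ => (1 - y) ^ r) (-1 * r * (1 - x) ^ (r - 1)) x :=
    ((hasDerivAt_id' x).const_sub 1).rpow_const (Or.inl (one_sub_pos hx).ne')
  refine (h1.mul h2).congr_deriv ?_
  have e1 : (1 + x) ^ s = (1 + x) ^ (s - 1) * (1 + x) := by
    rw [← Real.rpow_add_one (one_add_pos hx).ne', sub_add_cancel]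
  have e2 : (1 - x) ^ r = (1 - x) ^ (r - 1) * (1 - x) := by
    rw [← Real.rpow_add_one (one_sub_pos hx).ne', sub_add_cancel]
  rw [e1, e2]
  simp only [ww]
  ring

/-- Weights with larger exponents are smaller, up to a constant. -/
lemma ww_le_ww {s r s' r' : ℝ} (hs : s' ≤ s) (hr : r' ≤ r) :
    ∃ K : ℝ, 0 < K ∧ ∀ x ∈ I1, ww s r x ≤ K * ww s' r' x := by
  refine ⟨2 ^ (s - s') * 2 ^ (r - r'), by positivity, fun x hx => ?_⟩
  have h := ww_add (s - s') (r - r') s' r' hx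
  rw [sub_add_cancel, sub_add_cancel] at h
  rw [h]
  refine mul_le_mul_of_nonneg_right ?_ (ww_pos _ _ hx).le
  have := one_add_pos hx
  have := one_sub_pos hx
  refine mul_le_mul (Real.rpow_le_rpow ?_ ?_ (by linarith)) (Real.rpow_le_rpow ?_ ?_ (by linarith))
    ?_ (by positivity) <;> first | positivity | linarith

end Weights

lemma continuousOn_wt (r : ℝ) : ContinuousOn (wt r) I1 :=
  (continuousOn_ww r r).congr fun _ hx => wt_eq_ww r hx

lemma wt_pos (r : ℝ) : ∀ x ∈ I1, 0 < wt r x := fun _ hx => by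
  rw [wt_eq_ww r hx]; exact ww_pos r r hx

lemma wt_neg (r : ℝ) {x : ℝ} (hx : x ∈ I1) : wt (-r) x = (wt r x)⁻¹ := by
  rw [wt_eq_ww _ hx, wt_eq_ww _ hx, ww_neg _ _ hx]

lemma wt_add (r s : ℝ) {x : ℝ} (hx : x ∈ I1) : wt (r + s) x = wt r x * wt s x := by
  rw [wt_eq_ww _ hx, wt_eq_ww _ hx, wt_eq_ww _ hx, ww_add _ _ _ _ hx]

lemma wt_one (x : ℝ) : wt 1 x = 1 - x ^ 2 := by simp [wt]

lemma wt_anti {r s : ℝ} (h : s ≤ r) {x : ℝ} (hx : x ∈ I1) : wt r x ≤ wt s x :=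
  Real.rpow_le_rpow_of_exponent_ge (one_sub_sq_pos hx) (by nlinarith [sq_nonneg x]) h

/-- `|w u| ≤ C` as a bound for `u`. -/
lemma abs_le_mul_wt_neg {r u C x : ℝ} (hx : x ∈ I1) : |wt r x * u| ≤ C ↔ |u| ≤ C * wt (-r) x := by
  rw [abs_mul, abs_of_pos (wt_pos r x hx), wt_neg r hx, ← div_eq_mul_inv,
    le_div_iff₀ (wt_pos r x hx), mul_comm]

/-- Away from the end points `1 - x²` lies between `1/2` and `1`, so on the middle interval weighted
bounds are ordinary ones. -/
lemma wt_mid (r : ℝ) {x : ℝ} (hx : x ∈ Ih) : wt r x ≤ 2 ^ |r| := by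
  have h1 : 1 / 2 ≤ 1 - x ^ 2 := by nlinarith [hx.1, hx.2]
  have h2 : 1 - x ^ 2 ≤ 1 := by nlinarith [sq_nonneg x]
  calc wt r x ≤ (1 - x ^ 2) ^ (-|r|) :=
        Real.rpow_le_rpow_of_exponent_ge (by linarith) h2 (neg_abs_le r)
    _ ≤ (1 / 2) ^ (-|r|) :=
        Real.rpow_le_rpow_of_nonpos (by norm_num) h1 (neg_nonpos.2 (abs_nonneg r))
    _ = 2 ^ |r| := by
        rw [one_div, Real.inv_rpow (by norm_num), Real.rpow_neg (by norm_num), inv_inv]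

/-! ### Elements of the spaces -/

lemma WBdd.of_le {s : Set ℝ} {w : ℝ → ℝ} {n : ℕ} {f : ℝ → ℝ} {C : ℝ}
    (h : ∀ x ∈ s, |w x * iteratedDeriv n f x| ≤ C) : WBdd s w n f :=
  ⟨C, forall_mem_range.2 fun x => h x x.2⟩

lemma wnorm_le {s : Set ℝ} {w : ℝ → ℝ} {n : ℕ} {f : ℝ → ℝ} {C : ℝ} (hC : 0 ≤ C)
    (h : ∀ x ∈ s, |w x * iteratedDeriv n f x| ≤ C) : wnorm s w n f ≤ C :=
  Real.iSup_le (fun x => h x x.2) hC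

namespace M2
variable {ε : ℝ}

lemma bound0 (G : M2 ε) {x : ℝ} (hx : x ∈ I1) : |wt ε x * G.fn x| ≤ ‖G‖ := by
  have := G.mem.bdd0.le hx
  rw [iteratedDeriv_zero] at this
  rw [norm_def]
  linarith [wnorm_nonneg I1 (wt (1 + ε)) 1 G.fn, wnorm_nonneg I1 (wt (2 + ε)) 2 G.fn]

lemma bound1 (G : M2 ε) {x : ℝ} (hx : x ∈ I1) : |wt (1 + ε) x * deriv G.fn x| ≤ ‖G‖ := by
  have := G.mem.bdd1.le hx
  rw [iteratedDeriv_one] at this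
  rw [norm_def]
  linarith [wnorm_nonneg I1 (wt ε) 0 G.fn, wnorm_nonneg I1 (wt (2 + ε)) 2 G.fn]

lemma bound2 (G : M2 ε) {x : ℝ} (hx : x ∈ I1) :
    |wt (2 + ε) x * iteratedDeriv 2 G.fn x| ≤ ‖G‖ := by
  have := G.mem.bdd2.le hx
  rw [norm_def]
  linarith [wnorm_nonneg I1 (wt ε) 0 G.fn, wnorm_nonneg I1 (wt (1 + ε)) 1 G.fn]

lemma hasDerivAt (G : M2 ε) {x : ℝ} (hx : x ∈ I1) : HasDerivAt G.fn (deriv G.fn x) x := by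
  have := hasDerivAt_iteratedDeriv (n := 2) isOpen_I1 (by exact_mod_cast G.mem.smooth)
    (Nat.zero_lt_two) hx
  simpa [iteratedDeriv_one] using this

lemma hasDerivAt_deriv (G : M2 ε) {x : ℝ} (hx : x ∈ I1) :
    HasDerivAt (deriv G.fn) (iteratedDeriv 2 G.fn x) x := by
  have := hasDerivAt_iteratedDeriv (n := 2) isOpen_I1 (by exact_mod_cast G.mem.smooth)
    (Nat.one_lt_two) hx
  simpa [iteratedDeriv_one] using this

lemma continuousOn_iteratedDeriv_two (G : M2 ε) : ContinuousOn (iteratedDeriv 2 G.fn) I1 :=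
  continuousOn_iteratedDeriv (n := 2) isOpen_I1 (by exact_mod_cast G.mem.smooth) le_rfl

lemma continuousOn_deriv (G : M2 ε) : ContinuousOn (deriv G.fn) I1 := fun _ hx =>
  (G.hasDerivAt_deriv hx).continuousAt.continuousWithinAt

lemma continuousOn (G : M2 ε) : ContinuousOn G.fn I1 := fun _ hx =>
  (G.hasDerivAt hx).continuousAt.continuousWithinAt

lemma ext_on {G H : M2 ε} (h : EqOn G.fn H.fn I1) : G = H := by
  refine Subtype.ext (funext fun x => ?_)
  by_cases hx : x ∈ I1
  · exact h hx
  · exact (G.mem.zero_off x hx).trans (H.mem.zero_off x hx).symm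

/-- Construction of an element of `M₂` from a function and its derivatives on `(-1, 1)`. -/
lemma exists_of {g0 g1 g2 : ℝ → ℝ} {C0 C1 C2 : ℝ} (h0 : ∀ x ∈ I1, HasDerivAt g0 (g1 x) x)
    (h1 : ∀ x ∈ I1, HasDerivAt g1 (g2 x) x) (h2 : ContinuousOn g2 I1)
    (b0 : ∀ x ∈ I1, |wt ε x * g0 x| ≤ C0) (b1 : ∀ x ∈ I1, |wt (1 + ε) x * g1 x| ≤ C1)
    (b2 : ∀ x ∈ I1, |wt (2 + ε) x * g2 x| ≤ C2) :
    ∃ G : M2 ε, EqOn G.fn g0 I1 ∧ EqOn (deriv G.fn) g1 I1 ∧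
      EqOn (iteratedDeriv 2 G.fn) g2 I1 ∧ ‖G‖ ≤ C0 + C1 + C2 := by
  set f : ℝ → ℝ := I1.indicator g0 with hf
  have e0 : EqOn f g0 I1 := fun x hx => indicator_of_mem hx _
  have hd : ∀ x ∈ I1, HasDerivAt f (g1 x) x := fun x hx =>
    (h0 x hx).congr_of_eventuallyEq (eventuallyEq_of_mem (isOpen_I1.mem_nhds hx) e0)
  have e2' : EqOn (iteratedDeriv 1 g1) g2 I1 :=
    iteratedDeriv_succ_eqOn isOpen_I1 h1 (by simp [EqOn])
  have e1 : EqOn (iteratedDeriv 1 f) g1 I1 :=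
    iteratedDeriv_succ_eqOn isOpen_I1 hd (by simp [EqOn])
  have e2 : EqOn (iteratedDeriv 2 f) g2 I1 := iteratedDeriv_succ_eqOn isOpen_I1 hd e2'
  have c2 : ContDiffOn ℝ 2 f I1 := by
    have c0 : ContDiffOn ℝ (0 : ℕ) g2 I1 := by exact_mod_cast contDiffOn_zero.2 h2
    exact_mod_cast contDiffOn_succ_of_hasDerivAt isOpen_I1 hd
      (contDiffOn_succ_of_hasDerivAt isOpen_I1 h1 c0)
  have k0 : ∀ x ∈ I1, |wt ε x * iteratedDeriv 0 f x| ≤ C0 := fun x hx => by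
    rw [iteratedDeriv_zero, e0 hx]; exact b0 x hx
  have k1 : ∀ x ∈ I1, |wt (1 + ε) x * iteratedDeriv 1 f x| ≤ C1 := fun x hx => by
    rw [e1 hx]; exact b1 x hx
  have k2 : ∀ x ∈ I1, |wt (2 + ε) x * iteratedDeriv 2 f x| ≤ C2 := fun x hx => by
    rw [e2 hx]; exact b2 x hx
  refine ⟨⟨f, c2, fun x hx => indicator_of_notMem hx _, .of_le k0, .of_le k1, .of_le k2⟩, e0, ?_,
    e2, ?_⟩
  · rw [← iteratedDeriv_one]; exact e1
  · exact add_le_add_three (wnorm_le ((abs_nonneg _).trans (k0 0 zero_mem_I1)) k0)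
      (wnorm_le ((abs_nonneg _).trans (k1 0 zero_mem_I1)) k1)
      (wnorm_le ((abs_nonneg _).trans (k2 0 zero_mem_I1)) k2)

end M2

namespace M1
variable {ε : ℝ}

lemma bound0 (f : M1 ε) {x : ℝ} (hx : x ∈ I1) : |wt (-1 + 2 * ε) x * f.fn x| ≤ ‖f‖ := by
  have := f.mem.bdd0.le hx
  rw [iteratedDeriv_zero] at this
  rw [norm_def]
  linarith [wnorm_nonneg I1 (wt (2 * ε)) 1 f.fn, wnorm_nonneg Ih wt1 2 f.fn,
    wnorm_nonneg Ih wt1 3 f.fn]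

lemma bound1 (f : M1 ε) {x : ℝ} (hx : x ∈ I1) : |wt (2 * ε) x * deriv f.fn x| ≤ ‖f‖ := by
  have := f.mem.bdd1.le hx
  rw [iteratedDeriv_one] at this
  rw [norm_def]
  linarith [wnorm_nonneg I1 (wt (-1 + 2 * ε)) 0 f.fn, wnorm_nonneg Ih wt1 2 f.fn,
    wnorm_nonneg Ih wt1 3 f.fn]

lemma bound2 (f : M1 ε) {x : ℝ} (hx : x ∈ Ih) : |iteratedDeriv 2 f.fn x| ≤ ‖f‖ := by
  have := f.mem.bdd2.le hx
  rw [wt1, one_mul] at this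
  rw [norm_def]
  linarith [wnorm_nonneg I1 (wt (-1 + 2 * ε)) 0 f.fn, wnorm_nonneg I1 (wt (2 * ε)) 1 f.fn,
    wnorm_nonneg Ih wt1 3 f.fn]

lemma bound3 (f : M1 ε) {x : ℝ} (hx : x ∈ Ih) : |iteratedDeriv 3 f.fn x| ≤ ‖f‖ := by
  have := f.mem.bdd3.le hx
  rw [wt1, one_mul] at this
  rw [norm_def]
  linarith [wnorm_nonneg I1 (wt (-1 + 2 * ε)) 0 f.fn, wnorm_nonneg I1 (wt (2 * ε)) 1 f.fn,
    wnorm_nonneg Ih wt1 2 f.fn]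

lemma hasDerivAt (f : M1 ε) {x : ℝ} (hx : x ∈ I1) : HasDerivAt f.fn (deriv f.fn x) x := by
  have := hasDerivAt_iteratedDeriv (n := 1) isOpen_I1 (by exact_mod_cast f.mem.smooth)
    (Nat.zero_lt_one) hx
  simpa [iteratedDeriv_one] using this

lemma hasDerivAt_deriv (f : M1 ε) {x : ℝ} (hx : x ∈ Ih) :
    HasDerivAt (deriv f.fn) (iteratedDeriv 2 f.fn x) x := by
  have := hasDerivAt_iteratedDeriv (n := 3) (k := 1) isOpen_Ih
    (by exact_mod_cast f.mem.smooth_mid) (by norm_num) hx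
  simpa [iteratedDeriv_one] using this

lemma hasDerivAt_iteratedDeriv_two (f : M1 ε) {x : ℝ} (hx : x ∈ Ih) :
    HasDerivAt (iteratedDeriv 2 f.fn) (iteratedDeriv 3 f.fn x) x :=
  hasDerivAt_iteratedDeriv (n := 3) (k := 2) isOpen_Ih
    (by exact_mod_cast f.mem.smooth_mid) (by norm_num) hx

lemma continuousOn_iteratedDeriv_three (f : M1 ε) : ContinuousOn (iteratedDeriv 3 f.fn) Ih :=
  continuousOn_iteratedDeriv (n := 3) isOpen_Ih (by exact_mod_cast f.mem.smooth_mid) le_rfl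

lemma continuousOn_deriv (f : M1 ε) : ContinuousOn (deriv f.fn) I1 := by
  rw [← iteratedDeriv_one]
  exact continuousOn_iteratedDeriv (n := 1) isOpen_I1 (by exact_mod_cast f.mem.smooth) le_rfl

lemma continuousOn (f : M1 ε) : ContinuousOn f.fn I1 := fun _ hx =>
  (f.hasDerivAt hx).continuousAt.continuousWithinAt

lemma ext_on {f g : M1 ε} (h : EqOn f.fn g.fn I1) : f = g := by
  refine Subtype.ext (funext fun x => ?_)
  by_cases hx : x ∈ I1
  · exact h hx
  · exact (f.mem.zero_off x hx).trans (g.mem.zero_off x hx).symm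

/-- Construction of an element of `M₁` from a function and its derivatives. -/
lemma exists_of (hε : ε < 1 / 2) {f0 f1 f2 f3 : ℝ → ℝ} {C0 C1 C2 C3 : ℝ}
    (h0 : ∀ x ∈ I1, HasDerivAt f0 (f1 x) x) (h1 : ContinuousOn f1 I1)
    (h2 : ∀ x ∈ Ih, HasDerivAt f1 (f2 x) x) (h3 : ∀ x ∈ Ih, HasDerivAt f2 (f3 x) x)
    (h4 : ContinuousOn f3 Ih)
    (b0 : ∀ x ∈ I1, |wt (-1 + 2 * ε) x * f0 x| ≤ C0) (b1 : ∀ x ∈ I1, |wt (2 * ε) x * f1 x| ≤ C1)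
    (b2 : ∀ x ∈ Ih, |f2 x| ≤ C2) (b3 : ∀ x ∈ Ih, |f3 x| ≤ C3) :
    ∃ f : M1 ε, EqOn f.fn f0 I1 ∧ EqOn (deriv f.fn) f1 I1 ∧
      EqOn (iteratedDeriv 2 f.fn) f2 Ih ∧ EqOn (iteratedDeriv 3 f.fn) f3 Ih ∧
      ‖f‖ ≤ C0 + C1 + C2 + C3 := by
  set f : ℝ → ℝ := I1.indicator f0 with hf
  have e0 : EqOn f f0 I1 := fun x hx => indicator_of_mem hx _
  have hd : ∀ x ∈ I1, HasDerivAt f (f1 x) x := fun x hx =>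
    (h0 x hx).congr_of_eventuallyEq (eventuallyEq_of_mem (isOpen_I1.mem_nhds hx) e0)
  have hd' : ∀ x ∈ Ih, HasDerivAt f (f1 x) x := fun x hx => hd x (Ih_subset_I1 hx)
  have e1 : EqOn (iteratedDeriv 1 f) f1 I1 :=
    iteratedDeriv_succ_eqOn isOpen_I1 hd (by simp [EqOn])
  have e3'' : EqOn (iteratedDeriv 1 f2) f3 Ih :=
    iteratedDeriv_succ_eqOn isOpen_Ih h3 (by simp [EqOn])
  have e2' : EqOn (iteratedDeriv 1 f1) f2 Ih :=
    iteratedDeriv_succ_eqOn isOpen_Ih h2 (by simp [EqOn])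
  have e2 : EqOn (iteratedDeriv 2 f) f2 Ih := iteratedDeriv_succ_eqOn isOpen_Ih hd' e2'
  have e3 : EqOn (iteratedDeriv 3 f) f3 Ih :=
    iteratedDeriv_succ_eqOn isOpen_Ih hd' (iteratedDeriv_succ_eqOn isOpen_Ih h2 e3'')
  have c1 : ContDiffOn ℝ 1 f I1 := by
    have c0 : ContDiffOn ℝ (0 : ℕ) f1 I1 := by exact_mod_cast contDiffOn_zero.2 h1
    exact_mod_cast contDiffOn_succ_of_hasDerivAt isOpen_I1 hd c0
  have c3 : ContDiffOn ℝ 3 f Ih := by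
    have c0 : ContDiffOn ℝ (0 : ℕ) f3 Ih := by exact_mod_cast contDiffOn_zero.2 h4
    exact_mod_cast contDiffOn_succ_of_hasDerivAt isOpen_Ih hd'
      (contDiffOn_succ_of_hasDerivAt isOpen_Ih h2 (contDiffOn_succ_of_hasDerivAt isOpen_Ih h3 c0))
  have hz : ∀ x, x ∉ I1 → f x = 0 := fun x hx => indicator_of_notMem hx _
  -- The exponent `1 - 2ε` is positive, so the weighted bound forces the limit `0` at `±1`, which is
  -- also the value of the extension by zero.
  have cont : ContinuousOn f (Icc (-1) 1) := by
    have hbd : ∀ x ∈ Icc (-1 : ℝ) 1, |f x| ≤ C0 * wt (1 - 2 * ε) x := by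
      intro x hx
      by_cases hx' : x ∈ I1
      · rw [e0 hx']
        have := (abs_le_mul_wt_neg hx').1 (b0 x hx')
        rwa [show -(-1 + 2 * ε) = 1 - 2 * ε by ring] at this
      · rw [hz x hx', abs_zero]
        refine mul_nonneg ((abs_nonneg _).trans (b0 0 zero_mem_I1)) (Real.rpow_nonneg ?_ _)
        nlinarith [hx.1, hx.2]
    intro x hx
    by_cases hx' : x ∈ I1
    · exact (hd x hx').continuousAt.continuousWithinAt
    · have hx2 : 1 - x ^ 2 = 0 := by
        rcases eq_or_lt_of_le hx.1 with h | h
        · rw [← h]; norm_num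
        · rcases eq_or_lt_of_le hx.2 with h' | h'
          · rw [h']; norm_num
          · exact absurd ⟨h, h'⟩ hx'
      have hc : ContinuousAt (fun y => C0 * wt (1 - 2 * ε) y) x := by
        refine continuousAt_const.mul (ContinuousAt.rpow_const (by fun_prop) (Or.inr (by linarith)))
      have hlim : C0 * wt (1 - 2 * ε) x = 0 := by
        rw [wt, hx2, Real.zero_rpow (by linarith), mul_zero]
      have : Tendsto f (𝓝[Icc (-1) 1] x) (𝓝 0) := by
        refine squeeze_zero_norm' (a := fun y => C0 * wt (1 - 2 * ε) y) ?_ ?_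
        · filter_upwards [self_mem_nhdsWithin] with y hy using hbd y hy
        · rw [← hlim]; exact hc.tendsto.mono_left nhdsWithin_le_nhds
      rw [ContinuousWithinAt, hz x hx']
      exact this
  have k0 : ∀ x ∈ I1, |wt (-1 + 2 * ε) x * iteratedDeriv 0 f x| ≤ C0 := fun x hx => by
    rw [iteratedDeriv_zero, e0 hx]; exact b0 x hx
  have k1 : ∀ x ∈ I1, |wt (2 * ε) x * iteratedDeriv 1 f x| ≤ C1 := fun x hx => by
    rw [e1 hx]; exact b1 x hx
  have k2 : ∀ x ∈ Ih, |wt1 x * iteratedDeriv 2 f x| ≤ C2 := fun x hx => by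
    rw [e2 hx, wt1, one_mul]; exact b2 x hx
  have k3 : ∀ x ∈ Ih, |wt1 x * iteratedDeriv 3 f x| ≤ C3 := fun x hx => by
    rw [e3 hx, wt1, one_mul]; exact b3 x hx
  refine ⟨⟨f, c3, c1, cont, hz, .of_le k0, .of_le k1, .of_le k2, .of_le k3⟩, e0, ?_, e2, e3, ?_⟩
  · rw [← iteratedDeriv_one]; exact e1
  · exact add_le_add (add_le_add_three (wnorm_le ((abs_nonneg _).trans (k0 0 zero_mem_I1)) k0)
      (wnorm_le ((abs_nonneg _).trans (k1 0 zero_mem_I1)) k1)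
      (wnorm_le ((abs_nonneg _).trans (k2 0 zero_mem_Ih)) k2))
      (wnorm_le ((abs_nonneg _).trans (k3 0 zero_mem_Ih)) k3)

end M1

/-! ### Completeness -/

/-- Functions that form a Cauchy sequence in a weighted sup-norm converge, locally uniformly and in
that norm. -/
lemma exists_weighted_limit {s : Set ℝ} {w : ℝ → ℝ} (hw : ContinuousOn w s)
    (hpos : ∀ x ∈ s, 0 < w x) {u : ℕ → ℝ → ℝ}
    (h : ∀ η > 0, ∃ N, ∀ m ≥ N, ∀ n ≥ N, ∀ x ∈ s, |w x * (u m x - u n x)| ≤ η) :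
    ∃ g : ℝ → ℝ, (∀ x ∈ s, Tendsto (fun n => u n x) atTop (𝓝 (g x))) ∧
      TendstoLocallyUniformlyOn u g atTop s ∧
      ∀ η > 0, ∃ N, ∀ n ≥ N, ∀ x ∈ s, |w x * (u n x - g x)| ≤ η := by
  have hex : ∀ x ∈ s, ∃ l, Tendsto (fun n => u n x) atTop (𝓝 l) := by
    intro x hx
    refine cauchySeq_tendsto_of_complete (Metric.cauchySeq_iff.2 fun η hη => ?_)
    obtain ⟨N, hN⟩ := h (w x * (η / 2)) (mul_pos (hpos x hx) (half_pos hη))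
    refine ⟨N, fun m hm n hn => ?_⟩
    have := hN m hm n hn x hx
    rw [abs_mul, abs_of_pos (hpos x hx)] at this
    rw [Real.dist_eq]
    linarith [le_of_mul_le_mul_left this (hpos x hx)]
  choose! g hg using hex
  have hlim : ∀ η > 0, ∃ N, ∀ n ≥ N, ∀ x ∈ s, |w x * (u n x - g x)| ≤ η := by
    intro η hη
    obtain ⟨N, hN⟩ := h η hη
    refine ⟨N, fun n hn x hx => ?_⟩
    have ht : Tendsto (fun m => |w x * (u n x - u m x)|) atTop (𝓝 |w x * (u n x - g x)|) :=
      ((tendsto_const_nhds.sub (hg x hx)).const_mul _).abs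
    refine le_of_tendsto ht ?_
    filter_upwards [eventually_ge_atTop N] with m hm using hN n hn m hm x hx
  refine ⟨g, hg, ?_, hlim⟩
  rw [Metric.tendstoLocallyUniformlyOn_iff]
  intro η hη x hx
  have hwx := hpos x hx
  -- Near `x` the weight stays above `w x / 2`, so convergence in the weighted norm is uniform
  -- there.
  have hev : ∀ᶠ y in 𝓝[s] x, w x / 2 < w y :=
    (hw x hx).eventually (eventually_gt_nhds (half_lt_self hwx))
  obtain ⟨N, hN⟩ := hlim (w x / 2 * (η / 2)) (by positivity)
  refine ⟨_, inter_mem hev self_mem_nhdsWithin, ?_⟩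
  filter_upwards [eventually_ge_atTop N] with n hn y hy
  have h1 := hN n hn y hy.2
  have h2 : w x / 2 < w y := hy.1
  rw [abs_mul, abs_of_pos (hpos y hy.2)] at h1
  rw [dist_comm, Real.dist_eq]
  have h3 : w x / 2 * |u n y - g y| ≤ w x / 2 * (η / 2) :=
    (mul_le_mul_of_nonneg_right h2.le (abs_nonneg _)).trans h1
  linarith [le_of_mul_le_mul_left h3 (half_pos hwx)]

lemma M2.fn_sub {ε : ℝ} (f g : M2 ε) : (f - g).fn = f.fn - g.fn := rfl
lemma M1.fn_sub {ε : ℝ} (f g : M1 ε) : (f - g).fn = f.fn - g.fn := rfl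

lemma M2.deriv_sub {ε : ℝ} (f g : M2 ε) {x : ℝ} (hx : x ∈ I1) :
    deriv (f - g).fn x = deriv f.fn x - deriv g.fn x :=
  ((f.hasDerivAt hx).sub (g.hasDerivAt hx)).deriv

lemma M1.deriv_sub {ε : ℝ} (f g : M1 ε) {x : ℝ} (hx : x ∈ I1) :
    deriv (f - g).fn x = deriv f.fn x - deriv g.fn x :=
  ((f.hasDerivAt hx).sub (g.hasDerivAt hx)).deriv

/-- Weighted convergence of each derivative is locally uniform, so the limits are derivatives of one
another. -/
instance (ε : ℝ) : CompleteSpace (M2 ε) := by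
  refine Metric.complete_of_cauchySeq_tendsto fun u hu => ?_
  have hC : ∀ η > 0, ∃ N, ∀ m ≥ N, ∀ n ≥ N, ‖u m - u n‖ ≤ η := fun η hη => by
    obtain ⟨N, hN⟩ := Metric.cauchySeq_iff.1 hu η hη
    exact ⟨N, fun m hm n hn => by rw [← dist_eq_norm]; exact (hN m hm n hn).le⟩
  have d2 : ∀ (f g : M2 ε), ∀ x ∈ I1, iteratedDeriv 2 (f - g).fn x
      = iteratedDeriv 2 f.fn x - iteratedDeriv 2 g.fn x := fun f g x hx => by
    rw [M2.fn_sub, iteratedDeriv_sub (f.mem.cd le_rfl x hx) (g.mem.cd le_rfl x hx)]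
  obtain ⟨g0, t0, -, l0⟩ := exists_weighted_limit (u := fun n => (u n).fn)
    (continuousOn_wt ε) (wt_pos ε) fun η hη => by
      obtain ⟨N, hN⟩ := hC η hη
      exact ⟨N, fun m hm n hn x hx => ((u m - u n).bound0 hx).trans (hN m hm n hn)⟩
  obtain ⟨g1, t1, c1, l1⟩ := exists_weighted_limit (u := fun n => deriv (u n).fn)
    (continuousOn_wt (1 + ε)) (wt_pos (1 + ε)) fun η hη => by
      obtain ⟨N, hN⟩ := hC η hη
      refine ⟨N, fun m hm n hn x hx => ?_⟩
      rw [← M2.deriv_sub _ _ hx]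
      exact ((u m - u n).bound1 hx).trans (hN m hm n hn)
  obtain ⟨g2, -, c2, l2⟩ := exists_weighted_limit (u := fun n => iteratedDeriv 2 (u n).fn)
    (continuousOn_wt (2 + ε)) (wt_pos (2 + ε)) fun η hη => by
      obtain ⟨N, hN⟩ := hC η hη
      refine ⟨N, fun m hm n hn x hx => ?_⟩
      rw [← d2 _ _ x hx]
      exact ((u m - u n).bound2 hx).trans (hN m hm n hn)
  have h0 : ∀ x ∈ I1, HasDerivAt g0 (g1 x) x := fun x hx =>
    hasDerivAt_of_tendstoLocallyUniformlyOn isOpen_I1 c1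
      (.of_forall fun n x hx => (u n).hasDerivAt hx) t0 hx
  have h1 : ∀ x ∈ I1, HasDerivAt g1 (g2 x) x := fun x hx =>
    hasDerivAt_of_tendstoLocallyUniformlyOn isOpen_I1 c2
      (.of_forall fun n x hx => (u n).hasDerivAt_deriv hx) t1 hx
  have h2 : ContinuousOn g2 I1 :=
    c2.continuousOn (.of_forall fun n => (u n).continuousOn_iteratedDeriv_two)
  have key : ∀ η > 0, ∃ N, ∀ n ≥ N, ∃ D : M2 ε, EqOn D.fn ((u n).fn - g0) I1 ∧
      ‖D‖ ≤ η + η + η := by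
    intro η hη
    obtain ⟨N0, hN0⟩ := l0 η hη
    obtain ⟨N1, hN1⟩ := l1 η hη
    obtain ⟨N2, hN2⟩ := l2 η hη
    refine ⟨max N0 (max N1 N2), fun n hn => ?_⟩
    simp only [ge_iff_le, max_le_iff] at hn
    obtain ⟨D, hD, -, -, hDn⟩ := M2.exists_of (ε := ε)
      (fun x hx => ((u n).hasDerivAt hx).sub (h0 x hx))
      (fun x hx => ((u n).hasDerivAt_deriv hx).sub (h1 x hx))
      ((u n).continuousOn_iteratedDeriv_two.sub h2) (hN0 n hn.1) (hN1 n hn.2.1) (hN2 n hn.2.2)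
    exact ⟨D, hD, hDn⟩
  obtain ⟨N, hN⟩ := key 1 one_pos
  obtain ⟨D, hD, -⟩ := hN N le_rfl
  -- The limit is realized as an element of the space by subtracting from `u N` the element `D`
  -- representing `u N - g0`; only differences need to be estimated.
  refine ⟨u N - D, Metric.tendsto_atTop.2 fun η hη => ?_⟩
  obtain ⟨M, hM⟩ := key (η / 4) (by positivity)
  refine ⟨M, fun n hn => ?_⟩
  obtain ⟨D', hD', hn'⟩ := hM n hn
  have : u n - (u N - D) = D' := M2.ext_on fun x hx => by
    simp only [M2.fn_sub, Pi.sub_apply, hD hx, hD' hx]; ring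
  rw [dist_eq_norm, this]
  linarith

/-- Completeness of `M₁`. -/
lemma M1.completeSpace {ε : ℝ} (hε : ε < 1 / 2) : CompleteSpace (M1 ε) := by
  refine Metric.complete_of_cauchySeq_tendsto fun u hu => ?_
  have hC : ∀ η > 0, ∃ N, ∀ m ≥ N, ∀ n ≥ N, ‖u m - u n‖ ≤ η := fun η hη => by
    obtain ⟨N, hN⟩ := Metric.cauchySeq_iff.1 hu η hη
    exact ⟨N, fun m hm n hn => by rw [← dist_eq_norm]; exact (hN m hm n hn).le⟩
  have d2 : ∀ (f g : M1 ε), ∀ x ∈ Ih, iteratedDeriv 2 (f - g).fn x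
      = iteratedDeriv 2 f.fn x - iteratedDeriv 2 g.fn x := fun f g x hx => by
    rw [M1.fn_sub, iteratedDeriv_sub (f.mem.cd2 x hx) (g.mem.cd2 x hx)]
  have d3 : ∀ (f g : M1 ε), ∀ x ∈ Ih, iteratedDeriv 3 (f - g).fn x
      = iteratedDeriv 3 f.fn x - iteratedDeriv 3 g.fn x := fun f g x hx => by
    rw [M1.fn_sub, iteratedDeriv_sub (f.mem.cd3 x hx) (g.mem.cd3 x hx)]
  obtain ⟨g0, t0, -, l0⟩ := exists_weighted_limit (u := fun n => (u n).fn)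
    (continuousOn_wt (-1 + 2 * ε)) (wt_pos _) fun η hη => by
      obtain ⟨N, hN⟩ := hC η hη
      exact ⟨N, fun m hm n hn x hx => ((u m - u n).bound0 hx).trans (hN m hm n hn)⟩
  obtain ⟨g1, t1, c1, l1⟩ := exists_weighted_limit (u := fun n => deriv (u n).fn)
    (continuousOn_wt (2 * ε)) (wt_pos _) fun η hη => by
      obtain ⟨N, hN⟩ := hC η hη
      refine ⟨N, fun m hm n hn x hx => ?_⟩
      rw [← M1.deriv_sub _ _ hx]
      exact ((u m - u n).bound1 hx).trans (hN m hm n hn)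
  obtain ⟨g2, t2, c2, l2⟩ := exists_weighted_limit (u := fun n => iteratedDeriv 2 (u n).fn)
    (w := fun _ => 1) continuousOn_const (fun _ _ => one_pos) fun η hη => by
      obtain ⟨N, hN⟩ := hC η hη
      refine ⟨N, fun m hm n hn x hx => ?_⟩
      rw [← d2 _ _ x hx, one_mul]
      exact ((u m - u n).bound2 hx).trans (hN m hm n hn)
  obtain ⟨g3, -, c3, l3⟩ := exists_weighted_limit (u := fun n => iteratedDeriv 3 (u n).fn)
    (w := fun _ => 1) continuousOn_const (fun _ _ => one_pos) fun η hη => by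
      obtain ⟨N, hN⟩ := hC η hη
      refine ⟨N, fun m hm n hn x hx => ?_⟩
      rw [← d3 _ _ x hx, one_mul]
      exact ((u m - u n).bound3 hx).trans (hN m hm n hn)
  have h0 : ∀ x ∈ I1, HasDerivAt g0 (g1 x) x := fun x hx =>
    hasDerivAt_of_tendstoLocallyUniformlyOn isOpen_I1 c1
      (.of_forall fun n x hx => (u n).hasDerivAt hx) t0 hx
  have h1 : ContinuousOn g1 I1 := c1.continuousOn (.of_forall fun n => (u n).continuousOn_deriv)
  have h2 : ∀ x ∈ Ih, HasDerivAt g1 (g2 x) x := fun x hx =>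
    hasDerivAt_of_tendstoLocallyUniformlyOn isOpen_Ih c2
      (.of_forall fun n x hx => (u n).hasDerivAt_deriv hx)
      (fun x hx => t1 x (Ih_subset_I1 hx)) hx
  have h3 : ∀ x ∈ Ih, HasDerivAt g2 (g3 x) x := fun x hx =>
    hasDerivAt_of_tendstoLocallyUniformlyOn isOpen_Ih c3
      (.of_forall fun n x hx => (u n).hasDerivAt_iteratedDeriv_two hx) t2 hx
  have h4 : ContinuousOn g3 Ih :=
    c3.continuousOn (.of_forall fun n => (u n).continuousOn_iteratedDeriv_three)
  have key : ∀ η > 0, ∃ N, ∀ n ≥ N, ∃ D : M1 ε, EqOn D.fn ((u n).fn - g0) I1 ∧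
      ‖D‖ ≤ η + η + η + η := by
    intro η hη
    obtain ⟨N0, hN0⟩ := l0 η hη
    obtain ⟨N1, hN1⟩ := l1 η hη
    obtain ⟨N2, hN2⟩ := l2 η hη
    obtain ⟨N3, hN3⟩ := l3 η hη
    simp only [one_mul] at hN2 hN3
    refine ⟨max (max N0 N1) (max N2 N3), fun n hn => ?_⟩
    simp only [ge_iff_le, max_le_iff] at hn
    obtain ⟨D, hD, -, -, -, hDn⟩ := M1.exists_of hε
      (fun x hx => ((u n).hasDerivAt hx).sub (h0 x hx)) ((u n).continuousOn_deriv.sub h1)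
      (fun x hx => ((u n).hasDerivAt_deriv hx).sub (h2 x hx))
      (fun x hx => ((u n).hasDerivAt_iteratedDeriv_two hx).sub (h3 x hx))
      ((u n).continuousOn_iteratedDeriv_three.sub h4) (hN0 n hn.1.1) (hN1 n hn.1.2)
      (hN2 n hn.2.1) (hN3 n hn.2.2)
    exact ⟨D, hD, hDn⟩
  obtain ⟨N, hN⟩ := key 1 one_pos
  obtain ⟨D, hD, -⟩ := hN N le_rfl
  refine ⟨u N - D, Metric.tendsto_atTop.2 fun η hη => ?_⟩
  obtain ⟨M, hM⟩ := key (η / 5) (by positivity)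
  refine ⟨M, fun n hn => ?_⟩
  obtain ⟨D', hD', hn'⟩ := hM n hn
  have : u n - (u N - D) = D' := M1.ext_on fun x hx => by
    simp only [M1.fn_sub, Pi.sub_apply, hD hx, hD' hx]; ring
  rw [dist_eq_norm, this]
  linarith

/-! ### Integrals of functions bounded by power weights -/

section Integrals

variable {u : ℝ → ℝ}

lemma uIcc_subset_I1 {x y : ℝ} (hx : x ∈ I1) (hy : y ∈ I1) : uIcc x y ⊆ I1 := by
  intro t ht
  rcases le_total x y with h | h
  · rw [uIcc_of_le h] at ht; exact ⟨hx.1.trans_le ht.1, ht.2.trans_lt hy.2⟩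
  · rw [uIcc_of_ge h] at ht; exact ⟨hy.1.trans_le ht.1, ht.2.trans_lt hx.2⟩

lemma intervalIntegrable_I1 (hu : ContinuousOn u I1) {x y : ℝ} (hx : x ∈ I1) (hy : y ∈ I1) :
    IntervalIntegrable u volume x y :=
  (hu.mono (uIcc_subset_I1 hx hy)).intervalIntegrable

lemma hasDerivAt_integral (hu : ContinuousOn u I1) {a x : ℝ}
    (ha : IntervalIntegrable u volume a 0) (hx : x ∈ I1) :
    HasDerivAt (fun y => ∫ t in a..y, u t) (u x) x :=
  intervalIntegral.integral_hasDerivAt_right (ha.trans (intervalIntegrable_I1 hu zero_mem_I1 hx))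
    (hu.stronglyMeasurableAtFilter isOpen_I1 x hx) (hu.continuousAt (isOpen_I1.mem_nhds hx))

lemma neg_mem_I1 {x : ℝ} (hx : x ∈ I1) : -x ∈ I1 := ⟨by linarith [hx.2], by linarith [hx.1]⟩

lemma continuousOn_comp_neg (hu : ContinuousOn u I1) : ContinuousOn (fun t => u (-t)) I1 :=
  hu.comp continuousOn_neg fun _ hx => neg_mem_I1 hx

/-- For `t ≥ 0` the factor `(1 + t)ˢ` is at most `1`, and the primitive of `(1 - t)ʳ` grows like `(1
- x)^(r + 1)` because `r < -1`. The missing factor `(1 + x)^(s + 1)` is at least `2^(s + 1)`, which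
explains the constant. -/
lemma abs_integral_from_zero_le_of_nonneg {s r : ℝ} (hs : s < -1) (hr : r < -1) :
    ∃ K : ℝ, 0 ≤ K ∧ ∀ (u : ℝ → ℝ) (C : ℝ), 0 ≤ C → ContinuousOn u I1 →
      (∀ t ∈ I1, |u t| ≤ C * ww s r t) →
      ∀ x ∈ I1, 0 ≤ x → |∫ t in (0 : ℝ)..x, u t| ≤ C * K * ww (s + 1) (r + 1) x := by
  refine ⟨2 ^ (-(s + 1)) * (-(r + 1))⁻¹, by
    have : 0 < -(r + 1) := by linarith
    positivity, fun u C hC hu hb x hx hx0 => ?_⟩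
  have hr1 : 0 < -(r + 1) := by linarith
  set g : ℝ → ℝ := fun t => C * (1 - t) ^ r with hg
  have hsub : ∀ t ∈ Icc 0 x, t ∈ I1 := fun t ht => ⟨by linarith [ht.1], ht.2.trans_lt hx.2⟩
  have hgc : ContinuousOn g (uIcc 0 x) := by
    rw [uIcc_of_le hx0]
    refine continuousOn_const.mul (ContinuousOn.rpow_const (by fun_prop) fun t ht => Or.inl ?_)
    exact (one_sub_pos (hsub t ht)).ne'
  have h1 : ‖∫ t in (0 : ℝ)..x, u t‖ ≤ ∫ t in (0 : ℝ)..x, g t := by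
    refine intervalIntegral.norm_integral_le_of_norm_le hx0 (.of_forall fun t ht => ?_)
      hgc.intervalIntegrable
    have ht' := hsub t ⟨ht.1.le, ht.2⟩
    refine (hb t ht').trans (mul_le_mul_of_nonneg_left ?_ hC)
    refine mul_le_of_le_one_left (Real.rpow_nonneg (one_sub_pos ht').le _) ?_
    exact Real.rpow_le_one_of_one_le_of_nonpos (by linarith [ht.1]) (by linarith)
  have h2 : ∫ t in (0 : ℝ)..x, g t
      = C * (-(1 - x) ^ (r + 1) / (r + 1)) - C * (-(1 - 0) ^ (r + 1) / (r + 1)) := by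
    refine intervalIntegral.integral_eq_sub_of_hasDerivAt
      (f := fun t => C * (-(1 - t) ^ (r + 1) / (r + 1))) (fun t ht => ?_) hgc.intervalIntegrable
    rw [uIcc_of_le hx0] at ht
    have hd : HasDerivAt (fun t : ℝ => (1 - t) ^ (r + 1)) (-1 * (r + 1) * (1 - t) ^ (r + 1 - 1)) t :=
      ((hasDerivAt_id' t).const_sub 1).rpow_const (Or.inl (one_sub_pos (hsub t ht)).ne')
    refine ((hd.neg.div_const (r + 1)).const_mul C).congr_deriv ?_
    have : r + 1 ≠ 0 := by linarith
    simp only [hg, add_sub_cancel_right]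
    field_simp
  rw [Real.norm_eq_abs, h2] at h1
  refine h1.trans ?_
  have h3 : (1 - x) ^ (r + 1) ≤ 2 ^ (-(s + 1)) * ww (s + 1) (r + 1) x := by
    have : (2 : ℝ) ^ (s + 1) ≤ (1 + x) ^ (s + 1) :=
      Real.rpow_le_rpow_of_nonpos (by linarith) (by linarith [hx.2]) (by linarith)
    have h2p : (0 : ℝ) < 2 ^ (s + 1) := by positivity
    rw [Real.rpow_neg (by norm_num), ww, ← mul_assoc]
    refine le_mul_of_one_le_left (Real.rpow_nonneg (one_sub_pos hx).le _) ?_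
    rw [inv_mul_eq_div, one_le_div h2p]
    exact this
  have h4 : C * (-(1 - x) ^ (r + 1) / (r + 1)) - C * (-(1 - 0) ^ (r + 1) / (r + 1))
      = C * (((1 - x) ^ (r + 1) - 1) * (-(r + 1))⁻¹) := by
    have : r + 1 ≠ 0 := by linarith
    rw [sub_zero, Real.one_rpow]
    field_simp
    ring
  rw [h4, mul_assoc]
  refine mul_le_mul_of_nonneg_left ?_ hC
  rw [mul_right_comm]
  exact mul_le_mul_of_nonneg_right (by linarith) (by positivity)

/-- Integration from `0` of a function with a non-integrable power bound. -/
lemma abs_integral_from_zero_le {s r : ℝ} (hs : s < -1) (hr : r < -1) :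
    ∃ K : ℝ, 0 ≤ K ∧ ∀ (u : ℝ → ℝ) (C : ℝ), 0 ≤ C → ContinuousOn u I1 →
      (∀ t ∈ I1, |u t| ≤ C * ww s r t) →
      ∀ x ∈ I1, |∫ t in (0 : ℝ)..x, u t| ≤ C * K * ww (s + 1) (r + 1) x := by
  obtain ⟨K, hK, h⟩ := abs_integral_from_zero_le_of_nonneg hs hr
  obtain ⟨K', hK', h'⟩ := abs_integral_from_zero_le_of_nonneg hr hs
  refine ⟨max K K', le_max_of_le_left hK, fun u C hC hu hb x hx => ?_⟩
  rcases le_total 0 x with hx0 | hx0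
  · refine (h u C hC hu hb x hx hx0).trans (mul_le_mul_of_nonneg_right ?_ (ww_pos _ _ hx).le)
    exact mul_le_mul_of_nonneg_left (le_max_left _ _) hC
  · have := h' (fun t => u (-t)) C hC (continuousOn_comp_neg hu)
      (fun t ht => by rw [← ww_reflect]; exact hb _ (neg_mem_I1 ht)) (-x) (neg_mem_I1 hx)
      (by linarith)
    rw [intervalIntegral.integral_comp_neg, neg_neg, neg_zero, intervalIntegral.integral_symm,
      abs_neg, ww_reflect] at this
    refine this.trans (mul_le_mul_of_nonneg_right ?_ (ww_pos _ _ hx).le)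
    exact mul_le_mul_of_nonneg_left (le_max_right _ _) hC

/-- On `(-1, 0]` one has `1 ≤ 1 - t ≤ 2`, so only the integrable singularity `(1 + t)ˢ` matters and
`r` is arbitrary. The other end point is reached later by reflection. -/
lemma integrable_left_of_le {s r : ℝ} (hs : -1 < s) :
    ∃ K : ℝ, 0 ≤ K ∧ ∀ (u : ℝ → ℝ) (C : ℝ), 0 ≤ C → ContinuousOn u I1 →
      (∀ t ∈ I1, |u t| ≤ C * ww s r t) → IntervalIntegrable u volume (-1) 0 ∧
      ∀ x ∈ I1, x ≤ 0 → |∫ t in (-1 : ℝ)..x, u t| ≤ C * K * ww (s + 1) (r + 1) x := by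
  have hs1 : 0 < s + 1 := by linarith
  refine ⟨2 ^ |r| * 2 ^ |r + 1| * (s + 1)⁻¹, by positivity, fun u C hC hu hb => ?_⟩
  set g : ℝ → ℝ := fun t => C * 2 ^ |r| * (1 + t) ^ s with hg
  have hgi : ∀ a b : ℝ, IntervalIntegrable g volume a b := fun a b => by
    have := (intervalIntegral.intervalIntegrable_rpow' (a := 1 + a) (b := 1 + b) hs).comp_add_left 1
    simp only [add_sub_cancel_left] at this
    exact this.const_mul _
  have hbase : ∀ (p : ℝ), ∀ t ∈ I1, t ≤ 0 → (1 - t) ^ p ≤ 2 ^ |p| := fun p t ht ht0 =>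
    (Real.rpow_le_rpow_of_exponent_le (by linarith) (le_abs_self p)).trans
      (Real.rpow_le_rpow (by linarith) (by linarith [ht.1]) (abs_nonneg p))
  have hug : ∀ t ∈ I1, t ≤ 0 → ‖u t‖ ≤ g t := fun t ht ht0 => by
    refine (hb t ht).trans ?_
    change _ ≤ C * 2 ^ |r| * (1 + t) ^ s
    rw [mul_assoc]
    refine mul_le_mul_of_nonneg_left ?_ hC
    rw [ww, mul_comm]
    exact mul_le_mul_of_nonneg_right (hbase r t ht ht0) (Real.rpow_nonneg (one_add_pos ht).le _)
  have hui : IntervalIntegrable u volume (-1) 0 := by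
    rw [intervalIntegrable_iff_integrableOn_Ioo_of_le (by norm_num)]
    have h1 := (intervalIntegrable_iff_integrableOn_Ioo_of_le (by norm_num)).1 (hgi (-1) 0)
    refine h1.mono' ((hu.mono fun t ht => ⟨ht.1, ht.2.trans one_pos⟩).aestronglyMeasurable
      measurableSet_Ioo) ?_
    rw [ae_restrict_iff' measurableSet_Ioo]
    exact .of_forall fun t ht => hug t ⟨ht.1, ht.2.trans one_pos⟩ ht.2.le
  refine ⟨hui, fun x hx hx0 => ?_⟩
  have h1 : ‖∫ t in (-1 : ℝ)..x, u t‖ ≤ ∫ t in (-1 : ℝ)..x, g t := by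
    refine intervalIntegral.norm_integral_le_of_norm_le hx.1.le (.of_forall fun t ht => ?_) (hgi _ _)
    exact hug t ⟨ht.1, ht.2.trans_lt hx.2⟩ (ht.2.trans hx0)
  have h2 : ∫ t in (-1 : ℝ)..x, g t = C * 2 ^ |r| * ((1 + x) ^ (s + 1) * (s + 1)⁻¹) := by
    rw [hg, intervalIntegral.integral_const_mul,
      intervalIntegral.integral_comp_add_left (fun t : ℝ => t ^ s), integral_rpow (Or.inl hs)]
    norm_num [Real.zero_rpow hs1.ne', div_eq_mul_inv]
  rw [Real.norm_eq_abs, h2] at h1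
  refine h1.trans ?_
  have h3 : 1 ≤ 2 ^ |r + 1| * (1 - x) ^ (r + 1) := by
    have h4 := hbase (-(r + 1)) x hx hx0
    rw [abs_neg, Real.rpow_neg (one_sub_pos hx).le] at h4
    have h5 := Real.rpow_pos_of_pos (one_sub_pos hx) (r + 1)
    calc (1 : ℝ) = ((1 - x) ^ (r + 1))⁻¹ * (1 - x) ^ (r + 1) := (inv_mul_cancel₀ h5.ne').symm
      _ ≤ _ := mul_le_mul_of_nonneg_right h4 h5.le
  have h6 := Real.rpow_nonneg (one_add_pos hx).le (s + 1)
  calc C * 2 ^ |r| * ((1 + x) ^ (s + 1) * (s + 1)⁻¹)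
      = C * 2 ^ |r| * ((1 + x) ^ (s + 1) * (s + 1)⁻¹) * 1 := (mul_one _).symm
    _ ≤ C * 2 ^ |r| * ((1 + x) ^ (s + 1) * (s + 1)⁻¹) * (2 ^ |r + 1| * (1 - x) ^ (r + 1)) :=
        mul_le_mul_of_nonneg_left h3 (by positivity)
    _ = _ := by rw [ww]; ring

/-- Integration from the end points of a function with an integrable power bound. -/
lemma integrable_of_le {s r : ℝ} (hs : -1 < s) (hr : -1 < r) :
    ∃ K : ℝ, 0 ≤ K ∧ ∀ (u : ℝ → ℝ) (C : ℝ), 0 ≤ C → ContinuousOn u I1 →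
      (∀ t ∈ I1, |u t| ≤ C * ww s r t) →
      IntervalIntegrable u volume (-1) 0 ∧ IntervalIntegrable u volume 0 1 ∧
      (∀ x ∈ I1, x ≤ 0 → |∫ t in (-1 : ℝ)..x, u t| ≤ C * K * ww (s + 1) (r + 1) x) ∧
      ∀ x ∈ I1, 0 ≤ x → |∫ t in x..1, u t| ≤ C * K * ww (s + 1) (r + 1) x := by
  obtain ⟨K, hK, h⟩ := integrable_left_of_le (r := r) hs
  obtain ⟨K', hK', h'⟩ := integrable_left_of_le (r := s) hr
  refine ⟨max K K', le_max_of_le_left hK, fun u C hC hu hb => ?_⟩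
  obtain ⟨i1, b1⟩ := h u C hC hu hb
  obtain ⟨i2, b2⟩ := h' (fun t => u (-t)) C hC (continuousOn_comp_neg hu)
      (fun t ht => by rw [← ww_reflect]; exact hb _ (neg_mem_I1 ht))
  refine ⟨i1, ?_, fun x hx hx0 => ?_, fun x hx hx0 => ?_⟩
  · have := (IntervalIntegrable.iff_comp_neg (by simp)).1 i2
    simpa using this.symm
  · refine (b1 x hx hx0).trans (mul_le_mul_of_nonneg_right ?_ (ww_pos _ _ hx).le)
    exact mul_le_mul_of_nonneg_left (le_max_left _ _) hC
  · have := b2 (-x) (neg_mem_I1 hx) (by linarith)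
    rw [intervalIntegral.integral_comp_neg, neg_neg, neg_neg, ww_reflect] at this
    refine this.trans (mul_le_mul_of_nonneg_right ?_ (ww_pos _ _ hx).le)
    exact mul_le_mul_of_nonneg_left (le_max_right _ _) hC

/-- The total integral of a function with an integrable power bound. -/
lemma abs_integral_le {s r : ℝ} (hs : -1 < s) (hr : -1 < r) :
    ∃ K : ℝ, 0 ≤ K ∧ ∀ (u : ℝ → ℝ) (C : ℝ), 0 ≤ C → ContinuousOn u I1 →
      (∀ t ∈ I1, |u t| ≤ C * ww s r t) →
      |∫ t in (-1 : ℝ)..0, u t| ≤ C * K ∧ |∫ t in (0 : ℝ)..1, u t| ≤ C * K := by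
  obtain ⟨K, hK, h⟩ := integrable_of_le hs hr
  refine ⟨K, hK, fun u C hC hu hb => ?_⟩
  obtain ⟨-, -, b1, b2⟩ := h u C hC hu hb
  have e : ww (s + 1) (r + 1) 0 = 1 := by simp [ww]
  have h1 := b1 0 zero_mem_I1 le_rfl
  have h2 := b2 0 zero_mem_I1 le_rfl
  rw [e, mul_one] at h1 h2
  exact ⟨h1, h2⟩

end Integrals

/-- The limits of a function bounded by a positive power at the end points. -/
lemma tendsto_zero_of_le_ww {p r C : ℝ} (hp : 0 < p) (hr : 0 < r) {y : ℝ → ℝ}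
    (h : ∀ x ∈ I1, |y x| ≤ C * ww p r x) :
    Tendsto y (𝓝[>] (-1)) (𝓝 0) ∧ Tendsto y (𝓝[<] 1) (𝓝 0) := by
  have hc : Continuous fun x => C * ww p r x := by
    unfold ww
    refine continuous_const.mul (Continuous.mul ?_ ?_)
    · exact Continuous.rpow_const (by fun_prop) fun x => Or.inr hp.le
    · exact Continuous.rpow_const (by fun_prop) fun x => Or.inr hr.le
  have e1 : C * ww p r (-1) = 0 := by simp [ww, Real.zero_rpow hp.ne']
  have e2 : C * ww p r 1 = 0 := by simp [ww, Real.zero_rpow hr.ne']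
  constructor
  · refine squeeze_zero_norm' (a := fun x => C * ww p r x) ?_ ?_
    · filter_upwards [Ioo_mem_nhdsGT (show (-1 : ℝ) < 1 by norm_num)] with x hx using h x hx
    · have := hc.tendsto (-1)
      rw [e1] at this
      exact this.mono_left nhdsWithin_le_nhds
  · refine squeeze_zero_norm' (a := fun x => C * ww p r x) ?_ ?_
    · filter_upwards [Ioo_mem_nhdsLT (show (-1 : ℝ) < 1 by norm_num)] with x hx using h x hx
    · have := hc.tendsto 1
      rw [e2] at this
      exact this.mono_left nhdsWithin_le_nhds

/-! ### The linear operators -/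

/-- The affine function `a (1 - x) - d (1 + x)`, where `q = (a, d)`. -/
def aff (q : ℝ × ℝ) (x : ℝ) : ℝ := q.1 * (1 - x) - q.2 * (1 + x)

lemma aff_add (q q' : ℝ × ℝ) (x : ℝ) : aff (q + q') x = aff q x + aff q' x := by
  simp only [aff, Prod.fst_add, Prod.snd_add]; ring
lemma aff_sub (q q' : ℝ × ℝ) (x : ℝ) : aff (q - q') x = aff q x - aff q' x := by
  simp only [aff, Prod.fst_sub, Prod.snd_sub]; ring
lemma aff_smul (t : ℝ) (q : ℝ × ℝ) (x : ℝ) : aff (t • q) x = t * aff q x := by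
  simp only [aff, Prod.smul_fst, Prod.smul_snd, smul_eq_mul]; ring

lemma hasDerivAt_aff (q : ℝ × ℝ) (x : ℝ) : HasDerivAt (aff q) (-(q.1 + q.2)) x :=
  ((((hasDerivAt_id' x).const_sub 1).const_mul q.1).sub
    (((hasDerivAt_id' x).const_add 1).const_mul q.2)).congr_deriv (by ring)

lemma continuous_aff (q : ℝ × ℝ) : Continuous (aff q) := by unfold aff; fun_prop

lemma abs_aff_le (q : ℝ × ℝ) {x : ℝ} (hx : x ∈ I1) : |aff q x| ≤ 4 * ‖q‖ := by
  have h1 : |q.1| ≤ ‖q‖ := norm_fst_le q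
  have h2 : |q.2| ≤ ‖q‖ := norm_snd_le q
  have e1 : |1 - x| ≤ 2 := abs_le.2 ⟨by linarith [hx.2], by linarith [hx.1]⟩
  have e2 : |1 + x| ≤ 2 := abs_le.2 ⟨by linarith [hx.1], by linarith [hx.2]⟩
  calc |aff q x| ≤ |q.1 * (1 - x)| + |q.2 * (1 + x)| := abs_sub _ _
    _ ≤ ‖q‖ * 2 + ‖q‖ * 2 := by
        rw [abs_mul, abs_mul]
        exact add_le_add (mul_le_mul h1 e1 (abs_nonneg _) (norm_nonneg _))
          (mul_le_mul h2 e2 (abs_nonneg _) (norm_nonneg _))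
    _ = _ := by ring

/-- Derivative of an integrating factor. -/
lemma hasDerivAt_ww_aff (a d : ℝ) {x : ℝ} (hx : x ∈ I1) :
    HasDerivAt (ww a d) (aff (a, d) x * ww a d x / (1 - x ^ 2)) x := by
  refine (hasDerivAt_ww a d hx).congr_deriv ?_
  have h := ww_add (a - 1) (d - 1) 1 1 hx
  rw [sub_add_cancel, sub_add_cancel, ww_one] at h
  rw [h, aff]
  field_simp [(one_sub_sq_pos hx).ne']

/-- Admissible pairs of exponents. -/
structure GoodExp (ε : ℝ) (q : ℝ × ℝ) : Prop where
  pos : 0 < ε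
  lt_half : ε < 1 / 2
  one_le_fst : 1 ≤ q.1
  one_le_snd : 1 ≤ q.2
  fst_lt : q.1 < 1 + ε
  snd_lt : q.2 < 1 + ε

/-- Right-hand sides for the operator `f ↦ (1 - x²) f' + (2x + Ū) f`. -/
structure ThetaData (ε C : ℝ) (h h1 h2 : ℝ → ℝ) : Prop where
  cont : ContinuousOn h I1
  deriv1 : ∀ x ∈ Ih, HasDerivAt h (h1 x) x
  deriv2 : ∀ x ∈ Ih, HasDerivAt h1 (h2 x) x
  cont2 : ContinuousOn h2 Ih
  bdd0 : ∀ x ∈ I1, |h x| ≤ C * wt (1 - 2 * ε) x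
  bdd1 : ∀ x ∈ Ih, |h1 x| ≤ C
  bdd2 : ∀ x ∈ Ih, |h2 x| ≤ C

/-- Functions determined by their equation: `f` solves `(1 - x²) f' + (2x + Ū) f = h` up to a
multiple of `1 - x²`. -/
def ThetaSol {ε : ℝ} (q : ℝ × ℝ) (f : M1 ε) (h : ℝ → ℝ) : Prop :=
  ∃ l : ℝ, ∀ x ∈ I1, (1 - x ^ 2) * deriv f.fn x + (2 * x + aff q x) * f.fn x = h x + l * (1 - x ^ 2)

/-- `G` solves `(1 - x²) G'' + Ū G' = r`. -/
def PhiSol {ε : ℝ} (q : ℝ × ℝ) (G : M2 ε) (r : ℝ → ℝ) : Prop :=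
  ∀ x ∈ I1, (1 - x ^ 2) * iteratedDeriv 2 G.fn x + aff q x * deriv G.fn x = r x

/-- A monotone function lies between its limits at the two ends, and both are `0`. -/
lemma zero_of_deriv_nonneg {y : ℝ → ℝ} {y' : ℝ → ℝ} (hd : ∀ x ∈ I1, HasDerivAt y (y' x) x)
    (hy : ∀ x ∈ I1, 0 ≤ y' x) (h1 : Tendsto y (𝓝[>] (-1)) (𝓝 0))
    (h2 : Tendsto y (𝓝[<] 1) (𝓝 0)) : ∀ x ∈ I1, y x = 0 := by
  have hm : MonotoneOn y I1 := by
    refine monotoneOn_of_deriv_nonneg (convex_Ioo _ _)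
      (fun x hx => (hd x hx).continuousAt.continuousWithinAt) ?_ ?_
    · rw [interior_Ioo]
      exact fun x hx => (hd x hx).differentiableAt.differentiableWithinAt
    · rw [interior_Ioo]
      exact fun x hx => by rw [(hd x hx).deriv]; exact hy x hx
  intro x hx
  refine le_antisymm ?_ ?_
  · refine ge_of_tendsto h2 ?_
    filter_upwards [Ioo_mem_nhdsLT hx.2] with t ht
    exact hm hx ⟨hx.1.trans ht.1, ht.2⟩ ht.1.le
  · refine le_of_tendsto h1 ?_
    filter_upwards [Ioo_mem_nhdsGT hx.1] with t ht
    exact hm ⟨ht.1, ht.2.trans hx.2⟩ hx ht.2.le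

/-- With the integrating factor, `y = (1 + x)^(a-1) (1 - x)^(d-1) f` has derivative `l` times a
positive function, hence is monotone. It tends to `0` at both ends because `f` is of size `(1 -
x²)^(1 - 2ε)` and the exponents `a - 2ε`, `d - 2ε` are positive. So `y = 0`, whatever `l` is. -/
lemma ThetaSol.eq_zero {ε : ℝ} {q : ℝ × ℝ} (hq : GoodExp ε q) {f : M1 ε}
    (h : ThetaSol q f 0) : f = 0 := by
  obtain ⟨l, hl⟩ := h
  obtain ⟨a, d⟩ := q
  have ha : 1 ≤ a := hq.one_le_fst
  have hd : 1 ≤ d := hq.one_le_snd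
  have hε := hq.lt_half
  set y : ℝ → ℝ := fun x => ww (a - 1) (d - 1) x * f.fn x with hy
  have hyd : ∀ x ∈ I1, HasDerivAt y (l * ww (a - 1) (d - 1) x) x := by
    intro x hx
    refine ((hasDerivAt_ww_aff (a - 1) (d - 1) hx).mul (f.hasDerivAt hx)).congr_deriv ?_
    have := hl x hx
    have hp := (one_sub_sq_pos hx).ne'
    have e : aff (a - 1, d - 1) x = 2 * x + aff (a, d) x := by simp only [aff]; ring
    rw [e]
    simp only [Pi.zero_apply, zero_add] at this
    field_simp
    linear_combination ww (a - 1) (d - 1) x * this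
  have hyb : ∀ x ∈ I1, |y x| ≤ ‖f‖ * ww (a - 2 * ε) (d - 2 * ε) x := by
    intro x hx
    have h1 := (abs_le_mul_wt_neg hx).1 (f.bound0 hx)
    rw [wt_eq_ww _ hx] at h1
    have h2 := ww_add (a - 1) (d - 1) (-(-1 + 2 * ε)) (-(-1 + 2 * ε)) hx
    rw [show a - 1 + -(-1 + 2 * ε) = a - 2 * ε by ring,
      show d - 1 + -(-1 + 2 * ε) = d - 2 * ε by ring] at h2
    rw [hy, abs_mul, abs_of_pos (ww_pos _ _ hx), h2]
    calc _ ≤ ww (a - 1) (d - 1) x * (‖f‖ * ww (-(-1 + 2 * ε)) (-(-1 + 2 * ε)) x) :=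
          mul_le_mul_of_nonneg_left h1 (ww_pos _ _ hx).le
      _ = _ := by ring
  obtain ⟨t1, t2⟩ := tendsto_zero_of_le_ww (by linarith) (by linarith) hyb
  have hy0 : ∀ x ∈ I1, y x = 0 := by
    rcases le_total 0 l with hl0 | hl0
    · exact zero_of_deriv_nonneg hyd (fun x hx => mul_nonneg hl0 (ww_pos _ _ hx).le) t1 t2
    · have := zero_of_deriv_nonneg (y := fun x => -y x) (fun x hx => (hyd x hx).neg)
        (fun x hx => by
          have := mul_nonneg (neg_nonneg.2 hl0) (ww_pos (a - 1) (d - 1) hx).le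
          linarith) (by simpa using t1.neg) (by simpa using t2.neg)
      exact fun x hx => neg_eq_zero.1 (this x hx)
  exact M1.ext_on fun x hx => (mul_eq_zero.1 (hy0 x hx)).resolve_left (ww_pos _ _ hx).ne'

/-- Solution of the linear equation for `U_θ` on the level of functions. -/
lemma exists_theta_function {ε : ℝ} {q : ℝ × ℝ} (hq : GoodExp ε q) :
    ∃ K : ℝ, 0 ≤ K ∧ ∀ (C : ℝ) (h : ℝ → ℝ), 0 ≤ C → ContinuousOn h I1 →
      (∀ x ∈ I1, |h x| ≤ C * wt (1 - 2 * ε) x) →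
      ∃ (f : ℝ → ℝ) (l : ℝ), |l| ≤ K * C ∧ (∀ x ∈ I1, |wt (-1 + 2 * ε) x * f x| ≤ K * C) ∧
        ∀ x ∈ I1, HasDerivAt f ((h x + l * (1 - x ^ 2) - (2 * x + aff q x) * f x) / (1 - x ^ 2)) x := by
  obtain ⟨a, d⟩ := q
  have ha : 1 ≤ a := hq.one_le_fst
  have hd : 1 ≤ d := hq.one_le_snd
  have hε := hq.lt_half
  have hε0 := hq.pos
  -- These are the exponents of the integrating factor times the data, divided by `1 - x²`. They are
  -- integrable since `a, d ≥ 1` and `ε < 1/2`.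
  have hs : -1 < a - 1 - 2 * ε := by linarith
  have hr : -1 < d - 1 - 2 * ε := by linarith
  obtain ⟨K1, hK1, hI⟩ := integrable_of_le hs hr
  obtain ⟨K2, hK2, hT⟩ := abs_integral_le hs hr
  obtain ⟨K3, hK3, hW⟩ := ww_le_ww (s := a - 1) (r := d - 1) (s' := a - 1 - 2 * ε)
    (r' := d - 1 - 2 * ε) (by linarith) (by linarith)
  have hμb : ∀ t ∈ I1, |ww (a - 1) (d - 1) t| ≤ K3 * ww (a - 1 - 2 * ε) (d - 1 - 2 * ε) t :=
    fun t ht => by rw [abs_of_pos (ww_pos _ _ ht)]; exact hW t ht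
  have hμc := continuousOn_ww (a - 1) (d - 1)
  obtain ⟨iμ1, iμ2, -, -⟩ := hI _ K3 hK3.le hμc hμb
  -- The total mass multiplying `l` in the compatibility condition; its positivity makes `l`
  -- solvable.
  set M : ℝ := (∫ t in (-1 : ℝ)..0, ww (a - 1) (d - 1) t) + ∫ t in (0 : ℝ)..1, ww (a - 1) (d - 1) t
    with hM
  have hMpos : 0 < M := by
    refine add_pos ?_ ?_
    · exact intervalIntegral.intervalIntegral_pos_of_pos_on iμ1
        (fun x hx => ww_pos _ _ ⟨hx.1, hx.2.trans one_pos⟩) (by norm_num)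
    · exact intervalIntegral.intervalIntegral_pos_of_pos_on iμ2
        (fun x hx => ww_pos _ _ ⟨by linarith [hx.1], hx.2⟩) (by norm_num)
  set L : ℝ := 2 * K2 / M with hL
  have hL0 : 0 ≤ L := by positivity
  refine ⟨L + (1 + L * K3) * K1, by positivity, fun C h hC hc hb => ?_⟩
  set m : ℝ → ℝ := fun t => ww (a - 2) (d - 2) t * h t with hm
  have hmc : ContinuousOn m I1 := (continuousOn_ww _ _).mul hc
  have hmb : ∀ t ∈ I1, |m t| ≤ C * ww (a - 1 - 2 * ε) (d - 1 - 2 * ε) t := fun t ht => by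
    have h2 := ww_add (a - 2) (d - 2) (1 - 2 * ε) (1 - 2 * ε) ht
    rw [show a - 2 + (1 - 2 * ε) = a - 1 - 2 * ε by ring,
      show d - 2 + (1 - 2 * ε) = d - 1 - 2 * ε by ring] at h2
    have h1 := hb t ht
    rw [wt_eq_ww _ ht] at h1
    rw [hm, abs_mul, abs_of_pos (ww_pos _ _ ht), h2]
    calc _ ≤ ww (a - 2) (d - 2) t * (C * ww (1 - 2 * ε) (1 - 2 * ε) t) :=
          mul_le_mul_of_nonneg_left h1 (ww_pos _ _ ht).le
      _ = _ := by ring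
  obtain ⟨im1, im2, -, -⟩ := hI m C hC hmc hmb
  obtain ⟨T1, T2⟩ := hT m C hC hmc hmb
  -- This value makes the integral of `n` over `(-1, 1)` vanish. The primitive of `n` from `-1` is
  -- then also minus the integral from `x` to `1`, and so decays at both end points.
  set l : ℝ := -((∫ t in (-1 : ℝ)..0, m t) + ∫ t in (0 : ℝ)..1, m t) / M with hl
  have hlb : |l| ≤ L * C := by
    rw [hl, abs_div, abs_neg, abs_of_pos hMpos, hL, div_mul_eq_mul_div]
    refine div_le_div_of_nonneg_right ?_ hMpos.le
    linarith [abs_add_le (∫ t in (-1 : ℝ)..0, m t) (∫ t in (0 : ℝ)..1, m t)]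
  set n : ℝ → ℝ := fun t => m t + l * ww (a - 1) (d - 1) t with hn
  have hnc : ContinuousOn n I1 := hmc.add (continuousOn_const.mul hμc)
  have hnb : ∀ t ∈ I1, |n t| ≤ C * (1 + L * K3) * ww (a - 1 - 2 * ε) (d - 1 - 2 * ε) t := by
    intro t ht
    calc |n t| ≤ |m t| + |l * ww (a - 1) (d - 1) t| := abs_add_le _ _
      _ ≤ C * ww (a - 1 - 2 * ε) (d - 1 - 2 * ε) t
          + L * C * (K3 * ww (a - 1 - 2 * ε) (d - 1 - 2 * ε) t) := by
          rw [abs_mul l]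
          exact add_le_add (hmb t ht) (mul_le_mul hlb (hμb t ht) (abs_nonneg _) (by positivity))
      _ = _ := by ring
  have hC' : 0 ≤ C * (1 + L * K3) := by positivity
  obtain ⟨in1, in2, B1, B2⟩ := hI n _ hC' hnc hnb
  have htot : (∫ t in (-1 : ℝ)..0, n t) + ∫ t in (0 : ℝ)..1, n t = 0 := by
    simp only [hn]
    rw [intervalIntegral.integral_add im1 (iμ1.const_mul _),
      intervalIntegral.integral_add im2 (iμ2.const_mul _),
      intervalIntegral.integral_const_mul, intervalIntegral.integral_const_mul]
    have : l * M = -((∫ t in (-1 : ℝ)..0, m t) + ∫ t in (0 : ℝ)..1, m t) :=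
      div_mul_cancel₀ _ hMpos.ne'
    rw [hM] at this
    linarith
  set y : ℝ → ℝ := fun x => ∫ t in (-1 : ℝ)..x, n t with hy
  have hyd : ∀ x ∈ I1, HasDerivAt y (n x) x := fun x hx => hasDerivAt_integral hnc in1 hx
  have e1 : a - 1 - 2 * ε + 1 = a - 2 * ε := by ring
  have e2 : d - 1 - 2 * ε + 1 = d - 2 * ε := by ring
  rw [e1, e2] at B1 B2
  have hyb : ∀ x ∈ I1, |y x| ≤ C * (1 + L * K3) * K1 * ww (a - 2 * ε) (d - 2 * ε) x := by
    intro x hx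
    rcases le_total x 0 with hx0 | hx0
    · exact B1 x hx hx0
    · have i0 := intervalIntegrable_I1 hnc zero_mem_I1 hx
      have : y x = -∫ t in x..1, n t := by
        have h1 := intervalIntegral.integral_add_adjacent_intervals in1 i0
        have h2 := intervalIntegral.integral_add_adjacent_intervals i0 (i0.symm.trans in2)
        simp only [hy]
        linarith
      rw [this, abs_neg]
      exact B2 x hx hx0
  -- Dividing by the integrating factor turns the decay exponents `a - 2ε`, `d - 2ε` of `y` into `1
  -- - 2ε` at both ends, as `M₁` requires.
  refine ⟨fun x => ww (-(a - 1)) (-(d - 1)) x * y x, l, ?_, fun x hx => ?_, fun x hx => ?_⟩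
  · refine hlb.trans ?_
    rw [add_mul]
    exact le_add_of_nonneg_right (by positivity)
  · have h2 := ww_add (-1 + 2 * ε - (a - 1)) (-1 + 2 * ε - (d - 1)) (a - 2 * ε) (d - 2 * ε) hx
    rw [show -1 + 2 * ε - (a - 1) + (a - 2 * ε) = 0 by ring,
      show -1 + 2 * ε - (d - 1) + (d - 2 * ε) = 0 by ring, ww_zero] at h2
    have h3 := ww_add (-1 + 2 * ε) (-1 + 2 * ε) (-(a - 1)) (-(d - 1)) hx
    rw [wt_eq_ww _ hx, ← mul_assoc, ← h3, ← sub_eq_add_neg, ← sub_eq_add_neg, abs_mul,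
      abs_of_pos (ww_pos _ _ hx)]
    calc _ ≤ ww (-1 + 2 * ε - (a - 1)) (-1 + 2 * ε - (d - 1)) x *
          (C * (1 + L * K3) * K1 * ww (a - 2 * ε) (d - 2 * ε) x) :=
          mul_le_mul_of_nonneg_left (hyb x hx) (ww_pos _ _ hx).le
      _ = C * (1 + L * K3) * K1 := by rw [mul_left_comm, ← h2, mul_one]
      _ ≤ _ := by
          have : 0 ≤ L * C := by positivity
          linarith
  · refine ((hasDerivAt_ww_aff (-(a - 1)) (-(d - 1)) hx).mul (hyd x hx)).congr_deriv ?_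
    have hp := (one_sub_sq_pos hx).ne'
    have e : aff (-(a - 1), -(d - 1)) x = -(2 * x + aff (a, d) x) := by simp only [aff]; ring
    have h3 := ww_add (-(a - 1)) (-(d - 1)) (a - 1) (d - 1) hx
    have h4 := ww_add (a - 2) (d - 2) 1 1 hx
    rw [neg_add_cancel, neg_add_cancel, ww_zero] at h3
    rw [show a - 2 + 1 = a - 1 by ring, show d - 2 + 1 = d - 1 by ring, ww_one] at h4
    rw [e]
    simp only [hn, hm]
    rw [h4] at h3 ⊢
    field_simp
    linear_combination (-(h x) - l * (1 - x ^ 2)) * h3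

/-- The inverse of the linear operator for `U_θ`, with its bound. -/
theorem exists_thetaSol {ε : ℝ} {q : ℝ × ℝ} (hq : GoodExp ε q) :
    ∃ K : ℝ, 0 ≤ K ∧ ∀ (C : ℝ) (h h1 h2 : ℝ → ℝ), ThetaData ε C h h1 h2 →
      ∃ f : M1 ε, ThetaSol q f h ∧ ‖f‖ ≤ K * C := by
  obtain ⟨K, hK, hex⟩ := exists_theta_function hq
  have hε := hq.lt_half
  have hε0 := hq.pos
  set Q := 2 + 4 * ‖q‖ with hQ
  have hQ0 : 0 ≤ Q := by positivity
  set K1 := 1 + K + Q * K with hK1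
  set K2 := 2 * (1 + 2 * K + Q * (2 ^ |2 * ε| * K1) + Q * (2 ^ |1 - 2 * ε| * K)) with hK2
  set K3 := 2 * (1 + 2 * K + Q * K2 + 2 * Q * (2 ^ |2 * ε| * K1)) with hK3
  have hK10 : 0 ≤ K1 := by positivity
  have hK20 : 0 ≤ K2 := by positivity
  refine ⟨K + K1 + K2 + K3, by positivity, fun C h h1 h2 H => ?_⟩
  have hC : 0 ≤ C := (abs_nonneg _).trans (H.bdd1 0 zero_mem_Ih)
  obtain ⟨f, l, hl, hf, hd⟩ := hex C h hC H.cont H.bdd0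
  -- The three derivatives come from solving the equation for `f'` and differentiating it once and
  -- twice; `K1`, `K2`, `K3` are the resulting bounds. The factors `2` in `K2` and `K3` come from `1
  -- - x² ≥ 1/2` on the middle interval.
  set f1 : ℝ → ℝ := fun x =>
    (h x + l * (1 - x ^ 2) - (2 * x + aff q x) * f x) / (1 - x ^ 2) with hf1
  set f2 : ℝ → ℝ := fun x =>
    (h1 x - 2 * l * x - aff q x * f1 x - (2 - (q.1 + q.2)) * f x) / (1 - x ^ 2) with hf2
  set f3 : ℝ → ℝ := fun x =>
    (h2 x - 2 * l - (aff q x - 2 * x) * f2 x - (2 - 2 * (q.1 + q.2)) * f1 x) / (1 - x ^ 2) with hf3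
  have hfc : ContinuousOn f I1 := fun x hx => (hd x hx).continuousAt.continuousWithinAt
  have hac := continuous_aff q
  have hden : ∀ x ∈ I1, 1 - x ^ 2 ≠ 0 := fun x hx => (one_sub_sq_pos hx).ne'
  have hf1c : ContinuousOn f1 I1 := by
    refine ContinuousOn.div ?_ (by fun_prop) hden
    exact (H.cont.add (by fun_prop)).sub (ContinuousOn.mul (by fun_prop) hfc)
  have hsq : ∀ x : ℝ, HasDerivAt (fun x : ℝ => 1 - x ^ 2) (-(2 * x)) x := fun x => by
    simpa using (hasDerivAt_pow 2 x).const_sub 1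
  have hdd : ∀ x ∈ Ih, HasDerivAt f1 (f2 x) x := by
    intro x hx
    have hx' := Ih_subset_I1 hx
    have hn := hden x hx'
    have hlin : HasDerivAt (fun x => 2 * x + aff q x) (2 - (q.1 + q.2)) x :=
      (((hasDerivAt_id' x).const_mul 2).add (hasDerivAt_aff q x)).congr_deriv (by ring)
    refine (HasDerivAt.div (((H.deriv1 x hx).add ((hsq x).const_mul l)).sub (hlin.mul (hd x hx')))
      (hsq x) hn).congr_deriv ?_
    simp only [hf2, hf1, Pi.add_apply, Pi.sub_apply, Pi.mul_apply]
    field_simp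
    ring
  have hddd : ∀ x ∈ Ih, HasDerivAt f2 (f3 x) x := by
    intro x hx
    have hx' := Ih_subset_I1 hx
    have hn := hden x hx'
    refine (HasDerivAt.div ((((H.deriv2 x hx).sub ((hasDerivAt_id' x).const_mul (2 * l))).sub
      ((hasDerivAt_aff q x).mul (hdd x hx))).sub ((hd x hx').const_mul (2 - (q.1 + q.2))))
      (hsq x) hn).congr_deriv ?_
    have e : f2 x * (1 - x ^ 2) = h1 x - 2 * l * x - aff q x * f1 x - (2 - (q.1 + q.2)) * f x := by
      simp only [hf2]; rw [div_mul_cancel₀ _ hn]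
    change ((h2 x - 2 * l * 1 - (-(q.1 + q.2) * f1 x + aff q x * f2 x)
      - (2 - (q.1 + q.2)) * f1 x) * (1 - x ^ 2)
      - (h1 x - 2 * l * x - aff q x * f1 x - (2 - (q.1 + q.2)) * f x) * -(2 * x))
      / (1 - x ^ 2) ^ 2 = (h2 x - 2 * l - (aff q x - 2 * x) * f2 x
      - (2 - 2 * (q.1 + q.2)) * f1 x) / (1 - x ^ 2)
    rw [← e]
    field_simp
    ring
  have hf2c : ContinuousOn f2 Ih := fun x hx => (hddd x hx).continuousAt.continuousWithinAt
  have hf3c : ContinuousOn f3 Ih := by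
    refine ContinuousOn.div ?_ (by fun_prop) fun x hx => hden x (Ih_subset_I1 hx)
    exact ((H.cont2.sub continuousOn_const).sub (ContinuousOn.mul (by fun_prop) hf2c)).sub
      (continuousOn_const.mul (hf1c.mono Ih_subset_I1))
  have hA : ∀ x ∈ I1, |aff q x| ≤ Q := fun x hx => (abs_aff_le q hx).trans (by rw [hQ]; linarith)
  have hlinb : ∀ x ∈ I1, |2 * x + aff q x| ≤ Q := fun x hx => by
    have : |2 * x| ≤ 2 := abs_le.2 ⟨by linarith [hx.1], by linarith [hx.2]⟩
    exact (abs_add_le _ _).trans (add_le_add this (abs_aff_le q hx))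
  have hlinb' : ∀ x ∈ I1, |aff q x - 2 * x| ≤ Q := fun x hx => by
    have : |2 * x| ≤ 2 := abs_le.2 ⟨by linarith [hx.1], by linarith [hx.2]⟩
    refine (abs_sub _ _).trans ?_
    linarith [abs_aff_le q hx]
  have hsum : |q.1 + q.2| ≤ 2 * ‖q‖ := by
    have g1 : |q.1| ≤ ‖q‖ := norm_fst_le q
    have g2 : |q.2| ≤ ‖q‖ := norm_snd_le q
    linarith [abs_add_le q.1 q.2]
  have hc1 : |2 - (q.1 + q.2)| ≤ Q := by
    refine (abs_sub _ _).trans ?_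
    rw [abs_two]
    linarith [norm_nonneg q]
  have hc2 : |2 - 2 * (q.1 + q.2)| ≤ 2 * Q := by
    refine (abs_sub _ _).trans ?_
    rw [abs_mul, abs_two]
    linarith [norm_nonneg q]
  have hfb : ∀ x ∈ I1, |f x| ≤ K * C * wt (1 - 2 * ε) x := fun x hx => by
    have := (abs_le_mul_wt_neg hx).1 (hf x hx)
    rwa [show -(-1 + 2 * ε) = 1 - 2 * ε by ring] at this
  have hf1b : ∀ x ∈ I1, |f1 x| ≤ K1 * C * wt (-(2 * ε)) x := by
    intro x hx
    have hp := one_sub_sq_pos hx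
    have e : wt (1 - 2 * ε) x = wt (-(2 * ε)) x * (1 - x ^ 2) := by
      rw [← wt_one, ← wt_add _ _ hx]; congr 1; ring
    have hw := wt_pos (-(2 * ε)) x hx
    -- The term `l` in `f'` is only bounded, and is absorbed because the allowed growth `(1 -
    -- x²)^(-2ε)` is at least `1`.
    have hw1 : 1 ≤ wt (-(2 * ε)) x := by
      have := wt_anti (r := 0) (s := -(2 * ε)) (by linarith) hx
      simpa [wt] using this
    simp only [hf1]
    rw [abs_div, abs_of_pos hp, div_le_iff₀ hp]
    calc |h x + l * (1 - x ^ 2) - (2 * x + aff q x) * f x|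
        ≤ |h x| + |l| * (1 - x ^ 2) + |2 * x + aff q x| * |f x| := by
          refine (abs_sub _ _).trans ?_
          rw [abs_mul (2 * x + aff q x)]
          refine add_le_add_left ((abs_add_le _ _).trans ?_) _
          rw [abs_mul l, abs_of_pos hp]
      _ ≤ C * wt (1 - 2 * ε) x + K * C * (1 - x ^ 2) * wt (-(2 * ε)) x
          + Q * (K * C * wt (1 - 2 * ε) x) := by
          refine add_le_add (add_le_add (H.bdd0 x hx) ?_)
            (mul_le_mul (hlinb x hx) (hfb x hx) (abs_nonneg _) hQ0)
          refine (mul_le_mul_of_nonneg_right hl hp.le).trans ?_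
          exact le_mul_of_one_le_right (by positivity) hw1
      _ = _ := by rw [e, hK1]; ring
  have hmid : ∀ x ∈ Ih, ∀ z B : ℝ, |z| ≤ B → |z / (1 - x ^ 2)| ≤ 2 * B := by
    intro x hx z B hz
    have h34 : 1 / 2 ≤ 1 - x ^ 2 := by nlinarith [hx.1, hx.2]
    rw [abs_div, abs_of_pos (show 0 < 1 - x ^ 2 by linarith), div_le_iff₀ (by linarith)]
    nlinarith [abs_nonneg z]
  have hfm : ∀ x ∈ Ih, |f x| ≤ 2 ^ |1 - 2 * ε| * K * C := fun x hx => by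
    refine (hfb x (Ih_subset_I1 hx)).trans ?_
    have := mul_le_mul_of_nonneg_left (wt_mid (1 - 2 * ε) hx) (by positivity : 0 ≤ K * C)
    linarith
  have hf1m : ∀ x ∈ Ih, |f1 x| ≤ 2 ^ |2 * ε| * K1 * C := fun x hx => by
    refine (hf1b x (Ih_subset_I1 hx)).trans ?_
    have := mul_le_mul_of_nonneg_left (wt_mid (-(2 * ε)) hx) (by positivity : 0 ≤ K1 * C)
    rw [abs_neg] at this
    linarith
  have hf2b : ∀ x ∈ Ih, |f2 x| ≤ K2 * C := by
    intro x hx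
    have hx' := Ih_subset_I1 hx
    have hlx : |2 * l * x| ≤ 2 * (K * C) := by
      have : |x| ≤ 1 := abs_le.2 ⟨by linarith [hx'.1], by linarith [hx'.2]⟩
      rw [abs_mul, abs_mul, abs_two]
      exact (mul_le_of_le_one_right (by positivity) this).trans
        (mul_le_mul_of_nonneg_left hl (by norm_num))
    have m1 := mul_le_mul (hA x hx') (hf1m x hx) (abs_nonneg _) hQ0
    have m2 := mul_le_mul hc1 (hfm x hx) (abs_nonneg _) hQ0
    refine (hmid x hx _ (C + 2 * (K * C) + Q * (2 ^ |2 * ε| * K1 * C)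
      + Q * (2 ^ |1 - 2 * ε| * K * C)) ?_).trans_eq (by rw [hK2]; ring)
    refine (abs_sub _ _).trans (add_le_add ((abs_sub _ _).trans (add_le_add
      ((abs_sub _ _).trans (add_le_add (H.bdd1 x hx) hlx)) ?_)) ?_)
    · rw [abs_mul]; exact m1
    · rw [abs_mul]; exact m2
  have hf3b : ∀ x ∈ Ih, |f3 x| ≤ K3 * C := by
    intro x hx
    have hx' := Ih_subset_I1 hx
    have hlx : |2 * l| ≤ 2 * (K * C) := by
      rw [abs_mul, abs_two]
      exact mul_le_mul_of_nonneg_left hl (by norm_num)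
    have m1 := mul_le_mul (hlinb' x hx') (hf2b x hx) (abs_nonneg _) hQ0
    have m2 := mul_le_mul hc2 (hf1m x hx) (abs_nonneg _) (by positivity)
    refine (hmid x hx _ (C + 2 * (K * C) + Q * (K2 * C)
      + 2 * Q * (2 ^ |2 * ε| * K1 * C)) ?_).trans_eq (by rw [hK3]; ring)
    refine (abs_sub _ _).trans (add_le_add ((abs_sub _ _).trans (add_le_add
      ((abs_sub _ _).trans (add_le_add (H.bdd2 x hx) hlx)) ?_)) ?_)
    · rw [abs_mul]; exact m1
    · rw [abs_mul]; exact m2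
  obtain ⟨F, e0, e1, -, -, hF⟩ := M1.exists_of (ε := ε) hε hd hf1c hdd hddd hf3c hf
    (fun x hx => (abs_le_mul_wt_neg hx).2 (hf1b x hx)) hf2b hf3b
  refine ⟨F, ⟨l, fun x hx => ?_⟩, hF.trans_eq (by ring)⟩
  rw [e0 hx, e1 hx]
  rw [mul_div_cancel₀ _ (hden x hx)]
  ring

/-! ### The linearized equation for `U_φ`. -/

/-- Construction of `G` from the integrated form of its equation. -/
lemma exists_phi_of_integrated {ε : ℝ} {q : ℝ × ℝ} (hq : GoodExp ε q) :
    ∃ K : ℝ, 0 ≤ K ∧ ∀ (C : ℝ) (Y n : ℝ → ℝ), 0 ≤ C → (∀ x ∈ I1, HasDerivAt Y (n x) x) →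
      ContinuousOn n I1 → (∀ x ∈ I1, |Y x| ≤ C * ww (q.1 - 1 - ε) (q.2 - 1 - ε) x) →
      (∀ x ∈ I1, |n x| ≤ C * ww (q.1 - 2 - ε) (q.2 - 2 - ε) x) →
      ∃ G : M2 ε, EqOn G.fn (fun x => ∫ t in (0 : ℝ)..x, ww (-q.1) (-q.2) t * Y t) I1 ∧
        EqOn (deriv G.fn) (fun x => ww (-q.1) (-q.2) x * Y x) I1 ∧
        PhiSol q G (fun x => ww (1 - q.1) (1 - q.2) x * n x) ∧ ‖G‖ ≤ K * C := by
  have hε0 := hq.pos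
  obtain ⟨a, d⟩ := q
  obtain ⟨K, hK, hI⟩ := abs_integral_from_zero_le (s := -1 - ε) (r := -1 - ε) (by linarith)
    (by linarith)
  set Q := 1 + 4 * ‖(a, d)‖ with hQ
  refine ⟨K + 1 + Q, by positivity, fun C Y n hC hY hn bY bn => ?_⟩
  simp only at bY bn ⊢
  -- `Y` stands for `(1 + x)ᵃ (1 - x)ᵈ G'`, so `g1` and `g2` are `G'` and `G''`. The assumed
  -- exponents give the growth rates `-1 - ε` and `-2 - ε` of `M₂`, and integration from `0` gives
  -- `-ε` for `G`.
  set g1 : ℝ → ℝ := fun x => ww (-a) (-d) x * Y x with hg1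
  set g2 : ℝ → ℝ := fun x => ww (-a) (-d) x * n x + -(aff (a, d) x * g1 x) / (1 - x ^ 2) with hg2
  have hYc : ContinuousOn Y I1 := fun x hx => (hY x hx).continuousAt.continuousWithinAt
  have hg1c : ContinuousOn g1 I1 := (continuousOn_ww _ _).mul hYc
  have hac := continuous_aff (a, d)
  have hden : ∀ x ∈ I1, 1 - x ^ 2 ≠ 0 := fun x hx => (one_sub_sq_pos hx).ne'
  have hg2c : ContinuousOn g2 I1 :=
    ((continuousOn_ww _ _).mul hn).add
      (ContinuousOn.div (ContinuousOn.mul (by fun_prop) hg1c).neg (by fun_prop) hden)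
  have hg1d : ∀ x ∈ I1, HasDerivAt g1 (g2 x) x := fun x hx => by
    refine ((hasDerivAt_ww_aff (-a) (-d) hx).mul (hY x hx)).congr_deriv ?_
    have e : aff (-a, -d) x = -aff (a, d) x := by simp only [aff]; ring
    simp only [hg2, hg1, e]
    ring
  have bg1 : ∀ x ∈ I1, |g1 x| ≤ C * ww (-1 - ε) (-1 - ε) x := fun x hx => by
    have h := ww_add (-a) (-d) (a - 1 - ε) (d - 1 - ε) hx
    rw [show -a + (a - 1 - ε) = -1 - ε by ring, show -d + (d - 1 - ε) = -1 - ε by ring] at h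
    rw [hg1, abs_mul, abs_of_pos (ww_pos _ _ hx), h, mul_left_comm]
    exact mul_le_mul_of_nonneg_left (bY x hx) (ww_pos _ _ hx).le
  have bg2 : ∀ x ∈ I1, |g2 x| ≤ Q * C * ww (-2 - ε) (-2 - ε) x := fun x hx => by
    have h := ww_add (-a) (-d) (a - 2 - ε) (d - 2 - ε) hx
    rw [show -a + (a - 2 - ε) = -2 - ε by ring, show -d + (d - 2 - ε) = -2 - ε by ring] at h
    have h1 : |ww (-a) (-d) x * n x| ≤ C * ww (-2 - ε) (-2 - ε) x := by
      rw [abs_mul, abs_of_pos (ww_pos _ _ hx), h, mul_left_comm]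
      exact mul_le_mul_of_nonneg_left (bn x hx) (ww_pos _ _ hx).le
    have h3 := ww_add (-2 - ε) (-2 - ε) 1 1 hx
    rw [show -2 - ε + 1 = -1 - ε by ring, ww_one] at h3
    have hp := one_sub_sq_pos hx
    have h2 : |-(aff (a, d) x * g1 x) / (1 - x ^ 2)|
        ≤ 4 * ‖(a, d)‖ * (C * ww (-2 - ε) (-2 - ε) x) := by
      rw [abs_div, abs_of_pos hp, abs_neg, div_le_iff₀ hp, abs_mul]
      refine (mul_le_mul (abs_aff_le _ hx) (bg1 x hx) (abs_nonneg _) (by positivity)).trans_eq ?_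
      rw [h3]
      ring
    refine (abs_add_le _ _).trans ((add_le_add h1 h2).trans_eq ?_)
    rw [hQ]
    ring
  have bg0 := hI g1 C hC hg1c bg1
  have e0 : ∀ x ∈ I1, wt (-ε) x = ww (-1 - ε + 1) (-1 - ε + 1) x := fun x hx => by
    rw [wt_eq_ww _ hx, show -1 - ε + 1 = -ε by ring]
  have e1 : ∀ x ∈ I1, wt (-(1 + ε)) x = ww (-1 - ε) (-1 - ε) x := fun x hx => by
    rw [wt_eq_ww _ hx, show -(1 + ε) = -1 - ε by ring]
  have e2 : ∀ x ∈ I1, wt (-(2 + ε)) x = ww (-2 - ε) (-2 - ε) x := fun x hx => by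
    rw [wt_eq_ww _ hx, show -(2 + ε) = -2 - ε by ring]
  obtain ⟨G, f0, f1, f2, hG⟩ := M2.exists_of (ε := ε)
    (fun x hx => hasDerivAt_integral (a := 0) hg1c (by simp) hx) hg1d hg2c
    (fun x hx => (abs_le_mul_wt_neg hx).2 (by rw [e0 x hx]; exact bg0 x hx))
    (fun x hx => (abs_le_mul_wt_neg hx).2 (by rw [e1 x hx]; exact bg1 x hx))
    (fun x hx => (abs_le_mul_wt_neg hx).2 (by rw [e2 x hx]; exact bg2 x hx))
  refine ⟨G, f0, f1, fun x hx => ?_, hG.trans_eq (by ring)⟩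
  have h := ww_add (-a) (-d) 1 1 hx
  rw [ww_one, show -a + 1 = 1 - a by ring, show -d + 1 = 1 - d by ring] at h
  have hp := hden x hx
  rw [f1 hx, f2 hx]
  simp only [hg2, h]
  field_simp
  ring

/-- The inverse of the linear operator for `U_φ`, with its bound. -/
theorem exists_phiSol {ε : ℝ} {q : ℝ × ℝ} (hq : GoodExp ε q) :
    ∃ K : ℝ, 0 ≤ K ∧ ∀ (C : ℝ) (r : ℝ → ℝ), 0 ≤ C → ContinuousOn r I1 →
      (∀ x ∈ I1, |r x| ≤ C * wt (-(1 + ε)) x) →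
      ∃ G : M2 ε, PhiSol q G r ∧ G.fn 0 = 0 ∧ deriv G.fn 0 = 0 ∧ ‖G‖ ≤ K * C := by
  obtain ⟨K, hK, hex⟩ := exists_phi_of_integrated hq
  have h1 := hq.fst_lt
  have h2 := hq.snd_lt
  obtain ⟨a, d⟩ := q
  simp only at h1 h2 hex
  -- `a, d < 1 + ε` says that these exponents are below `-1`: the integrand is not controlled by an
  -- integrable power, and its primitive from `0` grows at most like the next power.
  obtain ⟨L, hL, hI⟩ := abs_integral_from_zero_le (s := a - 2 - ε) (r := d - 2 - ε) (by linarith)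
    (by linarith)
  refine ⟨K * (1 + L), by positivity, fun C r hC hr hb => ?_⟩
  set n : ℝ → ℝ := fun t => ww (a - 1) (d - 1) t * r t with hn
  have hnc : ContinuousOn n I1 := (continuousOn_ww _ _).mul hr
  have bn : ∀ x ∈ I1, |n x| ≤ C * ww (a - 2 - ε) (d - 2 - ε) x := fun x hx => by
    have h := ww_add (a - 1) (d - 1) (-(1 + ε)) (-(1 + ε)) hx
    rw [show a - 1 + -(1 + ε) = a - 2 - ε by ring, show d - 1 + -(1 + ε) = d - 2 - ε by ring] at h
    rw [hn, abs_mul, abs_of_pos (ww_pos _ _ hx), h, mul_left_comm, ← wt_eq_ww _ hx]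
    exact mul_le_mul_of_nonneg_left (hb x hx) (ww_pos _ _ hx).le
  have bY := hI n C hC hnc bn
  obtain ⟨G, f0, f1, hG, hGn⟩ := hex (C * (1 + L)) (fun x => ∫ t in (0 : ℝ)..x, n t) n
    (by positivity) (fun x hx => hasDerivAt_integral hnc (by simp) hx) hnc
    (fun x hx => by
      refine (bY x hx).trans ?_
      rw [show a - 2 - ε + 1 = a - 1 - ε by ring, show d - 2 - ε + 1 = d - 1 - ε by ring]
      refine mul_le_mul_of_nonneg_right ?_ (ww_pos _ _ hx).le
      nlinarith)
    (fun x hx => by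
      refine (bn x hx).trans (mul_le_mul_of_nonneg_right ?_ (ww_pos _ _ hx).le)
      nlinarith)
  refine ⟨G, fun x hx => ?_, by rw [f0 zero_mem_I1]; simp, by rw [f1 zero_mem_I1]; simp,
    hGn.trans_eq (by ring)⟩
  rw [hG x hx]
  simp only [hn]
  rw [← mul_assoc, ← ww_add _ _ _ _ hx]
  simp [ww_zero]

/-- The kernel of the linear operator for `U_φ` contains the primitive of `e^{-b}`. -/
theorem exists_phi_kernel {ε : ℝ} {q : ℝ × ℝ} (hq : GoodExp ε q) :
    ∃ H : M2 ε, EqOn H.fn (fun x => ∫ t in (0 : ℝ)..x, ww (-q.1) (-q.2) t) I1 ∧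
      PhiSol q H 0 ∧ H.fn 0 = 0 ∧ deriv H.fn 0 = 1 := by
  obtain ⟨K, -, hex⟩ := exists_phi_of_integrated hq
  obtain ⟨L, hL, hw⟩ := ww_le_ww (s := 0) (r := 0) (s' := q.1 - 1 - ε) (r' := q.2 - 1 - ε)
    (by linarith [hq.fst_lt]) (by linarith [hq.snd_lt])
  -- The kernel element has constant `Y = 1`, which is within the allowed growth because `a - 1 - ε`
  -- and `d - 1 - ε` are negative.
  obtain ⟨G, f0, f1, hG, -⟩ := hex L (fun _ => 1) (fun _ => 0) hL.le
    (fun x _ => hasDerivAt_const x 1) continuousOn_const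
    (fun x hx => by simpa [ww_zero] using hw x hx)
    (fun x hx => by simpa using mul_nonneg hL.le (ww_pos (q.1 - 2 - ε) (q.2 - 2 - ε) hx).le)
  simp only [mul_one, mul_zero] at f0 f1 hG
  refine ⟨G, f0, hG, by rw [f0 zero_mem_I1]; simp, by rw [f1 zero_mem_I1]; simp [ww]⟩

lemma eqOn_zero_of_hasDerivAt_zero {z : ℝ → ℝ} (hz : ∀ x ∈ I1, HasDerivAt z 0 x) {x : ℝ}
    (hx : x ∈ I1) : z x = z 0 :=
  isOpen_I1.is_const_of_deriv_eq_zero (convex_Ioo _ _).isPreconnected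
    (fun y hy => (hz y hy).differentiableAt.differentiableWithinAt) (fun y hy => (hz y hy).deriv)
    hx zero_mem_I1

/-- The product `(1 + x)ᵃ (1 - x)ᵈ G'` is constant and vanishes at `0`; hence `G' = 0` and `G` is
constant too. -/
lemma PhiSol.eq_zero {ε : ℝ} {q : ℝ × ℝ} {G : M2 ε} (h : PhiSol q G 0) (h0 : G.fn 0 = 0)
    (h1 : deriv G.fn 0 = 0) : G = 0 := by
  obtain ⟨a, d⟩ := q
  have hz : ∀ x ∈ I1, HasDerivAt (fun x => ww a d x * deriv G.fn x) 0 x := fun x hx => by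
    refine ((hasDerivAt_ww_aff a d hx).mul (G.hasDerivAt_deriv hx)).congr_deriv ?_
    have hp := (one_sub_sq_pos hx).ne'
    have := h x hx
    simp only [Pi.zero_apply] at this
    field_simp
    linear_combination ww a d x * this
  have hd : ∀ x ∈ I1, deriv G.fn x = 0 := fun x hx => by
    have := eqOn_zero_of_hasDerivAt_zero hz hx
    rw [h1, mul_zero] at this
    exact (mul_eq_zero.1 this).resolve_left (ww_pos _ _ hx).ne'
  refine M2.ext_on fun x hx => ?_
  rw [eqOn_zero_of_hasDerivAt_zero (z := G.fn) (fun y hy => by rw [← hd y hy]; exact G.hasDerivAt hy) hx, h0]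
  rfl

/-! ### Iterated integrals -/

/-- The threefold primitive with base point `0`. -/
def trip (κ : ℝ → ℝ) (x : ℝ) : ℝ :=
  ∫ l in (0 : ℝ)..x, ∫ t in (0 : ℝ)..l, ∫ s in (0 : ℝ)..t, κ s

/-- The threefold primitive corrected by an affine function so as to vanish at `±1`. -/
def tripT (κ : ℝ → ℝ) (x : ℝ) : ℝ :=
  trip κ x - (1 / 2) * trip κ (-1) * (1 - x) - (1 / 2) * trip κ 1 * (1 + x)

lemma mem_I1_of_uIoo {x l : ℝ} (hx : x ∈ Icc (-1 : ℝ) 1) (hl : l ∈ uIoo 0 x) : l ∈ I1 := by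
  rcases le_total 0 x with h | h
  · rw [uIoo_of_le h] at hl; exact ⟨by linarith [hl.1], hl.2.trans_le hx.2⟩
  · rw [uIoo_of_ge h] at hl; exact ⟨hx.1.trans_lt hl.1, by linarith [hl.2]⟩

lemma I1_subset_Icc {x : ℝ} (hx : x ∈ I1) : x ∈ Icc (-1 : ℝ) 1 := ⟨hx.1.le, hx.2.le⟩

/-- All three variables of integration stay in the open interval even for `x = ±1`, where the
primitive is evaluated to form the constants `ĉ₁, ĉ₂`. -/
lemma trip_congr {κ κ' : ℝ → ℝ} (h : EqOn κ κ' I1) {x : ℝ} (hx : x ∈ Icc (-1 : ℝ) 1) :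
    trip κ x = trip κ' x :=
  intervalIntegral.integral_congr_uIoo fun _ hl => intervalIntegral.integral_congr_uIoo fun _ ht =>
    intervalIntegral.integral_congr_uIoo fun _ hs => h (mem_I1_of_uIoo (I1_subset_Icc
      (mem_I1_of_uIoo (I1_subset_Icc (mem_I1_of_uIoo hx hl)) ht)) hs)

lemma trip_smul (c : ℝ) (κ : ℝ → ℝ) (x : ℝ) : trip (fun s => c * κ s) x = c * trip κ x := by
  simp only [trip, intervalIntegral.integral_const_mul]

lemma tripT_congr {κ κ' : ℝ → ℝ} (h : EqOn κ κ' I1) {x : ℝ} (hx : x ∈ Icc (-1 : ℝ) 1) :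
    tripT κ x = tripT κ' x := by
  simp only [tripT]
  rw [trip_congr h hx, trip_congr h (by norm_num), trip_congr h (by norm_num)]

lemma tripT_smul (c : ℝ) (κ : ℝ → ℝ) (x : ℝ) : tripT (fun s => c * κ s) x = c * tripT κ x := by
  simp only [tripT, trip_smul]; ring

/-- The second primitive of a function on `(-1, 1)`. -/
lemma hasDerivAt_primitive {u : ℝ → ℝ} (hu : ContinuousOn u I1) {x : ℝ} (hx : x ∈ I1) :
    HasDerivAt (fun y => ∫ t in (0 : ℝ)..y, u t) (u x) x :=
  hasDerivAt_integral (a := 0) hu (by simp) hx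

lemma continuousOn_primitive {u : ℝ → ℝ} (hu : ContinuousOn u I1) :
    ContinuousOn (fun y => ∫ t in (0 : ℝ)..y, u t) I1 := fun _ hx =>
  (hasDerivAt_primitive hu hx).continuousAt.continuousWithinAt

/-- The corrected threefold primitive is a right-hand side for the linear equation for `U_θ`. -/
lemma exists_thetaData_tripT {ε : ℝ} (hε0 : 0 < ε) (hε : ε < 1 / 2) :
    ∃ K : ℝ, 0 ≤ K ∧ ∀ (C : ℝ) (κ : ℝ → ℝ), 0 ≤ C → ContinuousOn κ I1 →
      (∀ x ∈ I1, |κ x| ≤ C * wt (-(2 + 2 * ε)) x) →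
      IntervalIntegrable (fun l => ∫ t in (0 : ℝ)..l, ∫ s in (0 : ℝ)..t, κ s) volume (-1) 0 ∧
      IntervalIntegrable (fun l => ∫ t in (0 : ℝ)..l, ∫ s in (0 : ℝ)..t, κ s) volume 0 1 ∧
      ThetaData ε (K * C) (tripT κ)
        (fun x => (∫ t in (0 : ℝ)..x, ∫ s in (0 : ℝ)..t, κ s)
          + ((1 / 2) * trip κ (-1) - (1 / 2) * trip κ 1))
        (fun x => ∫ s in (0 : ℝ)..x, κ s) := by
  -- The exponents along the three integrations are `-2 - 2ε`, `-1 - 2ε`, `-2ε`, `1 - 2ε`. The first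
  -- two are below `-1`, so one integrates from `0`; the third is above `-1` since `ε < 1/2`, so the
  -- last integral converges at `±1`.
  obtain ⟨K1, hK1, h1⟩ := abs_integral_from_zero_le (s := -(2 + 2 * ε)) (r := -(2 + 2 * ε))
    (by linarith) (by linarith)
  obtain ⟨K2, hK2, h2⟩ := abs_integral_from_zero_le (s := -(2 + 2 * ε) + 1)
    (r := -(2 + 2 * ε) + 1) (by linarith) (by linarith)
  obtain ⟨K3, hK3, h3⟩ := integrable_of_le (s := -(2 + 2 * ε) + 1 + 1)
    (r := -(2 + 2 * ε) + 1 + 1) (by linarith) (by linarith)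
  have es : -(2 + 2 * ε) + 1 + 1 + 1 = 1 - 2 * ε := by ring
  rw [es] at h3
  set A := K1 * K2 * K3 with hA
  have hA0 : 0 ≤ A := by positivity
  set D2 := K1 * K2 * 2 ^ |-(2 + 2 * ε) + 1 + 1| with hD2
  set D1 := K1 * 2 ^ |-(2 + 2 * ε) + 1| with hD1
  have hD20 : 0 ≤ D2 := by positivity
  have hD10 : 0 ≤ D1 := by positivity
  refine ⟨3 * A + D2 + D1, by positivity, fun C κ hC hκ hb => ?_⟩
  set k1 : ℝ → ℝ := fun t => ∫ s in (0 : ℝ)..t, κ s with hk1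
  set k2 : ℝ → ℝ := fun l => ∫ t in (0 : ℝ)..l, k1 t with hk2
  have c1 : ContinuousOn k1 I1 := continuousOn_primitive hκ
  have c2 : ContinuousOn k2 I1 := continuousOn_primitive c1
  have b1 := h1 κ C hC hκ fun x hx => by rw [← wt_eq_ww _ hx]; exact hb x hx
  have b2 := h2 k1 (C * K1) (by positivity) c1 b1
  obtain ⟨i1, i2, b3, b4⟩ := h3 k2 (C * K1 * K2) (by positivity) c2 b2
  have et : ∀ x, trip κ x = ∫ l in (0 : ℝ)..x, k2 l := fun x => rfl
  have w0 : ww (1 - 2 * ε) (1 - 2 * ε) 0 = 1 := by simp [ww]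
  have hm1 : |trip κ (-1)| ≤ A * C := by
    have := b3 0 zero_mem_I1 le_rfl
    rw [w0, mul_one] at this
    rw [et, intervalIntegral.integral_symm, abs_neg]
    exact this.trans_eq (by rw [hA]; ring)
  have hp1 : |trip κ 1| ≤ A * C := by
    have := b4 0 zero_mem_I1 le_rfl
    rw [w0, mul_one] at this
    rw [et]
    exact this.trans_eq (by rw [hA]; ring)
  refine ⟨i1, i2, ?_, ?_, ?_, ?_, ?_, ?_, ?_⟩
  · refine ContinuousOn.sub (ContinuousOn.sub ?_ (by fun_prop)) (by fun_prop)
    exact continuousOn_primitive c2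
  · intro x hx
    have hx' := Ih_subset_I1 hx
    refine (((hasDerivAt_primitive c2 hx').sub (((hasDerivAt_id' x).const_sub 1).const_mul _)).sub
      (((hasDerivAt_id' x).const_add 1).const_mul _)).congr_deriv ?_
    ring
  · intro x hx
    exact (hasDerivAt_primitive c1 (Ih_subset_I1 hx)).add_const _
  · exact c1.mono Ih_subset_I1
  · intro x hx
    have hw := wt_pos (1 - 2 * ε) x hx
    have hp := one_sub_sq_pos hx
    have hle : 1 - x ^ 2 ≤ wt (1 - 2 * ε) x := by
      rw [← wt_one]; exact wt_anti (by linarith) hx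
    have hd : |trip κ 1 - trip κ (-1)| ≤ 2 * (A * C) := (abs_sub _ _).trans (by linarith)
    have hdm := abs_le.1 hd
    have hX : 0 ≤ A * C := by positivity
    rcases le_total x 0 with hx0 | hx0
    · have e : tripT κ x = (∫ l in (-1 : ℝ)..x, k2 l)
          - (1 / 2) * (1 + x) * (trip κ 1 - trip κ (-1)) := by
        have := intervalIntegral.integral_add_adjacent_intervals i1
          (intervalIntegrable_I1 c2 zero_mem_I1 hx)
        rw [← this, ← et, intervalIntegral.integral_symm, ← et]
        simp only [tripT]
        ring
      have q1 := b3 x hx hx0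
      rw [← wt_eq_ww _ hx] at q1
      have q2 : |(1 / 2) * (1 + x) * (trip κ 1 - trip κ (-1))| ≤ A * C * wt (1 - 2 * ε) x := by
        have p1 := one_add_pos hx
        rw [abs_mul, abs_of_pos (by positivity)]
        have : 1 + x ≤ 1 - x ^ 2 := by nlinarith [hx.1]
        calc (1 / 2) * (1 + x) * |trip κ 1 - trip κ (-1)| ≤ (1 / 2) * (1 + x) * (2 * (A * C)) :=
              mul_le_mul_of_nonneg_left hd (by positivity)
          _ = A * C * (1 + x) := by ring
          _ ≤ _ := mul_le_mul_of_nonneg_left (this.trans hle) hX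
      rw [e]
      refine (abs_sub _ _).trans ((add_le_add q1 q2).trans ?_)
      rw [show C * K1 * K2 * K3 = A * C by rw [hA]; ring]
      have : 0 ≤ (A * C + D2 * C + D1 * C) * wt (1 - 2 * ε) x := by positivity
      linarith
    · have e : tripT κ x = -(∫ l in x..1, k2 l)
          + (1 / 2) * (1 - x) * (trip κ 1 - trip κ (-1)) := by
        have i0 := intervalIntegrable_I1 c2 zero_mem_I1 hx
        have := intervalIntegral.integral_add_adjacent_intervals i0 (i0.symm.trans i2)
        rw [← et, ← et] at this
        simp only [tripT]
        linear_combination this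
      have q1 := b4 x hx hx0
      rw [← wt_eq_ww _ hx] at q1
      have q2 : |(1 / 2) * (1 - x) * (trip κ 1 - trip κ (-1))| ≤ A * C * wt (1 - 2 * ε) x := by
        have p1 := one_sub_pos hx
        rw [abs_mul, abs_of_pos (by positivity)]
        have : 1 - x ≤ 1 - x ^ 2 := by nlinarith [hx.2]
        calc (1 / 2) * (1 - x) * |trip κ 1 - trip κ (-1)| ≤ (1 / 2) * (1 - x) * (2 * (A * C)) :=
              mul_le_mul_of_nonneg_left hd (by positivity)
          _ = A * C * (1 - x) := by ring
          _ ≤ _ := mul_le_mul_of_nonneg_left (this.trans hle) hX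
      rw [e]
      refine (abs_add_le _ _).trans ?_
      rw [abs_neg]
      refine (add_le_add q1 q2).trans ?_
      rw [show C * K1 * K2 * K3 = A * C by rw [hA]; ring]
      have : 0 ≤ (A * C + D2 * C + D1 * C) * wt (1 - 2 * ε) x := by positivity
      linarith
  · intro x hx
    have hx' := Ih_subset_I1 hx
    have q1 : |k2 x| ≤ D2 * C := by
      refine (b2 x hx').trans ?_
      rw [← wt_eq_ww _ hx']
      refine (mul_le_mul_of_nonneg_left (wt_mid _ hx) (by positivity)).trans_eq ?_
      rw [hD2]; ring
    have q2 := abs_sub ((1 / 2) * trip κ (-1)) ((1 / 2) * trip κ 1)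
    rw [abs_mul, abs_mul, abs_of_pos (by norm_num : (0 : ℝ) < 1 / 2)] at q2
    refine (abs_add_le _ _).trans ?_
    have : 0 ≤ (2 * A + D1) * C := by positivity
    linarith
  · intro x hx
    have hx' := Ih_subset_I1 hx
    refine (b1 x hx').trans ?_
    rw [← wt_eq_ww _ hx']
    refine (mul_le_mul_of_nonneg_left (wt_mid _ hx) (by positivity)).trans ?_
    have : 0 ≤ (3 * A + D2) * C := by positivity
    rw [show C * K1 * 2 ^ |-(2 + 2 * ε) + 1| = D1 * C by rw [hD1]; ring]
    linarith

/-- The integrand of `ψ`, polarized. -/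
def psiInt {ε : ℝ} (G H : M2 ε) (s : ℝ) : ℝ := 2 * G.fn s * deriv H.fn s / (1 - s ^ 2)

lemma psi_eq_trip {ε : ℝ} (G : M2 ε) : psi G.fn = trip (psiInt G G) := rfl

lemma continuousOn_psiInt {ε : ℝ} (G H : M2 ε) : ContinuousOn (psiInt G H) I1 :=
  ((continuousOn_const.mul G.continuousOn).mul H.continuousOn_deriv).div (by fun_prop)
    fun _ hx => (one_sub_sq_pos hx).ne'

lemma abs_psiInt_le {ε : ℝ} (G H : M2 ε) {x : ℝ} (hx : x ∈ I1) :
    |psiInt G H x| ≤ 2 * ‖G‖ * ‖H‖ * wt (-(2 + 2 * ε)) x := by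
  have h1 := (abs_le_mul_wt_neg hx).1 (G.bound0 hx)
  have h2 := (abs_le_mul_wt_neg hx).1 (H.bound1 hx)
  have hp := one_sub_sq_pos hx
  have e : wt (-(2 + 2 * ε)) x * (1 - x ^ 2) = wt (-ε) x * wt (-(1 + ε)) x := by
    rw [← wt_one, ← wt_add _ _ hx, ← wt_add _ _ hx]; congr 1; ring
  rw [psiInt, abs_div, abs_of_pos hp, div_le_iff₀ hp, mul_assoc (2 * ‖G‖ * ‖H‖), e, abs_mul,
    abs_mul, abs_two]
  calc 2 * |G.fn x| * |deriv H.fn x| ≤ 2 * (‖G‖ * wt (-ε) x) * (‖H‖ * wt (-(1 + ε)) x) :=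
        mul_le_mul (mul_le_mul_of_nonneg_left h1 zero_le_two) h2 (abs_nonneg _)
          ((by positivity : 0 ≤ 2 * |G.fn x|).trans (mul_le_mul_of_nonneg_left h1 zero_le_two))
    _ = _ := by ring

/-- Splitting the outer integral at `x = ±1` needs integrability up to the end points, which comes
from the growth bound on `psiInt`; the inner integrals run over compact subintervals, where
continuity is enough. -/
lemma trip_add {ε : ℝ} (hε0 : 0 < ε) (hε : ε < 1 / 2) (G H G' H' : M2 ε) {x : ℝ}
    (hx : x ∈ Icc (-1 : ℝ) 1) :
    trip (fun s => psiInt G H s + psiInt G' H' s) x = trip (psiInt G H) x + trip (psiInt G' H') x := by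
  obtain ⟨K, -, h⟩ := exists_thetaData_tripT hε0 hε
  have c := continuousOn_psiInt G H
  have c' := continuousOn_psiInt G' H'
  obtain ⟨i1, i2, -⟩ := h _ _ (by positivity) c fun x hx => abs_psiInt_le G H hx
  obtain ⟨j1, j2, -⟩ := h _ _ (by positivity) c' fun x hx => abs_psiInt_le G' H' hx
  have ii : ∀ {u : ℝ → ℝ}, IntervalIntegrable u volume (-1) 0 → IntervalIntegrable u volume 0 1 →
      IntervalIntegrable u volume 0 x := fun {u} h1 h2 =>
    (h1.trans h2).mono_set (by
      rw [uIcc_of_le (by norm_num : (-1 : ℝ) ≤ 1)]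
      exact uIcc_subset_Icc (by norm_num) hx)
  simp only [trip]
  rw [← intervalIntegral.integral_add (ii i1 i2) (ii j1 j2)]
  refine intervalIntegral.integral_congr_uIoo fun l hl => ?_
  have hl' := mem_I1_of_uIoo hx hl
  rw [← intervalIntegral.integral_add
    (intervalIntegrable_I1 (continuousOn_primitive c) zero_mem_I1 hl')
    (intervalIntegrable_I1 (continuousOn_primitive c') zero_mem_I1 hl')]
  refine intervalIntegral.integral_congr_uIoo fun t ht => ?_
  have ht' := mem_I1_of_uIoo (I1_subset_Icc hl') ht
  rw [← intervalIntegral.integral_add (intervalIntegrable_I1 c zero_mem_I1 ht')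
    (intervalIntegrable_I1 c' zero_mem_I1 ht')]

lemma tripT_add {ε : ℝ} (hε0 : 0 < ε) (hε : ε < 1 / 2) (G H G' H' : M2 ε) {x : ℝ}
    (hx : x ∈ I1) :
    tripT (fun s => psiInt G H s + psiInt G' H' s) x
      = tripT (psiInt G H) x + tripT (psiInt G' H') x := by
  simp only [tripT]
  rw [trip_add hε0 hε _ _ _ _ (I1_subset_Icc hx), trip_add hε0 hε _ _ _ _ (by norm_num),
    trip_add hε0 hε _ _ _ _ (by norm_num)]
  ring

/-! ### The bilinear maps -/

section Solutions

variable {ε : ℝ} {q : ℝ × ℝ}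

lemma M1.deriv_add (f g : M1 ε) {x : ℝ} (hx : x ∈ I1) :
    deriv (f + g).fn x = deriv f.fn x + deriv g.fn x :=
  ((f.hasDerivAt hx).add (g.hasDerivAt hx)).deriv

lemma M1.deriv_smul (t : ℝ) (f : M1 ε) (x : ℝ) : deriv (t • f).fn x = t * deriv f.fn x :=
  deriv_const_smul_field t f.fn

lemma M2.deriv_add (f g : M2 ε) {x : ℝ} (hx : x ∈ I1) :
    deriv (f + g).fn x = deriv f.fn x + deriv g.fn x :=
  ((f.hasDerivAt hx).add (g.hasDerivAt hx)).deriv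

lemma M2.deriv_smul (t : ℝ) (f : M2 ε) (x : ℝ) : deriv (t • f).fn x = t * deriv f.fn x :=
  deriv_const_smul_field t f.fn

lemma M2.iteratedDeriv_two_add (f g : M2 ε) {x : ℝ} (hx : x ∈ I1) :
    iteratedDeriv 2 (f + g).fn x = iteratedDeriv 2 f.fn x + iteratedDeriv 2 g.fn x :=
  iteratedDeriv_add (f.mem.cd le_rfl x hx) (g.mem.cd le_rfl x hx)

lemma M2.iteratedDeriv_two_smul (t : ℝ) (f : M2 ε) (x : ℝ) :
    iteratedDeriv 2 (t • f).fn x = t * iteratedDeriv 2 f.fn x := by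
  rw [M2.fn_smul, iteratedDeriv_const_smul_field, smul_eq_mul]

lemma ThetaSol.congr {f : M1 ε} {h h' : ℝ → ℝ} (H : ThetaSol q f h) (e : EqOn h h' I1) :
    ThetaSol q f h' := by
  obtain ⟨l, hl⟩ := H
  exact ⟨l, fun x hx => by rw [hl x hx, e hx]⟩

lemma ThetaSol.add {f f' : M1 ε} {h h' : ℝ → ℝ} (H : ThetaSol q f h) (H' : ThetaSol q f' h') :
    ThetaSol q (f + f') (fun x => h x + h' x) := by
  obtain ⟨l, hl⟩ := H
  obtain ⟨l', hl'⟩ := H'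
  refine ⟨l + l', fun x hx => ?_⟩
  rw [M1.deriv_add _ _ hx, M1.fn_add, Pi.add_apply]
  linear_combination hl x hx + hl' x hx

lemma ThetaSol.smul (t : ℝ) {f : M1 ε} {h : ℝ → ℝ} (H : ThetaSol q f h) :
    ThetaSol q (t • f) (fun x => t * h x) := by
  obtain ⟨l, hl⟩ := H
  refine ⟨t * l, fun x hx => ?_⟩
  rw [M1.deriv_smul, M1.fn_smul, Pi.smul_apply, smul_eq_mul]
  linear_combination t * hl x hx

lemma ThetaSol.unique (hq : GoodExp ε q) {f f' : M1 ε} {h : ℝ → ℝ} (H : ThetaSol q f h)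
    (H' : ThetaSol q f' h) : f = f' := by
  have := (H.add (H'.smul (-1))).congr (h' := 0) fun x _ => by simp
  have e := ThetaSol.eq_zero hq this
  rwa [neg_one_smul, ← sub_eq_add_neg, sub_eq_zero] at e

lemma PhiSol.congr {G : M2 ε} {r r' : ℝ → ℝ} (H : PhiSol q G r) (e : EqOn r r' I1) :
    PhiSol q G r' := fun x hx => by rw [H x hx, e hx]

lemma PhiSol.add {G G' : M2 ε} {r r' : ℝ → ℝ} (H : PhiSol q G r) (H' : PhiSol q G' r') :
    PhiSol q (G + G') (fun x => r x + r' x) := fun x hx => by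
  rw [M2.iteratedDeriv_two_add _ _ hx, M2.deriv_add _ _ hx]
  linear_combination H x hx + H' x hx

lemma PhiSol.smul (t : ℝ) {G : M2 ε} {r : ℝ → ℝ} (H : PhiSol q G r) :
    PhiSol q (t • G) (fun x => t * r x) := fun x hx => by
  rw [M2.iteratedDeriv_two_smul, M2.deriv_smul]
  linear_combination t * H x hx

lemma PhiSol.unique {G G' : M2 ε} {r : ℝ → ℝ} (H : PhiSol q G r) (H' : PhiSol q G' r)
    (h0 : G.fn 0 = G'.fn 0) (h1 : deriv G.fn 0 = deriv G'.fn 0) : G = G' := by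
  have := (H.add (H'.smul (-1))).congr (r' := 0) fun x _ => by simp
  have e := PhiSol.eq_zero this (by
    rw [M2.fn_add, M2.fn_smul, Pi.add_apply, Pi.smul_apply, h0]; simp)
    (by rw [M2.deriv_add _ _ zero_mem_I1, M2.deriv_smul, h1]; ring)
  rwa [neg_one_smul, ← sub_eq_add_neg, sub_eq_zero] at e

end Solutions

section Bilinear

variable {ε : ℝ} {q : ℝ × ℝ}

lemma M1.abs_fn_le_wt (f : M1 ε) {x : ℝ} (hx : x ∈ I1) : |f.fn x| ≤ ‖f‖ * wt (1 - 2 * ε) x := by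
  have := (abs_le_mul_wt_neg hx).1 (f.bound0 hx)
  rwa [show -(-1 + 2 * ε) = 1 - 2 * ε by ring] at this

lemma M1.abs_fn_le (hε : ε < 1 / 2) (f : M1 ε) {x : ℝ} (hx : x ∈ I1) : |f.fn x| ≤ ‖f‖ := by
  refine (f.abs_fn_le_wt hx).trans (mul_le_of_le_one_right (norm_nonneg _) ?_)
  have := wt_anti (r := 1 - 2 * ε) (s := 0) (by linarith) hx
  simpa [wt] using this

/-- The bilinear map inverting the linear operator for `U_θ` on products. -/
lemma exists_thetaMul (hq : GoodExp ε q) :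
    ∃ T : ((ℝ × ℝ) × M1 ε) →L[ℝ] M1 ε →L[ℝ] M1 ε, ∀ v f g,
      ThetaSol q g (fun x => (aff v.1 x + (1 / 2) * v.2.fn x) * f.fn x) ↔ g = T v f := by
  obtain ⟨K, hK, hex⟩ := exists_thetaSol hq
  have hε := hq.lt_half
  -- `D` bounds the inverse weight of first derivatives on the middle interval. In the constant `20
  -- D²`, the `5` comes from `|aff| ≤ 4‖v‖` plus the function term, and the `4` from the four
  -- products in the second derivative of `(aff + f/2) f`.
  set D : ℝ := 2 ^ |2 * ε| with hD
  have hD1 : 1 ≤ D := Real.one_le_rpow (by norm_num) (abs_nonneg _)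
  refine exists_bilinear_of_relation _ (K * (20 * D ^ 2)) (fun v f => ?_)
    (fun h h' => h.unique hq h') (fun h h' => (h.add h').congr fun x _ => ?_)
    (fun t _ _ _ h => (h.smul t).congr fun x _ => ?_)
    (fun h h' => (h.add h').congr fun x _ => ?_)
    (fun t _ _ _ h => (h.smul t).congr fun x _ => ?_)
  · have hv1 : ‖v.1‖ ≤ ‖v‖ := norm_fst_le v
    have hv2 : ‖v.2‖ ≤ ‖v‖ := norm_snd_le v
    have hN := norm_nonneg v
    have hF := norm_nonneg f
    have hlow : ∀ g : M1 ε, ∀ x ∈ Ih, |g.fn x| ≤ D * ‖g‖ := fun g x hx =>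
      (g.abs_fn_le hε (Ih_subset_I1 hx)).trans (le_mul_of_one_le_left (norm_nonneg _) hD1)
    have hlow1 : ∀ g : M1 ε, ∀ x ∈ Ih, |deriv g.fn x| ≤ D * ‖g‖ := fun g x hx => by
      refine ((abs_le_mul_wt_neg (Ih_subset_I1 hx)).1 (g.bound1 (Ih_subset_I1 hx))).trans ?_
      have := mul_le_mul_of_nonneg_left (wt_mid (-(2 * ε)) hx) (norm_nonneg g)
      rw [abs_neg] at this
      linarith
    have hlow2 : ∀ g : M1 ε, ∀ x ∈ Ih, |iteratedDeriv 2 g.fn x| ≤ D * ‖g‖ := fun g x hx =>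
      (g.bound2 hx).trans (le_mul_of_one_le_left (norm_nonneg _) hD1)
    have hDv : D * ‖v.2‖ ≤ D * ‖v‖ := mul_le_mul_of_nonneg_left hv2 (by positivity)
    have hvD : ‖v‖ ≤ D * ‖v‖ := le_mul_of_one_le_left hN hD1
    have a0 : ∀ x ∈ I1, |aff v.1 x + (1 / 2) * v.2.fn x| ≤ 5 * ‖v‖ := fun x hx => by
      have h1 := abs_aff_le v.1 hx
      have h2 := v.2.abs_fn_le hε hx
      refine (abs_add_le _ _).trans ?_
      rw [abs_mul, abs_of_pos (by norm_num : (0 : ℝ) < 1 / 2)]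
      linarith
    have a0' : ∀ x ∈ Ih, |aff v.1 x + (1 / 2) * v.2.fn x| ≤ 5 * D * ‖v‖ := fun x hx =>
      (a0 x (Ih_subset_I1 hx)).trans (by linarith)
    have a1 : ∀ x ∈ Ih, |-(v.1.1 + v.1.2) + (1 / 2) * deriv v.2.fn x| ≤ 5 * D * ‖v‖ :=
      fun x hx => by
        have g1 : |v.1.1| ≤ ‖v.1‖ := norm_fst_le v.1
        have g2 : |v.1.2| ≤ ‖v.1‖ := norm_snd_le v.1
        have h2 := hlow1 v.2 x hx
        refine (abs_add_le _ _).trans ?_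
        rw [abs_neg, abs_mul, abs_of_pos (by norm_num : (0 : ℝ) < 1 / 2)]
        linarith [abs_add_le v.1.1 v.1.2]
    have a2 : ∀ x ∈ Ih, |(1 / 2) * iteratedDeriv 2 v.2.fn x| ≤ 5 * D * ‖v‖ := fun x hx => by
      have h2 := hlow2 v.2 x hx
      rw [abs_mul, abs_of_pos (by norm_num : (0 : ℝ) < 1 / 2)]
      linarith
    have prod : ∀ {y z : ℝ}, |y| ≤ 5 * D * ‖v‖ → |z| ≤ D * ‖f‖ → |y * z| ≤ 5 * D ^ 2 * ‖v‖ * ‖f‖ :=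
      fun {y z} hy hz => by
        rw [abs_mul]
        exact (mul_le_mul hy hz (abs_nonneg _) (by positivity)).trans_eq (by ring)
    have hpos : 0 ≤ 5 * D ^ 2 * ‖v‖ * ‖f‖ := by positivity
    have hac := continuous_aff v.1
    have dv : ∀ x ∈ I1, HasDerivAt (fun x => aff v.1 x + (1 / 2) * v.2.fn x)
        (-(v.1.1 + v.1.2) + (1 / 2) * deriv v.2.fn x) x := fun x hx =>
      (hasDerivAt_aff v.1 x).add ((v.2.hasDerivAt hx).const_mul _)
    have dv' : ∀ x ∈ Ih, HasDerivAt (fun x => -(v.1.1 + v.1.2) + (1 / 2) * deriv v.2.fn x)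
        ((1 / 2) * iteratedDeriv 2 v.2.fn x) x := fun x hx =>
      ((v.2.hasDerivAt_deriv hx).const_mul _).const_add _
    obtain ⟨g, hg, hgn⟩ := hex (20 * D ^ 2 * ‖v‖ * ‖f‖)
      (fun x => (aff v.1 x + (1 / 2) * v.2.fn x) * f.fn x)
      (fun x => (-(v.1.1 + v.1.2) + (1 / 2) * deriv v.2.fn x) * f.fn x
        + (aff v.1 x + (1 / 2) * v.2.fn x) * deriv f.fn x)
      (fun x => ((1 / 2) * iteratedDeriv 2 v.2.fn x * f.fn x
        + (-(v.1.1 + v.1.2) + (1 / 2) * deriv v.2.fn x) * deriv f.fn x)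
        + ((-(v.1.1 + v.1.2) + (1 / 2) * deriv v.2.fn x) * deriv f.fn x
        + (aff v.1 x + (1 / 2) * v.2.fn x) * iteratedDeriv 2 f.fn x))
      { cont := (hac.continuousOn.add (continuousOn_const.mul v.2.continuousOn)).mul f.continuousOn
        deriv1 := fun x hx => (dv x (Ih_subset_I1 hx)).mul (f.hasDerivAt (Ih_subset_I1 hx))
        deriv2 := fun x hx => ((dv' x hx).mul (f.hasDerivAt (Ih_subset_I1 hx))).add
          ((dv x (Ih_subset_I1 hx)).mul (f.hasDerivAt_deriv hx))
        cont2 := by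
          have c0 := f.continuousOn.mono Ih_subset_I1
          have c1 := f.continuousOn_deriv.mono Ih_subset_I1
          have c2 : ContinuousOn (iteratedDeriv 2 f.fn) Ih := fun x hx =>
            (f.hasDerivAt_iteratedDeriv_two hx).continuousAt.continuousWithinAt
          have d0 := v.2.continuousOn.mono Ih_subset_I1
          have d1 := v.2.continuousOn_deriv.mono Ih_subset_I1
          have d2 : ContinuousOn (iteratedDeriv 2 v.2.fn) Ih := fun x hx =>
            (v.2.hasDerivAt_iteratedDeriv_two hx).continuousAt.continuousWithinAt
          fun_prop
        bdd0 := fun x hx => by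
          rw [abs_mul]
          have hw := wt_pos (1 - 2 * ε) x hx
          refine (mul_le_mul (a0 x hx) (f.abs_fn_le_wt hx) (abs_nonneg _) (by positivity)).trans ?_
          have hD2 : 1 ≤ D ^ 2 := one_le_pow₀ hD1
          have : 5 * ‖v‖ * (‖f‖ * wt (1 - 2 * ε) x)
              ≤ D ^ 2 * (5 * ‖v‖ * (‖f‖ * wt (1 - 2 * ε) x)) :=
            le_mul_of_one_le_left (by positivity) hD2
          have : 0 ≤ D ^ 2 * (15 * ‖v‖ * (‖f‖ * wt (1 - 2 * ε) x)) := by positivity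
          linarith
        bdd1 := fun x hx => by
          refine (abs_add_le _ _).trans ?_
          linarith [prod (a1 x hx) (hlow f x hx), prod (a0' x hx) (hlow1 f x hx)]
        bdd2 := fun x hx => by
          refine (abs_add_le _ _).trans ((add_le_add (abs_add_le _ _) (abs_add_le _ _)).trans ?_)
          linarith [prod (a2 x hx) (hlow f x hx), prod (a1 x hx) (hlow1 f x hx),
            prod (a0' x hx) (hlow2 f x hx)] }
    exact ⟨g, hg, hgn.trans_eq (by ring)⟩
  · simp only [Prod.fst_add, Prod.snd_add, aff_add, M1.fn_add, Pi.add_apply]; ring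
  · simp only [Prod.smul_fst, Prod.smul_snd, aff_smul, M1.fn_smul, Pi.smul_apply, smul_eq_mul]; ring
  · simp only [M1.fn_add, Pi.add_apply]; ring
  · simp only [M1.fn_smul, Pi.smul_apply, smul_eq_mul]; ring

/-- The bilinear map inverting the linear operator for `U_θ` on the polarization of `ψ`. -/
lemma exists_thetaPsi (hq : GoodExp ε q) :
    ∃ T : M2 ε →L[ℝ] M2 ε →L[ℝ] M1 ε, ∀ G H g,
      ThetaSol q g (tripT (psiInt G H)) ↔ g = T G H := by
  obtain ⟨K, hK, hex⟩ := exists_thetaSol hq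
  obtain ⟨L, hL, hψ⟩ := exists_thetaData_tripT hq.pos hq.lt_half
  refine exists_bilinear_of_relation _ (K * (L * 2)) (fun G H => ?_)
    (fun h h' => h.unique hq h') (fun h h' => (h.add h').congr fun x hx => ?_)
    (fun t _ _ _ h => (h.smul t).congr fun x hx => ?_)
    (fun h h' => (h.add h').congr fun x hx => ?_)
    (fun t _ _ _ h => (h.smul t).congr fun x hx => ?_)
  · obtain ⟨-, -, hd⟩ := hψ (2 * ‖G‖ * ‖H‖) (psiInt G H) (by positivity) (continuousOn_psiInt G H)
      fun x hx => abs_psiInt_le G H hx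
    obtain ⟨g, hg, hn⟩ := hex _ _ _ _ hd
    exact ⟨g, hg, hn.trans_eq (by ring)⟩
  · refine (tripT_add hq.pos hq.lt_half _ _ _ _ hx).symm.trans ?_
    refine tripT_congr (fun s _ => ?_) (I1_subset_Icc hx)
    simp only [psiInt, M2.fn_add, Pi.add_apply]; ring
  · simp only [← tripT_smul]
    refine tripT_congr (fun s _ => ?_) (I1_subset_Icc hx)
    simp only [psiInt, M2.fn_smul, Pi.smul_apply, smul_eq_mul]; ring
  · refine (tripT_add hq.pos hq.lt_half _ _ _ _ hx).symm.trans ?_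
    refine tripT_congr (fun s hs => ?_) (I1_subset_Icc hx)
    simp only [psiInt, M2.deriv_add _ _ hs]; ring
  · simp only [← tripT_smul]
    refine tripT_congr (fun s _ => ?_) (I1_subset_Icc hx)
    simp only [psiInt, M2.deriv_smul]; ring

/-- The bilinear map inverting the linear operator for `U_φ` on products. -/
lemma exists_phiMul (hq : GoodExp ε q) :
    ∃ T : ((ℝ × ℝ) × M1 ε) →L[ℝ] M2 ε →L[ℝ] M2 ε, ∀ v G H,
      (PhiSol q H (fun x => (aff v.1 x + v.2.fn x) * deriv G.fn x) ∧ H.fn 0 = 0 ∧ deriv H.fn 0 = 0)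
        ↔ H = T v G := by
  -- The zero Cauchy data at `0` remove the two-dimensional kernel and make the relation
  -- single-valued.
  obtain ⟨K, hK, hex⟩ := exists_phiSol hq
  refine exists_bilinear_of_relation _ (K * 5) (fun v G => ?_)
    (fun h h' => h.1.unique h'.1 (h.2.1.trans h'.2.1.symm) (h.2.2.trans h'.2.2.symm))
    (fun h h' => ⟨(h.1.add h'.1).congr fun x _ => ?_, ?_, ?_⟩)
    (fun t _ _ _ h => ⟨(h.1.smul t).congr fun x _ => ?_, ?_, ?_⟩)
    (fun h h' => ⟨(h.1.add h'.1).congr fun x hx => ?_, ?_, ?_⟩)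
    (fun t _ _ _ h => ⟨(h.1.smul t).congr fun x _ => ?_, ?_, ?_⟩)
  · have hv1 : ‖v.1‖ ≤ ‖v‖ := norm_fst_le v
    have hv2 : ‖v.2‖ ≤ ‖v‖ := norm_snd_le v
    have a0 : ∀ x ∈ I1, |aff v.1 x + v.2.fn x| ≤ 5 * ‖v‖ := fun x hx => by
      have h1 := abs_aff_le v.1 hx
      have h2 := v.2.abs_fn_le hq.lt_half hx
      refine (abs_add_le _ _).trans ?_
      linarith
    obtain ⟨H, h1, h2, h3, h4⟩ := hex (5 * ‖v‖ * ‖G‖)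
      (fun x => (aff v.1 x + v.2.fn x) * deriv G.fn x) (by positivity)
      (((continuous_aff v.1).continuousOn.add v.2.continuousOn).mul G.continuousOn_deriv)
      (fun x hx => by
        rw [abs_mul, mul_assoc]
        exact mul_le_mul (a0 x hx) ((abs_le_mul_wt_neg hx).1 (G.bound1 hx)) (abs_nonneg _)
          (by positivity))
    exact ⟨H, ⟨h1, h2, h3⟩, h4.trans_eq (by ring)⟩
  · simp only [Prod.fst_add, Prod.snd_add, aff_add, M1.fn_add, Pi.add_apply]; ring
  · rw [M2.fn_add, Pi.add_apply, h.2.1, h'.2.1, add_zero]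
  · rw [M2.deriv_add _ _ zero_mem_I1, h.2.2, h'.2.2, add_zero]
  · simp only [Prod.smul_fst, Prod.smul_snd, aff_smul, M1.fn_smul, Pi.smul_apply, smul_eq_mul]; ring
  · rw [M2.fn_smul, Pi.smul_apply, h.2.1, smul_zero]
  · rw [M2.deriv_smul, h.2.2, mul_zero]
  · simp only [M2.deriv_add _ _ hx]; ring
  · rw [M2.fn_add, Pi.add_apply, h.2.1, h'.2.1, add_zero]
  · rw [M2.deriv_add _ _ zero_mem_I1, h.2.2, h'.2.2, add_zero]
  · simp only [M2.deriv_smul]; ring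
  · rw [M2.fn_smul, Pi.smul_apply, h.2.1, smul_zero]
  · rw [M2.deriv_smul, h.2.2, mul_zero]

end Bilinear

/-! ### The nonlinear equations -/

/-- The constant function `1` as an element of `M₂`. -/
lemma exists_one {ε : ℝ} (hε : 0 < ε) : ∃ G : M2 ε, EqOn G.fn 1 I1 ∧
    EqOn (deriv G.fn) 0 I1 ∧ EqOn (iteratedDeriv 2 G.fn) 0 I1 := by
  obtain ⟨G, h0, h1, h2, -⟩ := M2.exists_of (ε := ε) (C0 := 1) (C1 := 0) (C2 := 0)
    (fun x _ => hasDerivAt_const x (1 : ℝ)) (fun x _ => hasDerivAt_const x (0 : ℝ))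
    continuousOn_const (fun x hx => by
      rw [mul_one, abs_of_pos (wt_pos ε x hx)]
      have := wt_anti (r := ε) (s := 0) hε.le hx
      simpa [wt] using this) (by simp) (by simp)
  exact ⟨G, h0, h1, h2⟩

/-- The equations for the deviation `(f, G)` from the no-swirl solution `aff q`, with the values
`β` of `G'` and `G` at `0`. -/
structure IsDeviation {ε : ℝ} (e : (ℝ × ℝ) × Beta) (z : M1 ε × M2 ε) : Prop where
  theta_eq : ∃ l : ℝ, ∀ x ∈ I1, (1 - x ^ 2) * deriv z.1.fn x + (2 * x + aff e.1 x) * z.1.fn x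
    + (1 / 2) * z.1.fn x ^ 2 + tripT (psiInt z.2 z.2) x = l * (1 - x ^ 2)
  phi_eq : ∀ x ∈ I1, (1 - x ^ 2) * iteratedDeriv 2 z.2.fn x + (aff e.1 x + z.1.fn x) * deriv z.2.fn x = 0
  deriv_zero : deriv z.2.fn 0 = e.2 0
  val_zero : z.2.fn 0 = e.2 1

/-- Each term of the product rule retains an undifferentiated factor, which vanishes at `z`. -/
lemma hasFDerivAt_bilinear_of_zero {A B C D : Type*} [NormedAddCommGroup A] [NormedSpace ℝ A]
    [NormedAddCommGroup B] [NormedSpace ℝ B] [NormedAddCommGroup C] [NormedSpace ℝ C]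
    [NormedAddCommGroup D] [NormedSpace ℝ D] (T : A →L[ℝ] B →L[ℝ] C) {u : D → A} {v : D → B} {z : D}
    (hu : DifferentiableAt ℝ u z) (hv : DifferentiableAt ℝ v z) (hu0 : u z = 0) (hv0 : v z = 0) :
    HasFDerivAt (fun y => T (u y) (v y)) (0 : D →L[ℝ] C) z := by
  refine (T.hasFDerivAt_of_bilinear hu.hasFDerivAt hv.hasFDerivAt).congr_fderiv ?_
  ext y
  simp [hu0, hv0]

/-- The linear part `β ↦ (0, β₃ H + β₄ J)` of the solution branch. -/
def linPart {ε : ℝ} (H J : M2 ε) : Beta →L[ℝ] M1 ε × M2 ε :=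
  (0 : Beta →L[ℝ] M1 ε).prod ((EuclideanSpace.proj (0 : Fin 2) : Beta →L[ℝ] ℝ).smulRight H
    + (EuclideanSpace.proj (1 : Fin 2) : Beta →L[ℝ] ℝ).smulRight J)

lemma linPart_apply {ε : ℝ} (H J : M2 ε) (β : Beta) :
    linPart H J β = (0, β 0 • H + β 1 • J) := rfl

/-- The equations for the deviation as a fixed point equation. -/
lemma exists_fixedPointMap {ε : ℝ} {q : ℝ × ℝ} (hq : GoodExp ε q) {H J : M2 ε}
    (hH : PhiSol q H 0) (hH0 : H.fn 0 = 0) (hH1 : deriv H.fn 0 = 1) (hJ : EqOn J.fn 1 I1)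
    (hJ1 : EqOn (deriv J.fn) 0 I1) (hJ2 : EqOn (iteratedDeriv 2 J.fn) 0 I1) :
    ∃ N : ((ℝ × ℝ) × Beta) × (M1 ε × M2 ε) → M1 ε × M2 ε, ContDiff ℝ ω N ∧ N ((q, 0), 0) = 0 ∧
      HasFDerivAt N (linPart H J ∘L .snd ℝ (ℝ × ℝ) Beta ∘L .fst ℝ _ _) ((q, 0), 0) ∧
      ∀ e z, IsDeviation e z ↔ z = N (e, z) := by
  obtain ⟨T1, hT1⟩ := exists_thetaMul hq
  obtain ⟨T2, hT2⟩ := exists_phiMul hq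
  obtain ⟨T3, hT3⟩ := exists_thetaPsi hq
  -- The coefficient is `aff p = aff q + aff (p - q)`: the operator at `q` is inverted, and the
  -- rest, linear in `p - q`, joins the nonlinearity. Thus the nearby exponents `p` need not satisfy
  -- `GoodExp`.
  set A : ((ℝ × ℝ) × Beta) × (M1 ε × M2 ε) → (ℝ × ℝ) × M1 ε := fun y => (y.1.1 - q, y.2.1) with hA
  have hAc : ContDiff ℝ ω A := by fun_prop
  have hfc : ContDiff ℝ ω fun y : ((ℝ × ℝ) × Beta) × (M1 ε × M2 ε) => y.2.1 := by fun_prop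
  have hGc : ContDiff ℝ ω fun y : ((ℝ × ℝ) × Beta) × (M1 ε × M2 ε) => y.2.2 := by fun_prop
  have c1 : ContDiff ℝ ω fun y => T1 (A y) y.2.1 := (T1.contDiff.comp hAc).clm_apply hfc
  have c2 : ContDiff ℝ ω fun y => T2 (A y) y.2.2 := (T2.contDiff.comp hAc).clm_apply hGc
  have c3 : ContDiff ℝ ω fun y : ((ℝ × ℝ) × Beta) × (M1 ε × M2 ε) => T3 y.2.2 y.2.2 :=
    (T3.contDiff.comp hGc).clm_apply hGc
  have hJ0 : J.fn 0 = 1 := hJ zero_mem_I1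
  have hJ10 : deriv J.fn 0 = 0 := hJ1 zero_mem_I1
  -- The bilinear corrections have zero Cauchy data, so the kernel elements `H` and `J` alone carry
  -- the prescribed values `β`.
  refine ⟨fun y => linPart H J y.1.2 + (-(T1 (A y) y.2.1) - T3 y.2.2 y.2.2, -(T2 (A y) y.2.2)),
    ?_, ?_, ?_, fun e z => ?_⟩
  · refine ContDiff.add ((linPart H J).contDiff.comp (contDiff_snd.comp contDiff_fst)) ?_
    exact (c1.neg.sub c3).prodMk c2.neg
  · simp [hA]
  · have hA0 : A ((q, 0), 0) = 0 := by simp [hA]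
    have dA := hAc.differentiable (by simp) ((q, 0), 0)
    have df := hfc.differentiable (by simp) ((q, (0 : Beta)), (0 : M1 ε × M2 ε))
    have dG := hGc.differentiable (by simp) ((q, (0 : Beta)), (0 : M1 ε × M2 ε))
    have d1 := hasFDerivAt_bilinear_of_zero T1 dA df hA0 rfl
    have d2 := hasFDerivAt_bilinear_of_zero T2 dA dG hA0 rfl
    have d3 := hasFDerivAt_bilinear_of_zero T3 dG dG rfl rfl
    refine ((linPart H J ∘L .snd ℝ (ℝ × ℝ) Beta ∘L .fst ℝ _ _).hasFDerivAt.add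
      ((d1.neg.sub d3).prodMk d2.neg)).congr_fderiv ?_
    ext y <;> simp
  · obtain ⟨⟨p, β⟩, ⟨f, G⟩⟩ := e, z
    simp only [linPart_apply, Prod.mk_add_mk, zero_add, Prod.mk.injEq, hA]
    have s1 := (hT1 (p - q, f) f _).2 rfl
    have s3 := (hT3 G G _).2 rfl
    obtain ⟨s2, s20, s21⟩ := (hT2 (p - q, f) G _).2 rfl
    have t1 : ThetaSol q (-(T1 (p - q, f) f) - T3 G G)
        (fun x => -((aff (p - q) x + (1 / 2) * f.fn x) * f.fn x) - tripT (psiInt G G) x) := by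
      have := ((s1.smul (-1)).add (s3.smul (-1)))
      rw [neg_one_smul, neg_one_smul, ← sub_eq_add_neg] at this
      exact this.congr fun x _ => by ring
    have kJ : PhiSol q J 0 := fun x hx => by rw [hJ1 hx, hJ2 hx]; simp
    have t2 : PhiSol q (β 0 • H + β 1 • J + -(T2 (p - q, f) G))
        (fun x => -((aff (p - q) x + f.fn x) * deriv G.fn x)) := by
      have := ((hH.smul (β 0)).add (kJ.smul (β 1))).add (s2.smul (-1))
      rw [neg_one_smul] at this
      exact this.congr fun x _ => by simp
    have t20 : (β 0 • H + β 1 • J + -(T2 (p - q, f) G)).fn 0 = β 1 := by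
      rw [← neg_one_smul ℝ (T2 (p - q, f) G)]
      simp only [M2.fn_add, M2.fn_smul, Pi.add_apply, Pi.smul_apply, smul_eq_mul]
      rw [hH0, hJ0, s20]
      ring
    have t21 : deriv (β 0 • H + β 1 • J + -(T2 (p - q, f) G)).fn 0 = β 0 := by
      rw [← neg_one_smul ℝ (T2 (p - q, f) G)]
      rw [M2.deriv_add _ _ zero_mem_I1, M2.deriv_add _ _ zero_mem_I1, M2.deriv_smul, M2.deriv_smul,
        M2.deriv_smul, hH1, hJ10, s21]
      ring
    constructor
    · rintro ⟨⟨l, hl⟩, hφ, h1, h0⟩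
      simp only at hl hφ h1 h0
      refine ⟨ThetaSol.unique hq ⟨l, fun x hx => ?_⟩ t1, PhiSol.unique (fun x hx => ?_) t2
        (h0.trans t20.symm) (h1.trans t21.symm)⟩
      · rw [aff_sub]
        linear_combination hl x hx
      · rw [aff_sub]
        linear_combination hφ x hx
    · rintro ⟨e1, e2⟩
      rw [← e1] at t1
      rw [← e2] at t2 t20 t21
      obtain ⟨l, hl⟩ := t1
      refine ⟨⟨l, fun x hx => ?_⟩, fun x hx => ?_, t21, t20⟩
      · have := hl x hx
        simp only [aff_sub] at this
        linear_combination this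
      · have := t2 x hx
        simp only [aff_sub] at this
        linear_combination this

/-- The smooth branch of small deviations near a compact set of no-swirl solutions. -/
theorem exists_deviation_branch {ε : ℝ} (hε0 : 0 < ε) (hε : ε < 1 / 2) {Q : Set (ℝ × ℝ)}
    (hQ : IsCompact Q) (hgood : ∀ q ∈ Q, GoodExp ε q) :
    ∃ O : Set ((ℝ × ℝ) × Beta), IsOpen O ∧ Q ×ˢ {0} ⊆ O ∧ ∃ ρ > 0,
      ∃ w : (ℝ × ℝ) × Beta → M1 ε × M2 ε, ContDiffOn ℝ ∞ w O ∧
      (∀ e ∈ O, IsDeviation e (w e) ∧ ∀ z, ‖z‖ < ρ → IsDeviation e z → z = w e) ∧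
      ∀ q ∈ Q, w (q, 0) = 0 ∧ ∀ H J : M2 ε, PhiSol q H 0 → H.fn 0 = 0 → deriv H.fn 0 = 1 →
        EqOn J.fn 1 I1 → EqOn (deriv J.fn) 0 I1 → EqOn (iteratedDeriv 2 J.fn) 0 I1 →
        fderiv ℝ w (q, 0) ∘L .inr ℝ (ℝ × ℝ) Beta = linPart H J := by
  have := M1.completeSpace hε
  obtain ⟨J, hJ, hJ1, hJ2⟩ := exists_one hε0
  obtain ⟨O, hO, hQO, ρ, hρ, w, hw, hsol⟩ := exists_branch_near_compact
    (S := Q ×ˢ ({0} : Set Beta)) (hQ.prod isCompact_singleton)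
    (fun e (z : M1 ε × M2 ε) => IsDeviation e z) (by
      rintro ⟨q, β⟩ ⟨hq, hβ⟩
      obtain rfl : β = 0 := hβ
      obtain ⟨H, -, hH, hH0, hH1⟩ := exists_phi_kernel (hgood q hq)
      obtain ⟨N, hN, h0, hd, hiff⟩ := exists_fixedPointMap (hgood q hq) hH hH0 hH1 hJ hJ1 hJ2
      refine ⟨N, hN, h0, ?_, hiff⟩
      rw [hd.fderiv]
      ext y <;> simp)
  refine ⟨O, hO, hQO, ρ, hρ, w, hw, hsol, fun q hq => ?_⟩
  have hqO : (q, (0 : Beta)) ∈ O := hQO ⟨hq, rfl⟩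
  have hw0 : w (q, 0) = 0 := by
    obtain ⟨H, -, hH, hH0, hH1⟩ := exists_phi_kernel (hgood q hq)
    obtain ⟨N, -, h0, -, hiff⟩ := exists_fixedPointMap (hgood q hq) hH hH0 hH1 hJ hJ1 hJ2
    exact ((hsol _ hqO).2 0 (by simpa using hρ) ((hiff _ _).2 h0.symm)).symm
  refine ⟨hw0, fun H J hH hH0 hH1 hJ hJ1 hJ2 => ?_⟩
  obtain ⟨N, hN, h0, hd, hiff⟩ := exists_fixedPointMap (hgood q hq) hH hH0 hH1 hJ hJ1 hJ2
  have hwd : HasFDerivAt w (fderiv ℝ w (q, 0)) (q, 0) :=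
    ((hw.contDiffAt (hO.mem_nhds hqO)).differentiableAt (by simp)).hasFDerivAt
  have hc : HasFDerivAt (fun e => (e, w e)) ((ContinuousLinearMap.id ℝ _).prod (fderiv ℝ w (q, 0)))
      (q, 0) := (hasFDerivAt_id _).prodMk hwd
  rw [← hw0] at hd
  -- Differentiating the identity `w e = N (e, w e)` at the base point: since the derivative of `N`
  -- there involves only `β`, the unknown derivative of `w` drops out of the right-hand side.
  have hcomp := hd.comp (q, (0 : Beta)) hc
  have heq : (N ∘ fun e => (e, w e)) =ᶠ[𝓝 (q, 0)] w := by
    filter_upwards [hO.mem_nhds hqO] with e he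
    exact ((hiff e (w e)).1 (hsol e he).1).symm
  have := (hcomp.congr_of_eventuallyEq heq.symm).unique hwd
  rw [← this]
  ext y <;> simp

/-! ### The no-swirl solutions with `c₃ = c̄₃(c₁, c₂)` -/

lemma hasDerivAt_tanh (s : ℝ) : HasDerivAt Real.tanh (1 - Real.tanh s ^ 2) s := by
  have hc := (Real.cosh_pos s).ne'
  have h := (Real.hasDerivAt_sinh s).div (Real.hasDerivAt_cosh s) hc
  have e : Real.sinh / Real.cosh = Real.tanh := funext fun x => by
    rw [Pi.div_apply, Real.tanh_eq_sinh_div_cosh]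
  rw [e] at h
  refine h.congr_deriv ?_
  rw [Real.tanh_eq_sinh_div_cosh]
  field_simp

lemma tanh_mem_I1 (s : ℝ) : Real.tanh s ∈ I1 := ⟨Real.neg_one_lt_tanh s, Real.tanh_lt_one s⟩

/-- Global solutions of `Y' = -Y² F / 2` with `F` bounded below are nowhere positive. -/
lemma nonpos_of_riccati {Y F : ℝ → ℝ} {κ : ℝ} (hκ : 0 < κ) (hF : ∀ s, κ ≤ F s)
    (hY : ∀ s, HasDerivAt Y (-(1 / 2) * Y s ^ 2 * F s) s) (s₀ : ℝ) : Y s₀ ≤ 0 := by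
  by_contra! hpos
  -- If `Y` is positive at `s₀` it is positive at all earlier times, and `1 / Y` has derivative `F /
  -- 2 ≥ κ / 2`. Going backwards, `1 / Y` would have to reach `0` no later than at the point `s₁`
  -- below.
  have hanti : Antitone Y := antitone_of_hasDerivAt_nonpos hY fun s => by
    change _ ≤ (0 : ℝ)
    have : 0 ≤ Y s ^ 2 * F s := mul_nonneg (sq_nonneg _) (hκ.le.trans (hF s))
    linarith
  have hp : ∀ s ≤ s₀, 0 < Y s := fun s hs => hpos.trans_le (hanti hs)
  have hd : ∀ s ≤ s₀, HasDerivAt (fun s => (Y s)⁻¹ - κ / 2 * s) (F s / 2 - κ / 2) s := fun s hs => by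
    have hn := (hp s hs).ne'
    refine (((hY s).inv hn).sub ((hasDerivAt_id' s).const_mul (κ / 2))).congr_deriv ?_
    field_simp
  have hmono : MonotoneOn (fun s => (Y s)⁻¹ - κ / 2 * s) (Iic s₀) := by
    refine monotoneOn_of_deriv_nonneg (convex_Iic _)
      (fun s hs => (hd s hs).continuousAt.continuousWithinAt) ?_ ?_
    · rw [interior_Iic]
      exact fun s hs => (hd s (le_of_lt hs)).differentiableAt.differentiableWithinAt
    · rw [interior_Iic]
      exact fun s hs => by rw [(hd s (le_of_lt hs)).deriv]; linarith [hF s]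
  have hz : 0 < (Y s₀)⁻¹ := inv_pos.2 hpos
  set s₁ := s₀ - 2 * (Y s₀)⁻¹ / κ with hs₁
  have hle : s₁ ≤ s₀ := by
    have : 0 ≤ 2 * (Y s₀)⁻¹ / κ := by positivity
    linarith
  have h1 := hmono (show s₁ ∈ Iic s₀ from hle) (mem_Iic.2 le_rfl) hle
  have h2 := inv_pos.2 (hp s₁ hle)
  have h3 : κ / 2 * s₁ = κ / 2 * s₀ - (Y s₀)⁻¹ := by rw [hs₁]; field_simp
  simp only at h1
  linarith

/-- Replacing `Y s` by `-Y (-s)` preserves the form of the equation, so the one-sided bound gives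
the other one. -/
lemma eq_zero_of_riccati {Y F : ℝ → ℝ} {κ : ℝ} (hκ : 0 < κ) (hF : ∀ s, κ ≤ F s)
    (hY : ∀ s, HasDerivAt Y (-(1 / 2) * Y s ^ 2 * F s) s) (s₀ : ℝ) : Y s₀ = 0 := by
  refine le_antisymm (nonpos_of_riccati hκ hF hY s₀) ?_
  have h := nonpos_of_riccati (Y := fun s => -Y (-s)) (F := fun s => F (-s)) hκ (fun s => hF (-s))
    (fun s => by
      refine (((hY (-s)).comp s (hasDerivAt_neg s)).neg).congr_deriv ?_
      ring) (-s₀)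
  simp only [neg_neg] at h
  linarith

/-- `c` is the vector of constants of the no-swirl solution `aff q`. -/
structure ConstRel (c : Fin 3 → ℝ) (q : ℝ × ℝ) : Prop where
  fst : c 0 = (q.1 - 1) ^ 2 - 1
  snd : c 1 = (q.2 - 1) ^ 2 - 1
  thd : c 2 = -(1 / 2) * (q.1 + q.2 - 2) * (q.1 + q.2)
  one_le_fst : 1 ≤ q.1
  one_le_snd : 1 ≤ q.2

lemma contDiff_aff (q : ℝ × ℝ) {n : ℕ∞ω} : ContDiff ℝ n (aff q) := by
  unfold aff; fun_prop

lemma isNoSwirl_aff {c : Fin 3 → ℝ} {q : ℝ × ℝ} (h : ConstRel c q) : IsNoSwirl c (aff q) where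
  smooth := (contDiff_aff q).contDiffOn
  eq x _ := by
    rw [(hasDerivAt_aff q x).deriv, P, h.fst, h.snd, h.thd, aff]
    ring

/-- Subtracting the two equations and using the integrating factor gives `y' = -y² ww (-a) (-d) /
2`. Under `x = tanh s` the coefficient becomes `ww (1 - a) (1 - d)`, which is bounded below because
`a, d ≥ 1`, and `s` ranges over the whole line, so `y = 0`. -/
lemma isNoSwirl_unique {c : Fin 3 → ℝ} {q : ℝ × ℝ} (h : ConstRel c q) {u : ℝ → ℝ}
    (hu : IsNoSwirl c u) : EqOn u (aff q) I1 := by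
  obtain ⟨a, d⟩ := q
  have ha : 1 ≤ a := h.one_le_fst
  have hd : 1 ≤ d := h.one_le_snd
  obtain ⟨K, hK, hw⟩ := ww_le_ww (s := 0) (r := 0) (s' := 1 - a) (r' := 1 - d) (by linarith)
    (by linarith)
  set y : ℝ → ℝ := fun x => ww (a - 1) (d - 1) x * (u x - aff (a, d) x) with hy
  have hud : ∀ x ∈ I1, HasDerivAt u (deriv u x) x := fun x hx =>
    ((hu.smooth.contDiffAt (isOpen_I1.mem_nhds hx)).differentiableAt (by simp)).hasDerivAt
  have hyd : ∀ x ∈ I1, HasDerivAt y (-(1 / 2) * y x ^ 2 * ww (-a) (-d) x) x := by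
    intro x hx
    refine ((hasDerivAt_ww_aff (a - 1) (d - 1) hx).mul
      ((hud x hx).sub (hasDerivAt_aff (a, d) x))).congr_deriv ?_
    have hp := (one_sub_sq_pos hx).ne'
    have e1 : aff (a - 1, d - 1) x = 2 * x + aff (a, d) x := by simp only [aff]; ring
    have e2 := hu.eq x hx
    have e3 := (isNoSwirl_aff h).eq x hx
    rw [(hasDerivAt_aff (a, d) x).deriv] at e3
    have e4 := ww_add (-a) (-d) (a - 1) (d - 1) hx
    have e5 := ww_neg 1 1 hx
    rw [ww_one] at e5
    rw [show -a + (a - 1) = -1 by ring, show -d + (d - 1) = -1 by ring, e5] at e4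
    have e6 : y x ^ 2 * ww (-a) (-d) x
        = ww (a - 1) (d - 1) x * (u x - aff (a, d) x) ^ 2 * (1 - x ^ 2)⁻¹ := by
      rw [e4]; simp only [hy]; ring
    rw [e1, mul_assoc, e6]
    simp only [Pi.sub_apply]
    field_simp
    linear_combination 2 * ww (a - 1) (d - 1) x * (e2 - e3)
  have hcomp : ∀ s, HasDerivAt (fun s => y (Real.tanh s))
      (-(1 / 2) * y (Real.tanh s) ^ 2 * ww (1 - a) (1 - d) (Real.tanh s)) s := by
    intro s
    refine ((hyd _ (tanh_mem_I1 s)).comp s (hasDerivAt_tanh s)).congr_deriv ?_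
    have := ww_add (-a) (-d) 1 1 (tanh_mem_I1 s)
    rw [ww_one, show -a + 1 = 1 - a by ring, show -d + 1 = 1 - d by ring] at this
    rw [this]
    ring
  intro x hx
  have h0 := eq_zero_of_riccati (κ := K⁻¹) (Y := fun s => y (Real.tanh s))
    (F := fun s => ww (1 - a) (1 - d) (Real.tanh s)) (inv_pos.2 hK)
    (fun s => by
      have := hw _ (tanh_mem_I1 s)
      rw [ww_zero] at this
      rwa [inv_le_iff_one_le_mul₀' hK]) hcomp (Real.artanh x)
  simp only [Real.tanh_artanh hx, hy] at h0
  exact sub_eq_zero.1 ((mul_eq_zero.1 h0).resolve_left (ww_pos _ _ hx).ne')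

/-! ### From the parameters to the exponents of the affine solution. -/

/-- The exponents attached to a parameter. -/
def qf (p : Param) : ℝ × ℝ := (1 + √(1 + p.1 0), 1 + √(1 + p.1 1))

lemma constRel_of_mem {k : ℕ} (hk5 : 5 ≤ k) (hk8 : k ≤ 8) {p : Param} (hp : p ∈ Ik k) :
    ConstRel p.1 (qf p) := by
  have hJ : -1 ≤ p.1 0 ∧ -1 ≤ p.1 1 ∧ p.1 2 = c3bar (p.1 0) (p.1 1) := by
    have h := hp.1
    interval_cases k
    · exact ⟨h.1.le, h.2.1.le, h.2.2⟩
    · exact ⟨h.1.ge, h.2.1.le, h.2.2⟩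
    · exact ⟨h.1.le, h.2.1.ge, h.2.2⟩
    · exact ⟨h.1.ge, h.2.1.ge, h.2.2⟩
  obtain ⟨h0, h1, h2⟩ := hJ
  refine ⟨?_, ?_, ?_, ?_, ?_⟩ <;> simp only [qf]
  · rw [add_sub_cancel_left, Real.sq_sqrt (by linarith)]; ring
  · rw [add_sub_cancel_left, Real.sq_sqrt (by linarith)]; ring
  · rw [h2, c3bar]; ring
  · linarith [Real.sqrt_nonneg (1 + p.1 0)]
  · linarith [Real.sqrt_nonneg (1 + p.1 1)]

/-- By uniqueness the supremum is taken over a single value. -/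
lemma gammaPlus_eq {c : Fin 3 → ℝ} {q : ℝ × ℝ} (h : ConstRel c q) : gammaPlus c = aff q 0 := by
  have : {γ | ∃ u, IsNoSwirl c u ∧ u 0 = γ} = {aff q 0} := by
    ext γ
    constructor
    · rintro ⟨u, hu, rfl⟩
      exact isNoSwirl_unique h hu zero_mem_I1
    · rintro rfl
      exact ⟨_, isNoSwirl_aff h, rfl⟩
  rw [gammaPlus, this, csSup_singleton]

lemma ubar_eqOn {p : Param} {q : ℝ × ℝ} (h : ConstRel p.1 q) (hγ : p.2 = gammaPlus p.1) :
    EqOn (Ubar p) (aff q) I1 := by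
  have hex : ∃ u, IsNoSwirl p.1 u ∧ u 0 = p.2 :=
    ⟨_, isNoSwirl_aff h, by rw [hγ, gammaPlus_eq h]⟩
  rw [Ubar, dif_pos hex]
  exact isNoSwirl_unique h hex.choose_spec.1

lemma ubarLeft_eq {p : Param} {q : ℝ × ℝ} (h : EqOn (Ubar p) (aff q) I1) :
    UbarLeft p = 2 * q.1 := by
  refine Tendsto.limUnder_eq ?_
  have h1 : Tendsto (aff q) (𝓝[>] (-1)) (𝓝 (2 * q.1)) := by
    have := (continuous_aff q).tendsto (-1)
    rw [show aff q (-1) = 2 * q.1 by simp only [aff]; ring] at this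
    exact this.mono_left nhdsWithin_le_nhds
  refine h1.congr' ?_
  filter_upwards [Ioo_mem_nhdsGT (show (-1 : ℝ) < 1 by norm_num)] with x hx using (h hx).symm

lemma ubarRight_eq {p : Param} {q : ℝ × ℝ} (h : EqOn (Ubar p) (aff q) I1) :
    UbarRight p = -(2 * q.2) := by
  refine Tendsto.limUnder_eq ?_
  have h1 : Tendsto (aff q) (𝓝[<] 1) (𝓝 (-(2 * q.2))) := by
    have := (continuous_aff q).tendsto 1
    rw [show aff q 1 = -(2 * q.2) by simp only [aff]; ring] at this
    exact this.mono_left nhdsWithin_le_nhds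
  refine h1.congr' ?_
  filter_upwards [Ioo_mem_nhdsLT (show (-1 : ℝ) < 1 by norm_num)] with x hx using (h hx).symm

/-- The logarithmic derivative of `ww a d` is `aff (a, d) / (1 - x²)`, the integrand of `b`, and `ww
a d` is `1` at `0`. So `V³` is the kernel element found by quadrature. -/
lemma exp_neg_b {p : Param} {q : ℝ × ℝ} (h : EqOn (Ubar p) (aff q) I1) {x : ℝ} (hx : x ∈ I1) :
    Real.exp (-b p x) = ww (-q.1) (-q.2) x := by
  have hb : b p x = Real.log (ww q.1 q.2 x) - Real.log (ww q.1 q.2 0) := by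
    have e : b p x = ∫ s in (0 : ℝ)..x, aff q s / (1 - s ^ 2) :=
      intervalIntegral.integral_congr fun s hs => by
        simp only [h (uIcc_subset_I1 zero_mem_I1 hx hs)]
    rw [e]
    refine intervalIntegral.integral_eq_sub_of_hasDerivAt
      (f := fun s => Real.log (ww q.1 q.2 s)) (fun s hs => ?_) ?_
    · have hs' := uIcc_subset_I1 zero_mem_I1 hx hs
      have hw := (ww_pos q.1 q.2 hs').ne'
      refine ((hasDerivAt_ww_aff q.1 q.2 hs').log hw).congr_deriv ?_
      field_simp
    · exact intervalIntegrable_I1 ((continuous_aff q).continuousOn.div (by fun_prop)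
        fun s hs => (one_sub_sq_pos hs).ne') zero_mem_I1 hx
  rw [hb, show ww q.1 q.2 0 = 1 by simp [ww], Real.log_one, sub_zero, Real.exp_neg,
    Real.exp_log (ww_pos _ _ hx), ww_neg _ _ hx]

lemma V3_eqOn {p : Param} {q : ℝ × ℝ} (h : EqOn (Ubar p) (aff q) I1) :
    EqOn (V3 p).2 (fun x => ∫ t in (0 : ℝ)..x, ww (-q.1) (-q.2) t) I1 := fun _ hx =>
  intervalIntegral.integral_congr fun _ ht => exp_neg_b h (uIcc_subset_I1 zero_mem_I1 hx ht)

/-- The boundary values are `2a ≥ 2` and `-2d ≤ -2`, so only the second alternative of each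
condition on `ε` applies, and it reads `a - 1 < ε`, respectively `d - 1 < ε`. -/
lemma goodExp_of_mem {k : ℕ} (hk5 : 5 ≤ k) (hk8 : k ≤ 8) {K : Set Param} (hKI : K ⊆ Ik k)
    {ε : ℝ} (hε : Admissible K ε) {p : Param} (hp : p ∈ K) : GoodExp ε (qf p) := by
  have hc := constRel_of_mem hk5 hk8 (hKI hp)
  have hU := ubar_eqOn hc (hKI hp).2.1
  have e1 := ubarLeft_eq hU
  have e2 := ubarRight_eq hU
  have h1 := hc.one_le_fst
  have h2 := hc.one_le_snd
  have g1 := hε.left_ge p hp (by linarith)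
  have g2 := hε.right_le p hp (by linarith)
  exact ⟨hε.pos, hε.lt_half, h1, h2, by linarith, by linarith⟩

/-- The exponents, as a function on `Ik k`, extend smoothly to an open set. -/
lemma exists_smooth_extension {k : ℕ} (hk5 : 5 ≤ k) (hk8 : k ≤ 8) :
    ∃ O : Set Param, IsOpen O ∧ Ik k ⊆ O ∧ ∃ g : Param → ℝ × ℝ, ContDiffOn ℝ ∞ g O ∧
      EqOn g qf (Ik k) := by
  have hc : ∀ i : Fin 3, Continuous fun p : Param => p.1 i := fun i => by fun_prop
  have hopen : ∀ i : Fin 3, IsOpen {p : Param | -1 < p.1 i} := fun i =>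
    isOpen_lt continuous_const (hc i)
  have hsq : ∀ i : Fin 3, ContDiffOn ℝ ∞ (fun p : Param => 1 + √(1 + p.1 i)) {p | -1 < p.1 i} :=
    fun i => by
      refine contDiffOn_const.add (ContDiffOn.sqrt (by fun_prop) fun p hp => ?_)
      have : -1 < p.1 i := hp
      linarith
  -- The square root is not smooth at `0`. On the sets where a coordinate of `c` equals `-1`
  -- identically, the exponent is constantly `1`, and that constant is used as the extension.
  interval_cases k
  · exact ⟨_, (hopen 0).inter (hopen 1), fun p hp => ⟨hp.1.1, hp.1.2.1⟩, qf,
      ((hsq 0).mono inter_subset_left).prodMk ((hsq 1).mono inter_subset_right), fun _ _ => rfl⟩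
  · refine ⟨_, hopen 1, fun p hp => hp.1.2.1, fun p => (1, 1 + √(1 + p.1 1)),
      contDiffOn_const.prodMk (hsq 1), fun p hp => ?_⟩
    have : p.1 0 = -1 := hp.1.1
    simp [qf, this]
  · refine ⟨_, hopen 0, fun p hp => hp.1.1, fun p => (1 + √(1 + p.1 0), 1),
      (hsq 0).prodMk contDiffOn_const, fun p hp => ?_⟩
    have : p.1 1 = -1 := hp.1.2.1
    simp [qf, this]
  · refine ⟨_, isOpen_univ, subset_univ _, fun _ => (1, 1), contDiffOn_const, fun p hp => ?_⟩
    have h0 : p.1 0 = -1 := hp.1.1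
    have h1 : p.1 1 = -1 := hp.1.2.1
    simp [qf, h0, h1]

/-! ### Deviations and solutions of the equations -/

lemma psi_congr {u v : ℝ → ℝ} (h : EqOn u v I1) {x : ℝ} (hx : x ∈ Icc (-1 : ℝ) 1) :
    psi u x = psi v x := by
  refine trip_congr (κ := fun s => 2 * u s * deriv u s / (1 - s ^ 2))
    (κ' := fun s => 2 * v s * deriv v s / (1 - s ^ 2)) (fun s hs => ?_) hx
  have hd : deriv u s = deriv v s :=
    (eventuallyEq_of_mem (isOpen_I1.mem_nhds hs) h).deriv_eq
  simp only [h hs, hd]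

lemma SolvesNSE.congr {U U' : Pair} {c : Fin 3 → ℝ} (h : SolvesNSE U c) (hU : Agree U' U) :
    SolvesNSE U' c where
  smooth_theta := h.smooth_theta.congr hU.1
  smooth_phi := h.smooth_phi.congr hU.2
  eq_theta x hx := by
    rw [(eventuallyEq_of_mem (isOpen_I1.mem_nhds hx) hU.1).deriv_eq, hU.1 hx,
      psi_congr hU.2 (I1_subset_Icc hx)]
    exact h.eq_theta x hx
  eq_phi x hx := by
    rw [iteratedDeriv_eqOn isOpen_I1 hU.2 hx,
      (eventuallyEq_of_mem (isOpen_I1.mem_nhds hx) hU.2).deriv_eq, hU.1 hx]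
    exact h.eq_phi x hx

lemma cHat_congr (p : Param) {w w' : Pair} (h : Agree w w') : cHat p w = cHat p w' := by
  have hφ : EqOn (phi p w.1) (phi p w'.1) I1 := fun x hx => by
    simp only [phi]
    rw [(eventuallyEq_of_mem (isOpen_I1.mem_nhds hx) h.1).deriv_eq, h.1 hx]
  simp only [cHat]
  rw [psi_congr h.2 (by norm_num), psi_congr h.2 (by norm_num),
    iteratedDeriv_eqOn isOpen_I1 hφ zero_mem_I1]

section

variable {ε : ℝ} {p : Param} {q : ℝ × ℝ}

lemma exists_thetaData_psi (hε0 : 0 < ε) (hε : ε < 1 / 2) (G : M2 ε) :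
    ∃ (C : ℝ) (h1 : ℝ → ℝ), ThetaData ε C (tripT (psiInt G G)) h1
      (fun x => ∫ s in (0 : ℝ)..x, psiInt G G s) := by
  obtain ⟨K, -, h⟩ := exists_thetaData_tripT hε0 hε
  obtain ⟨-, -, hd⟩ := h (2 * ‖G‖ * ‖G‖) (psiInt G G) (by positivity) (continuousOn_psiInt G G)
    fun x hx => abs_psiInt_le G G hx
  exact ⟨_, _, hd⟩

/-- A deviation gives a solution of the equations with the expected constants. -/
lemma IsDeviation.solvesNSE (hε0 : 0 < ε) (hε : ε < 1 / 2) (hc : ConstRel p.1 q)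
    (hU : EqOn (Ubar p) (aff q) I1) {β : Beta} {f : M1 ε} {G : M2 ε}
    (h : IsDeviation (q, β) (f, G)) : SolvesNSE (aff q + f.fn, G.fn) (cHat p (f.fn, G.fn)) := by
  obtain ⟨l, hl⟩ := h.theta_eq
  simp only at hl
  obtain ⟨C, h1, H⟩ := exists_thetaData_psi hε0 hε G
  have hsq : ∀ x : ℝ, HasDerivAt (fun x : ℝ => l * (1 - x ^ 2)) (l * -(2 * x)) x := fun x => by
    simpa using ((hasDerivAt_pow 2 x).const_sub 1).const_mul l
  have hlin : ∀ x : ℝ, HasDerivAt (fun x : ℝ => l * -(2 * x)) (-(2 * l)) x := fun x =>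
    ((((hasDerivAt_id' x).const_mul 2).neg).const_mul l).congr_deriv (by ring)
  have hφ : EqOn (phi p f.fn) (fun x => l * (1 - x ^ 2) - tripT (psiInt G G) x) Ih := by
    intro x hx
    have hx' := Ih_subset_I1 hx
    simp only [phi, hU hx']
    linear_combination hl x hx'
  have hd2 : EqOn (iteratedDeriv 2 fun x => l * (1 - x ^ 2) - tripT (psiInt G G) x)
      (fun x => -(2 * l) - ∫ s in (0 : ℝ)..x, psiInt G G s) Ih :=
    iteratedDeriv_succ_eqOn isOpen_Ih (fun x hx => (hsq x).sub (H.deriv1 x hx))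
      (iteratedDeriv_succ_eqOn isOpen_Ih (fun x hx => (hlin x).sub (H.deriv2 x hx))
        (by simp [EqOn]))
  -- The second derivative of `tripT` is an integral from `0` to `x`, hence is `0` at `x = 0`; this
  -- is why `l` can be read off from `φ` there.
  have hl2 : iteratedDeriv 2 (phi p f.fn) 0 = -(2 * l) := by
    rw [iteratedDeriv_eqOn isOpen_Ih hφ zero_mem_Ih, hd2 zero_mem_Ih]
    simp
  refine ⟨(contDiff_aff q).contDiffOn.add f.mem.smooth, G.mem.smooth, fun x hx => ?_,
    fun x hx => h.phi_eq x hx⟩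
  have h0 := (isNoSwirl_aff hc).eq x hx
  have hx1 := hl x hx
  have hd : deriv (aff q + f.fn) x = deriv (aff q) x + deriv f.fn x :=
    deriv_add (hasDerivAt_aff q x).differentiableAt (f.hasDerivAt hx).differentiableAt
  simp only [cHat, P, hl2, Matrix.cons_val_zero, Matrix.cons_val_one, Matrix.cons_val, hd,
    Pi.add_apply, psi_eq_trip]
  simp only [P] at h0
  simp only [tripT] at hx1
  linear_combination h0 + hx1

/-- A solution of the equations close to a no-swirl solution is given by a deviation. -/
lemma isDeviation_of_solvesNSE (hε0 : 0 < ε) (hε : ε < 1 / 2) (hc : ConstRel p.1 q)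
    {c : Fin 3 → ℝ} {f : M1 ε} {G : M2 ε} (h : SolvesNSE (aff q + f.fn, G.fn) c) :
    IsDeviation (q, !₂[deriv G.fn 0, G.fn 0]) (f, G) := by
  obtain ⟨C, h1, H⟩ := exists_thetaData_psi hε0 hε G
  -- `A` and `B` measure the failure of the formulas for `ĉ₁` and `ĉ₂`. All terms of `E` tend to `0`
  -- at `±1`, while the right-hand side of the equation for `E` tends to `2A` at `-1` and `2B` at
  -- `1`, so both vanish.
  set A := c 0 - p.1 0 - (1 / 2) * trip (psiInt G G) (-1) with hA
  set B := c 1 - p.1 1 - (1 / 2) * trip (psiInt G G) 1 with hB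
  set l := c 2 - p.1 2 with hl
  set E : ℝ → ℝ := fun x => (1 - x ^ 2) * deriv f.fn x + (2 * x + aff q x) * f.fn x
    + (1 / 2) * f.fn x ^ 2 + tripT (psiInt G G) x with hE
  have hEeq : ∀ x ∈ I1, E x = A * (1 - x) + B * (1 + x) + l * (1 - x ^ 2) := fun x hx => by
    have h0 := (isNoSwirl_aff hc).eq x hx
    have h2 := h.eq_theta x hx
    have hd : deriv (aff q + f.fn) x = deriv (aff q) x + deriv f.fn x :=
      deriv_add (hasDerivAt_aff q x).differentiableAt (f.hasDerivAt hx).differentiableAt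
    simp only [P, hd, Pi.add_apply, psi_eq_trip] at h0 h2
    simp only [hE, hA, hB, hl, tripT]
    linear_combination h2 - h0
  have hEb : ∀ x ∈ I1, |E x| ≤ (‖f‖ + (2 + 4 * ‖q‖) * ‖f‖ + (1 / 2) * (‖f‖ * ‖f‖) + C)
      * ww (1 - 2 * ε) (1 - 2 * ε) x := by
    intro x hx
    rw [← wt_eq_ww _ hx]
    have hw := wt_pos (1 - 2 * ε) x hx
    have b0 := f.abs_fn_le_wt hx
    have hp := one_sub_sq_pos hx
    have t1 : |(1 - x ^ 2) * deriv f.fn x| ≤ ‖f‖ * wt (1 - 2 * ε) x := by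
      have := (abs_le_mul_wt_neg hx).1 (f.bound1 hx)
      have e : wt (1 - 2 * ε) x = (1 - x ^ 2) * wt (-(2 * ε)) x := by
        rw [← wt_one, ← wt_add _ _ hx]; congr 1
      rw [abs_mul, abs_of_pos hp, e, mul_left_comm]
      exact mul_le_mul_of_nonneg_left this hp.le
    have t2 : |(2 * x + aff q x) * f.fn x| ≤ (2 + 4 * ‖q‖) * (‖f‖ * wt (1 - 2 * ε) x) := by
      rw [abs_mul]
      refine mul_le_mul ((abs_add_le _ _).trans (add_le_add ?_ (abs_aff_le q hx))) b0 (abs_nonneg _)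
        (by positivity)
      exact abs_le.2 ⟨by linarith [hx.1], by linarith [hx.2]⟩
    have t3 : |(1 / 2) * f.fn x ^ 2| ≤ (1 / 2) * (‖f‖ * (‖f‖ * wt (1 - 2 * ε) x)) := by
      rw [abs_mul, abs_of_pos (by norm_num : (0 : ℝ) < 1 / 2), abs_pow, sq]
      exact mul_le_mul_of_nonneg_left
        (mul_le_mul (f.abs_fn_le hε hx) b0 (abs_nonneg _) (norm_nonneg _)) (by norm_num)
    calc |E x| ≤ |(1 - x ^ 2) * deriv f.fn x| + |(2 * x + aff q x) * f.fn x|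
          + |(1 / 2) * f.fn x ^ 2| + |tripT (psiInt G G) x| :=
          (abs_add_le _ _).trans (add_le_add_left ((abs_add_le _ _).trans
            (add_le_add_left (abs_add_le _ _) _)) _)
      _ ≤ _ := add_le_add (add_le_add (add_le_add t1 t2) t3) (H.bdd0 x hx)
      _ = _ := by ring
  obtain ⟨lim1, lim2⟩ := tendsto_zero_of_le_ww (by linarith) (by linarith) hEb
  have hcont : Continuous fun x : ℝ => A * (1 - x) + B * (1 + x) + l * (1 - x ^ 2) := by fun_prop
  have hA0 : A = 0 := by
    have h1 := (hcont.tendsto (-1)).mono_left (nhdsWithin_le_nhds (s := Ioi (-1)))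
    have h2 : Tendsto (fun x : ℝ => A * (1 - x) + B * (1 + x) + l * (1 - x ^ 2)) (𝓝[>] (-1))
        (𝓝 0) := lim1.congr' (by
      filter_upwards [Ioo_mem_nhdsGT (show (-1 : ℝ) < 1 by norm_num)] with x hx using hEeq x hx)
    have := tendsto_nhds_unique h1 h2
    norm_num at this
    exact this
  have hB0 : B = 0 := by
    have h1 := (hcont.tendsto 1).mono_left (nhdsWithin_le_nhds (s := Iio 1))
    have h2 : Tendsto (fun x : ℝ => A * (1 - x) + B * (1 + x) + l * (1 - x ^ 2)) (𝓝[<] 1)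
        (𝓝 0) := lim2.congr' (by
      filter_upwards [Ioo_mem_nhdsLT (show (-1 : ℝ) < 1 by norm_num)] with x hx using hEeq x hx)
    have := tendsto_nhds_unique h1 h2
    norm_num at this
    exact this
  refine ⟨⟨l, fun x hx => ?_⟩, fun x hx => h.eq_phi x hx, rfl, rfl⟩
  have := hEeq x hx
  rw [hA0, hB0] at this
  simp only [hE] at this
  linear_combination this

end

/-! ### The projection onto `X₃` -/

lemma M2.abs_val_zero_le {ε : ℝ} (G : M2 ε) : |G.fn 0| ≤ ‖G‖ := by
  simpa [wt] using G.bound0 zero_mem_I1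

lemma M2.abs_deriv_zero_le {ε : ℝ} (G : M2 ε) : |deriv G.fn 0| ≤ ‖G‖ := by
  simpa [wt] using G.bound1 zero_mem_I1

/-- A continuous projection onto `X₃`. -/
lemma exists_projX3 {ε : ℝ} (hε0 : 0 < ε) (hε : ε < 1 / 2) :
    ∃ T : M1 ε × M2 ε →L[ℝ] X3 ε, ∀ f G, G.fn 0 = 0 → deriv G.fn 0 = 0 →
      (T (f, G) : X ε).fst = f ∧ (T (f, G) : X ε).snd = G := by
  obtain ⟨J, hJ, hJ1, -⟩ := exists_one hε0
  -- Any element with value `0` and derivative `1` at `0` serves here; the exponents `(1, 1)` are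
  -- admissible for every `ε` in the range.
  obtain ⟨H, -, -, hH0, hH1⟩ := exists_phi_kernel (ε := ε) (q := (1, 1))
    ⟨hε0, hε, le_rfl, le_rfl, by linarith, by linarith⟩
  have hJ0 : J.fn 0 = 1 := hJ zero_mem_I1
  have hJ10 : deriv J.fn 0 = 0 := hJ1 zero_mem_I1
  let v0 : M2 ε →L[ℝ] ℝ := LinearMap.mkContinuous
    { toFun := fun G => G.fn 0, map_add' := fun _ _ => rfl, map_smul' := fun _ _ => rfl } 1
    fun G => by rw [one_mul]; exact G.abs_val_zero_le
  let v1 : M2 ε →L[ℝ] ℝ := LinearMap.mkContinuous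
    { toFun := fun G => deriv G.fn 0, map_add' := fun G G' => M2.deriv_add G G' zero_mem_I1
      map_smul' := fun t G => M2.deriv_smul t G 0 } 1
    fun G => by rw [one_mul]; exact G.abs_deriv_zero_le
  let S : M2 ε →L[ℝ] M2 ε := .id ℝ _ + (-v1).smulRight H + (-v0).smulRight J
  have hS : ∀ G, S G = G + (-deriv G.fn 0) • H + (-G.fn 0) • J := fun G => rfl
  let R : M1 ε × M2 ε →L[ℝ] X ε :=
    ((WithLp.prodContinuousLinearEquiv 1 ℝ (M1 ε) (M2 ε)).symm : M1 ε × M2 ε →L[ℝ] X ε) ∘L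
      (ContinuousLinearMap.prodMap (.id ℝ (M1 ε)) S)
  have hR1 : ∀ f G, (R (f, G)).fst = f := fun _ _ => rfl
  have hR2 : ∀ f G, (R (f, G)).snd = S G := fun _ _ => rfl
  refine ⟨R.codRestrict (X3 ε) ?_, fun f G h0 h1 => ⟨rfl, ?_⟩⟩
  · rintro ⟨f, G⟩
    refine ⟨?_, ?_⟩
    · change deriv (R (f, G)).snd.fn 0 = 0
      rw [hR2, hS, M2.deriv_add _ _ zero_mem_I1, M2.deriv_add _ _ zero_mem_I1, M2.deriv_smul,
        M2.deriv_smul, hH1, hJ10]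
      ring
    · change (R (f, G)).snd.fn 0 = 0
      rw [hR2, hS]
      simp only [M2.fn_add, M2.fn_smul, Pi.add_apply, Pi.smul_apply, smul_eq_mul, hH0, hJ0]
      ring
  · change S G = G
    rw [hS, h0, h1]
    simp

end HomNS

end

/-! ### The remainder `V` as the branch minus its linear part. -/

theorem theorem3p3 (k : ℕ) (hk5 : 5 ≤ k) (hk8 : k ≤ 8)
    (K : Set HomNS.Param) (hK : IsCompact K) (hKI : K ⊆ HomNS.Ik k)
    (ε : ℝ) (hε : HomNS.Admissible K ε) :
    ∃ δ : ℝ, 0 < δ ∧ ∃ V : HomNS.Param → HomNS.Beta → HomNS.X3 ε,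
      (∃ O : Set HomNS.Param, IsOpen O ∧ K ⊆ O ∧
        ContDiffOn ℝ ∞ (fun q : HomNS.Param × HomNS.Beta => V q.1 q.2) (O ×ˢ ball 0 δ)) ∧
      (∀ p ∈ K, V p 0 = 0) ∧
      (∀ p ∈ K, HasFDerivAt (V p) (0 : HomNS.Beta →L[ℝ] HomNS.X3 ε) 0) ∧
      (∀ p ∈ K, ∀ β ∈ ball (0 : HomNS.Beta) δ,
        HomNS.SolvesNSE (HomNS.ansatz p β (V p β : HomNS.X ε))
          (HomNS.cHat p (HomNS.ansatz p β (V p β : HomNS.X ε) - HomNS.Ucg p))) ∧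
      ∃ δ' : ℝ, 0 < δ' ∧ ∀ p ∈ K, ∀ (U : HomNS.Pair) (W : HomNS.X ε),
        HomNS.Agree (U - HomNS.Ucg p) (HomNS.toPair W) → ‖W‖ < δ' →
        (∃ chat : Fin 3 → ℝ, HomNS.SolvesNSE U chat) →
        ∃ β ∈ ball (0 : HomNS.Beta) δ,
          HomNS.Agree U (HomNS.ansatz p β (V p β : HomNS.X ε)) := by
  open HomNS in
  have hε0 := hε.pos
  have hεh := hε.lt_half
  have hqc : Continuous qf := by unfold qf; fun_prop
  set Q := qf '' K with hQ
  have hQc : IsCompact Q := hK.image hqc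
  have hgood : ∀ p ∈ K, GoodExp ε (qf p) := fun p hp => goodExp_of_mem hk5 hk8 hKI hε hp
  have hrel : ∀ p ∈ K, ConstRel p.1 (qf p) := fun p hp => constRel_of_mem hk5 hk8 (hKI hp)
  have hUb : ∀ p ∈ K, EqOn (Ubar p) (aff (qf p)) I1 := fun p hp =>
    ubar_eqOn (hrel p hp) (hKI hp).2.1
  obtain ⟨O, hO, hQO, ρ, hρ, w, hw, hsol, hlin⟩ := exists_deviation_branch hε0 hεh hQc
    (by rintro _ ⟨p, hp, rfl⟩; exact hgood p hp)
  obtain ⟨O₁, hO₁, hIk, g, hg, hgq⟩ := exists_smooth_extension hk5 hk8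
  obtain ⟨T, hT⟩ := exists_projX3 hε0 hεh
  obtain ⟨J, hJ, hJ1, hJ2⟩ := exists_one hε0
  -- Compactness of `Q` gives one radius `δ` valid for all parameters in `K`.
  obtain ⟨u, v, hu, hv, hQu, h0v, huv⟩ := generalized_tube_lemma hQc isCompact_singleton hO hQO
  obtain ⟨δ, hδ, hδv⟩ := Metric.isOpen_iff.1 hv 0 (h0v rfl)
  have hgK : ∀ p ∈ K, g p = qf p := fun p hp => hgq (hKI hp)
  have hO₂ : IsOpen (O₁ ∩ g ⁻¹' u) := hg.continuousOn.isOpen_inter_preimage hO₁ hu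
  have hmem : ∀ p ∈ K, ∀ β ∈ ball (0 : Beta) δ, (qf p, β) ∈ O := fun p hp β hβ =>
    huv ⟨hQu ⟨p, hp, rfl⟩, hδv hβ⟩
  -- The projection `T` makes `V` take values in `X₃` for all `p`, also off `K`. On `K` it changes
  -- nothing, since the branch and its linear part have the same Cauchy data `β` at `0`.
  set V : Param → Beta → X3 ε := fun p β =>
    T (w (g p, β) - fderiv ℝ w (g p, 0) (0, β)) with hV
  have hker : ∀ p ∈ K, ∃ H : M2 ε, EqOn (V3 p).2 H.fn I1 ∧ H.fn 0 = 0 ∧ deriv H.fn 0 = 1 ∧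
      ∀ β : Beta, fderiv ℝ w (qf p, 0) (0, β) = (0, β 0 • H + β 1 • J) := by
    intro p hp
    obtain ⟨H, hH, hHs, hH0, hH1⟩ := exists_phi_kernel (hgood p hp)
    refine ⟨H, (V3_eqOn (hUb p hp)).trans hH.symm, hH0, hH1, fun β => ?_⟩
    have := (hlin (qf p) ⟨p, hp, rfl⟩).2 H J hHs hH0 hH1 hJ hJ1 hJ2
    rw [← linPart_apply, ← this]
    simp
  have hans : ∀ p ∈ K, ∀ β ∈ ball (0 : Beta) δ,
      Agree (ansatz p β (V p β : X ε)) (aff (qf p) + (w (qf p, β)).1.fn, (w (qf p, β)).2.fn) := by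
    intro p hp β hβ
    obtain ⟨H, hH, hH0, hH1, hD⟩ := hker p hp
    have hdev := (hsol _ (hmem p hp β hβ)).1
    have d0 := hdev.val_zero
    have d1 := hdev.deriv_zero
    have e : V p β = T ((w (qf p, β)).1,
        (w (qf p, β)).2 + (-1 : ℝ) • (β 0 • H + β 1 • J)) := by
      simp only [hV]
      rw [hgK p hp, hD]
      congr 1
      ext1
      · simp
      · simp [sub_eq_add_neg, add_comm]
    have hJ0 : J.fn 0 = 1 := hJ zero_mem_I1
    have hJ10 : deriv J.fn 0 = 0 := hJ1 zero_mem_I1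
    obtain ⟨e1, e2⟩ := hT (w (qf p, β)).1 ((w (qf p, β)).2 + (-1 : ℝ) • (β 0 • H + β 1 • J))
      (by
        simp only [M2.fn_add, M2.fn_smul, Pi.add_apply, Pi.smul_apply, smul_eq_mul]
        rw [d0, hH0, hJ0]
        ring)
      (by
        rw [M2.deriv_add _ _ zero_mem_I1, M2.deriv_smul, M2.deriv_add _ _ zero_mem_I1,
          M2.deriv_smul, M2.deriv_smul, d1, hH1, hJ10]
        ring)
    rw [← e] at e1 e2
    constructor
    · intro x hx
      simp only [ansatz, toPair, Ucg, V3, V4, e1, Prod.fst_add, Prod.smul_fst, Pi.add_apply,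
        smul_zero, add_zero, hUb p hp hx]
    · intro x hx
      have h3 := hH hx
      have hJx : J.fn x = 1 := hJ hx
      simp only [ansatz, toPair, Ucg, V4, e2, Prod.snd_add, Prod.smul_snd, Pi.add_apply,
        Pi.smul_apply, Pi.zero_apply, Pi.one_apply, M2.fn_add, M2.fn_smul, smul_eq_mul, h3, hJx]
      ring
  refine ⟨δ, hδ, V, ⟨O₁ ∩ g ⁻¹' u, hO₂, fun p hp => ⟨hIk (hKI hp), ?_⟩, ?_⟩, fun p hp => ?_,
    fun p hp => ?_, fun p hp β hβ => ?_, min ρ (δ / 2), lt_min hρ (half_pos hδ), ?_⟩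
  · rw [mem_preimage, hgK p hp]
    exact hQu ⟨p, hp, rfl⟩
  · have hg' : ContDiffOn ℝ ∞ (fun y : Param × Beta => g y.1) ((O₁ ∩ g ⁻¹' u) ×ˢ ball 0 δ) :=
      hg.comp contDiffOn_fst fun y hy => hy.1.1
    have hw1 : ContDiffOn ℝ ∞ (fun y : Param × Beta => w (g y.1, y.2))
        ((O₁ ∩ g ⁻¹' u) ×ˢ ball 0 δ) :=
      hw.comp (hg'.prodMk contDiffOn_snd) fun y hy => huv ⟨hy.1.2, hδv hy.2⟩
    have hw2 : ContDiffOn ℝ ∞ (fun y : Param × Beta => fderiv ℝ w (g y.1, 0))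
        ((O₁ ∩ g ⁻¹' u) ×ˢ ball 0 δ) :=
      (hw.fderiv_of_isOpen hO (m := ∞) (by simp)).comp (hg'.prodMk contDiffOn_const)
        fun y hy => huv ⟨hy.1.2, h0v rfl⟩
    exact T.contDiff.comp_contDiffOn
      (hw1.sub (hw2.clm_apply (contDiffOn_const.prodMk contDiffOn_snd)))
  · simp only [hV]
    rw [hgK p hp, (hlin (qf p) ⟨p, hp, rfl⟩).1, ← Prod.zero_eq_mk, map_zero, sub_zero, map_zero]
  · have hd : HasFDerivAt w (fderiv ℝ w (qf p, 0)) (qf p, 0) :=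
      ((hw.contDiffAt (hO.mem_nhds (hmem p hp 0 (mem_ball_self hδ)))).differentiableAt
        (by simp)).hasFDerivAt
    have hi : HasFDerivAt (fun β : Beta => (qf p, β)) (.inr ℝ (ℝ × ℝ) Beta) 0 :=
      hasFDerivAt_prodMk_right _ _
    -- The linear part subtracted in `V` is the derivative of the branch in `β`, so the two cancel.
    have h1 := (hd.comp (0 : Beta) hi).sub
      (fderiv ℝ w (qf p, 0) ∘L .inr ℝ (ℝ × ℝ) Beta).hasFDerivAt
    rw [sub_self] at h1
    have h2 := T.hasFDerivAt.comp (0 : Beta) h1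
    rw [ContinuousLinearMap.comp_zero] at h2
    simp only [hV]
    rw [hgK p hp]
    exact h2
  · have hag := hans p hp β hβ
    have hdev := (hsol _ (hmem p hp β hβ)).1
    have hs := IsDeviation.solvesNSE (f := (w (qf p, β)).1) (G := (w (qf p, β)).2) hε0 hεh
      (hrel p hp) (hUb p hp) hdev
    have hc : cHat p (ansatz p β (V p β : X ε) - Ucg p)
        = cHat p ((w (qf p, β)).1.fn, (w (qf p, β)).2.fn) := by
      refine cHat_congr p ⟨fun x hx => ?_, fun x hx => ?_⟩
      · have := hag.1 hx
        simp only [Prod.fst_sub, Pi.sub_apply, Ucg, this, Pi.add_apply, hUb p hp hx]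
        ring
      · have := hag.2 hx
        simp only [Prod.snd_sub, Pi.sub_apply, Ucg, this, Pi.zero_apply, sub_zero]
    rw [hc]
    exact hs.congr hag
  · rintro p hp U W hUW hWn ⟨c, hUs⟩
    have hag : Agree U (aff (qf p) + W.fst.fn, W.snd.fn) := by
      refine ⟨fun x hx => ?_, fun x hx => ?_⟩
      · have := hUW.1 hx
        simp only [Prod.fst_sub, Pi.sub_apply, Ucg, toPair, hUb p hp hx] at this
        simp only [Pi.add_apply]
        linarith
      · have := hUW.2 hx
        simpa only [Prod.snd_sub, Pi.sub_apply, Ucg, toPair, Pi.zero_apply, sub_zero] using this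
    have hag' : Agree (aff (qf p) + W.fst.fn, W.snd.fn) U := ⟨hag.1.symm, hag.2.symm⟩
    have hdev := isDeviation_of_solvesNSE hε0 hεh (hrel p hp) (hUs.congr hag')
    set β : Beta := !₂[deriv W.snd.fn 0, W.snd.fn 0] with hβ
    have hnorm : ‖W‖ = ‖W.fst‖ + ‖W.snd‖ := by
      rw [WithLp.prod_norm_eq_of_L1]
    have hW1 := norm_nonneg W.fst
    have hW2 := norm_nonneg W.snd
    have hWρ := hWn.trans_le (min_le_left _ _)
    have hWδ := hWn.trans_le (min_le_right _ _)
    -- Both components of `β` are bounded by `‖W‖ < δ / 2`, so `|β|² < δ² / 2`.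
    have hβb : β ∈ ball (0 : Beta) δ := by
      rw [mem_ball_zero_iff, EuclideanSpace.norm_eq, Real.sqrt_lt' hδ, Fin.sum_univ_two]
      have b0 : ‖β 0‖ ≤ ‖W.snd‖ := W.snd.abs_deriv_zero_le
      have b1 : ‖β 1‖ ≤ ‖W.snd‖ := W.snd.abs_val_zero_le
      have := pow_le_pow_left₀ (norm_nonneg _) b0 2
      have := pow_le_pow_left₀ (norm_nonneg _) b1 2
      nlinarith
    -- The branch lives in the product with the maximum norm, which is at most the sum norm of `X`.
    have hz : ‖(W.fst, W.snd)‖ < ρ := by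
      rw [Prod.norm_mk]
      exact max_lt (by linarith) (by linarith)
    have heq := (hsol _ (hmem p hp β hβb)).2 _ hz hdev
    have h2 := hans p hp β hβb
    rw [← heq] at h2
    exact ⟨β, hβb, hag.1.trans h2.1.symm, hag.2.trans h2.2.symm⟩
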